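/- An NFA $\mathcal A=(Q,\delta,s)$ over a finite non-empty alphabet $\Sigma$ with a strict total order $<$ consists of a finite set $Q$ of states, a transition function $\delta:Q\times\Sigma\to 2^Q$ and a source state $s\in Q$; write $\delta_a(T)=\bigcup_{u\in T}\delta(u,a)$ for $T\subseteq Q$, and $|\delta|$ for the number of transitions, i.e. of triples $(u,a,v)$ with $v\in\delta(u,a)$. Assume throughout that $s$ has no in-going transitions, that every state is reachable from $s$, that $\mathcal A$ is input-consistent (all transitions entering a state $v\neq s$ carry the same letter $\lambda(v)$), and that every letter labels at least one transition. A partition of $Q$ is forward-stable if for any two parts $S,T$ and every $a\in\Sigma$ either $S\subseteq\delta_a(T)$ or $S\cap\delta_a(T)=\emptyset$; the coarsest forward-stable partition is the one that every forward-stable partition refines. For an equivalence relation $\sim$ on $Q$, the quotient automaton $\mathcal A/_\sim$ has the classes as states, source $[s]$, and $[v]\in\delta([u],a)$ iff $v'\in\delta(u',a)$ for some $u'\sim u$, $v'\sim v$. A Wheeler order of an NFA is a strict total order $\prec$ on its states in which the source comes first and such that for all $v\in\delta_a(u)$, $v'\in\delta_{a'}(u')$: if $a<a'$ then $v\prec v'$;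 and if $a=a'$, $u\prec u'$ and $v\ne v'$ then $v\prec v'$. A Wheeler preorder of $\mathcal A$ is a total preorder $\preceq$ on $Q$ such that the classes of the induced equivalence $\sim$ form the coarsest forward-stable partition and the strict order induced by $\preceq$ on the classes is a Wheeler order of $\mathcal A/_\sim$. $\mathcal A$ is quasi-Wheeler if it has a Wheeler preorder. Ordered partition refinement maintains two ordered partitions of $Q$, starting with $\mathcal P=\langle \{s\},Q_{a_1},\dots,Q_{a_k}\rangle$ and $\mathcal X=\langle Q\rangle$, where $a_1<\dots<a_k$ are the letters and $Q_a=\{v\in Q\setminus\{s\}:\lambda(v)=a\}$. While $\mathcal X\ne\mathcal P$: let $S$ be the first block of $\mathcal X$ that contains at least two blocks of $\mathcal P$; let $B$ be the smaller in size of the first and the last block of $\mathcal P$ contained in $S$ (ties broken arbitrarily); replace $S$ in $\mathcal X$ by $B,\,S\setminus B$ if $B$ is the first block, and by $S\setminus B,\,B$ if it is the last one; and replace every block $D$ of $\mathcal P$, in place, by the non-empty ones among $D_{12},D_{11},D_2$ in this order if $B$ is the first block, and among $D_2,D_{11},D_{12}$ in this order if it is the last one, where, with $a$ the letter of the transitions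 entering $D$, $D_1=D\cap\delta_a(B)$, $D_2=D\setminus D_1$, $D_{11}=D_1\cap\delta_a(S\setminus B)$, $D_{12}=D_1\setminus D_{11}$ (the block $\{s\}$ stays as it is). When the loop ends, $\mathcal P$ is returned. Theorem. For every such $\mathcal A$, ordered partition refinement terminates, and the returned ordered partition defines a total preorder on $Q$ (ordering states by the position of their part) which is a Wheeler preorder if and only if $\mathcal A$ is quasi-Wheeler. Moreover, on a unit-cost random access machine whose only arithmetic operations are adding and subtracting one, there is one program that, given any such $\mathcal A$ as a list of its transitions with states numbered from $0$ to $|Q|-1$ and letters numbered in increasing order, computes an ordered partition returned by the algorithm in $O(|\delta|\log|Q|)$ steps, with a constant independent of $\mathcal A$ and of $\Sigma$. -/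

import Mathlib

/-! ### Nondeterministic automata with a source state and without final states -/

/-- A nondeterministic automaton `(Q, δ, s)` over the alphabet `Sig`, without final states:
`step u a` is `δ_a(u)` and `src` is the source state `s`. -/
structure SourceNFA (Sig Q : Type*) where
  step : Q → Sig → Set Q
  src : Q

namespace SourceNFA

variable {Sig Q : Type*}

/-- The set of all transitions, as triples `(u, a, v)` with `v ∈ δ_a(u)`. -/
def transitions (A : SourceNFA Sig Q) : Set (Q × Sig × Q) :=
  {t | t.2.2 ∈ A.step t.1 t.2.1}

/-- `δ_a(T)`, the union of the sets `δ_a(u)` over `u ∈ T`. -/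
def img (A : SourceNFA Sig Q) (a : Sig) (T : Set Q) : Set Q :=
  {v | ∃ u ∈ T, v ∈ A.step u a}

/-- Input-consistency: the transitions that enter a state `v ≠ s` exist and all carry the same
letter. -/
def InputConsistent (A : SourceNFA Sig Q) : Prop :=
  ∀ v, v ≠ A.src → ∃! a, ∃ u, v ∈ A.step u a

/-- The standing assumptions on an automaton. -/
structure Standard (A : SourceNFA Sig Q) : Prop where
  /-- the source has no in-going transitions -/
  not_mem_src : ∀ u a, A.src ∉ A.step u a
  /-- every state is reachable from the source -/
  reachable : ∀ v, Relation.ReflTransGen (fun u w => ∃ a, w ∈ A.step u a) A.src v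
  inputConsistent : A.InputConsistent
  /-- every letter labels at least one transition -/
  letter_used : ∀ a, ∃ u v, v ∈ A.step u a

/-! ### Forward-stable partitions -/

/-- `S` is forward-stable with respect to `T`. -/
def FwdStable (A : SourceNFA Sig Q) (S T : Set Q) : Prop :=
  ∀ a, S ⊆ A.img a T ∨ S ∩ A.img a T = ∅

/-- The partition into the classes of `E` is forward-stable. -/
def FwdStablePartition (A : SourceNFA Sig Q) (E : Setoid Q) : Prop :=
  ∀ S ∈ E.classes, ∀ T ∈ E.classes, A.FwdStable S T

/-- The partition into the classes of `E` is the coarsest forward-stable one: it is forward-stable,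
and every forward-stable partition refines it. -/
def IsCoarsestFwdStable (A : SourceNFA Sig Q) (E : Setoid Q) : Prop :=
  A.FwdStablePartition E ∧ ∀ F : Setoid Q, A.FwdStablePartition F → F ≤ E

/-! ### Wheeler orders, Wheeler preorders, quasi-Wheeler automata -/

/-- `lt` is a Wheeler order of the states of `A`. -/
structure IsWheelerOrder [LT Sig] (A : SourceNFA Sig Q) (lt : Q → Q → Prop) : Prop where
  irrefl : ∀ u, ¬ lt u u
  trans : ∀ u v w, lt u v → lt v w → lt u w
  total : ∀ u v, u ≠ v → lt u v ∨ lt v u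
  src_lt : ∀ v, v ≠ A.src → lt A.src v
  of_letter_lt : ∀ u v a u₂ v₂ a₂, v ∈ A.step u a → v₂ ∈ A.step u₂ a₂ →
    a < a₂ → lt v v₂
  of_lt : ∀ u v u₂ v₂ a, v ∈ A.step u a → v₂ ∈ A.step u₂ a →
    lt u u₂ → v ≠ v₂ → lt v v₂

/-- The quotient automaton: the classes of `E` are collapsed into single states. -/
def quotient (A : SourceNFA Sig Q) (E : Setoid Q) : SourceNFA Sig (Quotient E) where
  step x a := {y | ∃ u v, Quotient.mk E u = x ∧ Quotient.mk E v = y ∧ v ∈ A.step u a}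
  src := Quotient.mk E A.src

end SourceNFA

/-- `r` is a total preorder: reflexive, transitive and connected. -/
structure TotalPreorderRel {U : Type*} (r : U → U → Prop) : Prop where
  refl : ∀ u, r u u
  trans : ∀ u v w, r u v → r v w → r u w
  total : ∀ u v, r u v ∨ r v u

/-- The equivalence relation induced by a total preorder. -/
def TotalPreorderRel.toSetoid {U : Type*} {r : U → U → Prop} (h : TotalPreorderRel r) :
    Setoid U where
  r u v := r u v ∧ r v u
  iseqv := ⟨fun u => ⟨h.refl u, h.refl u⟩, fun p => ⟨p.2, p.1⟩,
    fun p q => ⟨h.trans _ _ _ p.1 q.1, h.trans _ _ _ q.2 p.2⟩⟩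

/-- The strict order that a total preorder induces on the equivalence classes:
`[u] ≺ [v]` iff `u ≼ v` and not `v ≼ u`. -/
def TotalPreorderRel.quotLT {U : Type*} {r : U → U → Prop} (h : TotalPreorderRel r)
    (x y : Quotient h.toSetoid) : Prop :=
  ∃ u v, Quotient.mk h.toSetoid u = x ∧ Quotient.mk h.toSetoid v = y ∧ r u v ∧ ¬ r v u

namespace SourceNFA

variable {Sig Q : Type*}

/-- `r` is a Wheeler preorder: a total preorder whose classes form the coarsest forward-stable
partition and whose induced strict order is a Wheeler order of the quotient automaton. -/
def IsWheelerPreorder [LT Sig] (A : SourceNFA Sig Q) (r : Q → Q → Prop) : Prop :=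
  ∃ h : TotalPreorderRel r, A.IsCoarsestFwdStable h.toSetoid ∧
    (A.quotient h.toSetoid).IsWheelerOrder h.quotLT

def QuasiWheeler [LT Sig] (A : SourceNFA Sig Q) : Prop :=
  ∃ r : Q → Q → Prop, A.IsWheelerPreorder r

end SourceNFA

/-! ### Ordered partitions, and ordered partition refinement -/

/-- The list `P` is an ordered partition of `Q`. -/
structure IsOrderedPartition {Q : Type*} (P : List (Set Q)) : Prop where
  nonempty : ∀ D ∈ P, D.Nonempty
  disjoint : P.Pairwise Disjoint
  cover : ∀ v, ∃ D ∈ P, v ∈ D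

/-- The preorder given by an ordered partition: the part of `u` is the part of `v` or precedes
it. -/
def partLE {Q : Type*} (P : List (Set Q)) (u v : Q) : Prop :=
  ∃ (i j : ℕ) (hi : i < P.length) (hj : j < P.length), i ≤ j ∧ u ∈ P[i] ∧ v ∈ P[j]

/-- The blocks of `P` contained in `S`, in the order of `P`. -/
noncomputable def blocksIn {Q : Type*} (P : List (Set Q)) (S : Set Q) : List (Set Q) :=
  open Classical in P.filter (fun D => D ⊆ S)

/-- `S` consists of multiple blocks of `P`. -/
def Compound {Q : Type*} (P : List (Set Q)) (S : Set Q) : Prop :=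
  2 ≤ (blocksIn P S).length

/-- The non-empty sets of a list, in the same order. -/
noncomputable def nonemptySets {Q : Type*} (P : List (Set Q)) : List (Set Q) :=
  open Classical in P.filter (fun D => D.Nonempty)

/-- The variables of the algorithm: the two ordered partitions `X` and `P`. -/
structure RefineConfig (Q : Type*) where
  X : List (Set Q)
  P : List (Set Q)

namespace SourceNFA

variable {Sig Q : Type*}

/-- The states with an in-going transition from `T`. As all transitions into the states of a block
`D` of the algorithm carry one and the same letter `a` (except for `D = {s}`, which is never
split), `D ∩ A.imgAll T` is `D ∩ δ_a(T)`. -/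
def imgAll (A : SourceNFA Sig Q) (T : Set Q) : Set Q := ⋃ a, A.img a T

/-- `D₁`: the states of `D` reached from the splitter `B`. -/
def part1 (A : SourceNFA Sig Q) (B D : Set Q) : Set Q := D ∩ A.imgAll B

/-- `D₂`: the states of `D` not reached from `B`. -/
def part2 (A : SourceNFA Sig Q) (B D : Set Q) : Set Q := D \ A.part1 B D

/-- `D₁₁`: the states of `D` reached both from `B` and from `S \ B`. -/
def part11 (A : SourceNFA Sig Q) (B S D : Set Q) : Set Q := A.part1 B D ∩ A.imgAll (S \ B)

/-- `D₁₂`: the states of `D` reached from `B` but not from `S \ B`. -/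
def part12 (A : SourceNFA Sig Q) (B S D : Set Q) : Set Q := A.part1 B D \ A.part11 B S D

/-- The ordered three-way split of a block `D` when the splitter is the first block in `S`. -/
noncomputable def splitFirst (A : SourceNFA Sig Q) (B S D : Set Q) : List (Set Q) :=
  nonemptySets [A.part12 B S D, A.part11 B S D, A.part2 B D]

/-- The ordered three-way split of a block `D` when the splitter is the last block in `S`. -/
noncomputable def splitLast (A : SourceNFA Sig Q) (B S D : Set Q) : List (Set Q) :=
  nonemptySets [A.part2 B D, A.part11 B S D, A.part12 B S D]

/-- Start of the algorithm: `X = ⟨Q⟩` and `P = ⟨Q_ε, Q_{a₁}, …, Q_{aₖ}⟩`, where `a₁ < … < aₖ` are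
the letters, `Q_ε = {s}`, and `Q_a = δ_a(Q)` consists of the states entered by the letter `a`. -/
noncomputable def refineInit [Fintype Sig] [LinearOrder Sig] (A : SourceNFA Sig Q) :
    RefineConfig Q where
  X := [Set.univ]
  P := {A.src} :: ((Finset.univ : Finset Sig).sort (· ≤ ·)).map (fun a => A.img a Set.univ)

/-- The body of the while loop. `S` is the first compound block of `X`, `F` and `L` are the first
and the last block of `P` contained in `S`, and the splitter is the smaller one of `F` and `L`
(either of them if they have the same size). -/
inductive RefineBody (A : SourceNFA Sig Q) : RefineConfig Q → RefineConfig Q → Prop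
  | first (X₁ X₂ P : List (Set Q)) (S F L : Set Q)
      (hX₁ : ∀ T ∈ X₁, ¬ Compound P T) (hS : Compound P S)
      (hF : (blocksIn P S).head? = some F) (hL : (blocksIn P S).getLast? = some L)
      (hFL : F.ncard ≤ L.ncard) :
      RefineBody A ⟨X₁ ++ S :: X₂, P⟩
        ⟨X₁ ++ F :: (S \ F) :: X₂, P.flatMap (A.splitFirst F S)⟩
  | last (X₁ X₂ P : List (Set Q)) (S F L : Set Q)
      (hX₁ : ∀ T ∈ X₁, ¬ Compound P T) (hS : Compound P S)
      (hF : (blocksIn P S).head? = some F) (hL : (blocksIn P S).getLast? = some L)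
      (hFL : L.ncard ≤ F.ncard) :
      RefineBody A ⟨X₁ ++ S :: X₂, P⟩
        ⟨X₁ ++ (S \ L) :: L :: X₂, P.flatMap (A.splitLast L S)⟩

/-- One iteration of the loop `while X ≠ P`. -/
def RefineIter (A : SourceNFA Sig Q) (c d : RefineConfig Q) : Prop :=
  c.X ≠ c.P ∧ A.RefineBody c d

/-- The algorithm can get to the configuration `c` at the head of the loop. -/
def RefineReaches [Fintype Sig] [LinearOrder Sig] (A : SourceNFA Sig Q) (c : RefineConfig Q) :
    Prop :=
  Relation.ReflTransGen A.RefineIter A.refineInit c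

/-- Some run of the algorithm leaves the loop and returns the ordered partition `P`. -/
def RefineReturns [Fintype Sig] [LinearOrder Sig] (A : SourceNFA Sig Q) (P : List (Set Q)) :
    Prop :=
  ∃ c, A.RefineReaches c ∧ c.X = c.P ∧ c.P = P

end SourceNFA

/-! ### A random access machine with unit costs -/

/-- A memory of the machine: registers and arrays, all holding natural numbers. -/
structure RamState where
  reg : ℕ → ℕ
  arr : ℕ → ℕ → ℕ

/-- Comparison of two registers. -/
inductive RamTest
  | lt (x y : ℕ)
  | le (x y : ℕ)
  | eq (x y : ℕ)
  | ne (x y : ℕ)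

def RamTest.Holds (s : RamState) : RamTest → Prop
  | lt x y => s.reg x < s.reg y
  | le x y => s.reg x ≤ s.reg y
  | eq x y => s.reg x = s.reg y
  | ne x y => s.reg x ≠ s.reg y

/-- Programs. The only arithmetic is adding and subtracting one, so that in `t` steps no number
exceeds the numbers of the input and of the program text by more than `t`: the cells are words of
logarithmic length. -/
inductive RamProg
  /-- `x := c` -/
  | const (x c : ℕ)
  /-- `x := y` -/
  | copy (x y : ℕ)
  /-- `x := x + 1` -/
  | inc (x : ℕ)
  /-- `x := x - 1`, where `0 - 1 = 0` -/
  | dec (x : ℕ)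
  /-- `x := a[y]` -/
  | load (x a y : ℕ)
  /-- `a[x] := y` -/
  | store (a x y : ℕ)
  | seq (p q : RamProg)
  | cond (b : RamTest) (p q : RamProg)
  | loop (b : RamTest) (p : RamProg)

def RamState.setReg (s : RamState) (x c : ℕ) : RamState :=
  { s with reg := Function.update s.reg x c }

def RamState.setArr (s : RamState) (a i c : ℕ) : RamState :=
  { s with arr := Function.update s.arr a (Function.update (s.arr a) i c) }

/-- `RamExec p s t s₂`: started in the memory `s`, the program `p` halts after exactly `t` steps
in the memory `s₂`. Every instruction and every evaluation of a test is one step. -/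
inductive RamExec : RamProg → RamState → ℕ → RamState → Prop
  | const (s : RamState) (x c : ℕ) : RamExec (.const x c) s 1 (s.setReg x c)
  | copy (s : RamState) (x y : ℕ) : RamExec (.copy x y) s 1 (s.setReg x (s.reg y))
  | inc (s : RamState) (x : ℕ) : RamExec (.inc x) s 1 (s.setReg x (s.reg x + 1))
  | dec (s : RamState) (x : ℕ) : RamExec (.dec x) s 1 (s.setReg x (s.reg x - 1))
  | load (s : RamState) (x a y : ℕ) :
      RamExec (.load x a y) s 1 (s.setReg x (s.arr a (s.reg y)))
  | store (s : RamState) (a x y : ℕ) :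
      RamExec (.store a x y) s 1 (s.setArr a (s.reg x) (s.reg y))
  | seq {p q : RamProg} {s s₁ s₂ : RamState} {t₁ t₂ : ℕ} :
      RamExec p s t₁ s₁ → RamExec q s₁ t₂ s₂ → RamExec (.seq p q) s (t₁ + t₂) s₂
  | condTrue {b : RamTest} {p q : RamProg} {s s₁ : RamState} {t : ℕ} :
      b.Holds s → RamExec p s t s₁ → RamExec (.cond b p q) s (t + 1) s₁
  | condFalse {b : RamTest} {p q : RamProg} {s s₁ : RamState} {t : ℕ} :
      ¬ b.Holds s → RamExec q s t s₁ → RamExec (.cond b p q) s (t + 1) s₁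
  | loopTrue {b : RamTest} {p : RamProg} {s s₁ s₂ : RamState} {t₁ t₂ : ℕ} :
      b.Holds s → RamExec p s t₁ s₁ → RamExec (.loop b p) s₁ t₂ s₂ →
      RamExec (.loop b p) s (t₁ + t₂ + 1) s₂
  | loopFalse {b : RamTest} {p : RamProg} {s : RamState} :
      ¬ b.Holds s → RamExec (.loop b p) s 1 s

/-! ### Automata as inputs of the machine -/

/-- `T` lists the transitions of `A`, each of them once, in any order. -/
def SourceNFA.Lists {Sig Q : Type*} (A : SourceNFA Sig Q) (T : List (Q × Sig × Q)) : Prop :=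
  T.Nodup ∧ ∀ t, t ∈ T ↔ t ∈ A.transitions

/-- The input memory for `A`, for a numbering `e` of the states, the numbering `f` of the letters
in increasing order, and a list `T` of the transitions. Registers `0, …, 3` hold `|Q|`, `|Sig|`,
`|T|` and the source state; the `i`-th entries of the arrays `0, 1, 2` hold the tail, the letter and
the head of the `i`-th transition. All other cells hold `0`. -/
def SourceNFA.encode {Sig Q : Type*} [LE Sig] (A : SourceNFA Sig Q)
    {n k : ℕ} (e : Q ≃ Fin n) (f : Sig ≃o Fin k) (T : List (Q × Sig × Q)) : RamState where
  reg
    | 0 => n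
    | 1 => k
    | 2 => T.length
    | 3 => e A.src
    | _ => 0
  arr
    | 0 => fun i => (T.map fun t => (e t.1 : ℕ)).getD i 0
    | 1 => fun i => (T.map fun t => (f t.2.1 : ℕ)).getD i 0
    | 2 => fun i => (T.map fun t => (e t.2.2 : ℕ)).getD i 0
    | _ => fun _ => 0

/-- The memory `s` holds the ordered partition `P`: entry number `e u` of array `3` is the position
(counted from `0`) in `P` of the part that contains `u`. -/
def HoldsPartition {Q : Type*} {n : ℕ} (e : Q ≃ Fin n) (s : RamState) (P : List (Set Q)) : Prop :=
  ∀ (i : ℕ) (hi : i < P.length), ∀ u ∈ P[i], s.arr 3 (e u) = i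

/-!
Correctness of ordered partition refinement, and a program that runs it in time
`O(|δ| log |Q|)`.

*The algorithm.* Ordered partitions are handled through rank functions: `Ranks r P` says that the
parts of `P`, from left to right, are the fibres of `r : Q → ℕ` in increasing order. The invariant
`SourceNFA.RefineInv` says that `X` is coarser than `P`, that all states of a block of `P` are
entered by the same letter, that all blocks of `P` are stable with respect to all blocks of `X`,
that every forward-stable partition refines `P`, and that `u ≼ v` in a Wheeler preorder implies that
`u` does not come after `v` in `P`. It is preserved by the three-way split: if `B` is the first
block in `S`, then in every Wheeler preorder the states of a block of `P` that are entered from `B`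
only precede those entered from `B` and from `S \ B`, and these precede the states not entered from
`B`; symmetrically for the last block. When `X = P`, the partition is forward-stable, hence the
coarsest such partition, and a Wheeler preorder, whose classes are the same, must order them in the
same way. Every iteration adds a block to `X`, so the algorithm terminates.

*The program.* The states are kept in an array in which the blocks of `P` and of `X` are segments.
The program identifies a block of either partition with its first position. The heart of an
iteration is `RamProg.processBlock`. It scans the edges that leave the splitter `B`; the edges with
a common head and with tails in a common block of `X` share a record, and the counter of a record
tells whether a state entered from `B` is entered from `S \ B` too. Two passes, for `D₁` and for
`D₁₂ ⊆ D₁`, then split all blocks in time proportional to the number of moved states. As `B` has at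
most half of the states of `S`, the scans are paid for by the potential
`∑ u, (113 * |out u| + 5) * log₂ |S u|`, where `S u` is the block of `X` with `u`.

The first compound block is found through the positions at which a block of `P` but no block of `X`
starts. The first of them lies in the first compound block of `X`, right behind its first block of
`P`. They are kept in a binary tree of counters (`TreeHolds`), in which insertion, deletion and the
search for the minimum take time `O(log |Q|)`; each position is inserted and deleted at most once.
The machine cannot multiply, so the arithmetic of the tree is read from tables.
-/

/-! ### Ordered partitions described by rank functions -/

/-- The list `P` of sets is the ordered partition of `Q` into the fibres of `r`, listed in
increasing order of the value of `r`. -/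
structure Ranks {Q : Type*} (r : Q → ℕ) (P : List (Set Q)) : Prop where
  nonempty : ∀ D ∈ P, D.Nonempty
  cover : ∀ v, ∃ D ∈ P, v ∈ D
  const : ∀ D ∈ P, ∀ u ∈ D, ∀ v ∈ D, r u = r v
  lt : P.Pairwise fun D E => ∀ u ∈ D, ∀ v ∈ E, r u < r v

namespace Ranks

variable {Q : Type*} {r r' : Q → ℕ} {P P' : List (Set Q)}

theorem lt_of_lt (h : Ranks r P) {i j : ℕ} (hi : i < P.length) (hj : j < P.length) (hij : i < j)
    {u v : Q} (hu : u ∈ P[i]) (hv : v ∈ P[j]) : r u < r v :=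
  List.pairwise_iff_getElem.1 h.lt i j hi hj hij u hu v hv

theorem index_le (h : Ranks r P) {i j : ℕ} (hi : i < P.length) (hj : j < P.length)
    {u v : Q} (hu : u ∈ P[i]) (hv : v ∈ P[j]) : i ≤ j ↔ r u ≤ r v := by
  rcases lt_trichotomy i j with hij | rfl | hij
  · have := h.lt_of_lt hi hj hij hu hv
    omega
  · have := h.const _ (List.getElem_mem hi) u hu v hv
    omega
  · have := h.lt_of_lt hj hi hij hv hu
    omega

theorem partLE_iff (h : Ranks r P) (u v : Q) : partLE P u v ↔ r u ≤ r v := by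
  constructor
  · rintro ⟨i, j, hi, hj, hij, hu, hv⟩
    exact (h.index_le hi hj hu hv).1 hij
  · intro hle
    obtain ⟨D, hD, hu⟩ := h.cover u
    obtain ⟨E, hE, hv⟩ := h.cover v
    obtain ⟨i, hi, rfl⟩ := List.getElem_of_mem hD
    obtain ⟨j, hj, rfl⟩ := List.getElem_of_mem hE
    exact ⟨i, j, hi, hj, (h.index_le hi hj hu hv).2 hle, hu, hv⟩

theorem eq_of_mem (h : Ranks r P) {D E : Set Q} (hD : D ∈ P) (hE : E ∈ P) {u v : Q}
    (hu : u ∈ D) (hv : v ∈ E) (e : r u = r v) : D = E := by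
  obtain ⟨i, hi, rfl⟩ := List.getElem_of_mem hD
  obtain ⟨j, hj, rfl⟩ := List.getElem_of_mem hE
  have h1 := (h.index_le hi hj hu hv).2 e.le
  have h2 := (h.index_le hj hi hv hu).2 e.ge
  obtain rfl : i = j := le_antisymm h1 h2
  rfl

theorem mem_iff (h : Ranks r P) {D : Set Q} (hD : D ∈ P) {u v : Q} (hu : u ∈ D) :
    v ∈ D ↔ r v = r u := by
  refine ⟨fun hv => h.const D hD v hv u hu, fun e => ?_⟩
  obtain ⟨E, hE, hv⟩ := h.cover v
  rwa [h.eq_of_mem hD hE hu hv e.symm]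

theorem eq_fiber (h : Ranks r P) {D : Set Q} (hD : D ∈ P) {u : Q} (hu : u ∈ D) :
    D = {v | r v = r u} := Set.ext fun _ => h.mem_iff hD hu

theorem fiber_mem (h : Ranks r P) (u : Q) : {v | r v = r u} ∈ P := by
  obtain ⟨D, hD, hu⟩ := h.cover u
  rwa [← h.eq_fiber hD hu]

theorem isOrderedPartition (h : Ranks r P) : IsOrderedPartition P where
  nonempty := h.nonempty
  disjoint := h.lt.imp fun hlt => Set.disjoint_left.2 fun v hv hv' => (hlt v hv v hv').ne rfl
  cover := h.cover

theorem totalPreorderRel (h : Ranks r P) : TotalPreorderRel (partLE P) where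
  refl u := (h.partLE_iff u u).2 le_rfl
  trans u v w huv hvw :=
    (h.partLE_iff u w).2 (((h.partLE_iff u v).1 huv).trans ((h.partLE_iff v w).1 hvw))
  total u v := by
    rw [h.partLE_iff, h.partLE_iff]
    exact le_total _ _

/-- Only the order of the values of the rank function matters. -/
theorem of_order (h : Ranks r P) (hr : ∀ u v, r' u < r' v ↔ r u < r v) : Ranks r' P where
  nonempty := h.nonempty
  cover := h.cover
  const D hD u hu v hv := by
    have h1 := h.const D hD u hu v hv
    have h2 := hr u v
    have h3 := hr v u
    omega
  lt := h.lt.imp fun hlt u hu v hv => (hr u v).2 (hlt u hu v hv)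

theorem unique (h : Ranks r P) (h' : Ranks r P') : P = P' := by
  have nodup : ∀ {P : List (Set Q)}, Ranks r P → P.Nodup := fun {P} h => by
    refine List.Pairwise.imp_of_mem ?_ h.lt
    rintro D E hD - hlt rfl
    obtain ⟨u, hu⟩ := h.nonempty D hD
    exact (hlt u hu u hu).ne rfl
  have sub : ∀ {P P' : List (Set Q)}, Ranks r P → Ranks r P' → ∀ D ∈ P, D ∈ P' :=
    fun h h' D hD => by
      obtain ⟨u, hu⟩ := h.nonempty D hD
      rw [h.eq_fiber hD hu]
      exact h'.fiber_mem u
  have hperm : P.Perm P' := (List.perm_ext_iff_of_nodup (nodup h) (nodup h')).2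
    fun D => ⟨sub h h' D, sub h' h D⟩
  refine hperm.eq_of_pairwise ?_ h.lt h'.lt
  intro D E hD hE h1 h2
  obtain ⟨u, hu⟩ := h.nonempty D hD
  obtain ⟨v, hv⟩ := h'.nonempty E hE
  exact absurd (h1 u hu v hv) (h2 v hv u hu).asymm

theorem flatMap (h : Ranks r P) (g : Set Q → List (Set Q))
    (hsub : ∀ D ∈ P, ∀ E ∈ g D, E ⊆ D) (hne : ∀ D ∈ P, ∀ E ∈ g D, E.Nonempty)
    (hcov : ∀ D ∈ P, ∀ v ∈ D, ∃ E ∈ g D, v ∈ E)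
    (hconst : ∀ D ∈ P, ∀ E ∈ g D, ∀ u ∈ E, ∀ v ∈ E, r' u = r' v)
    (hlt : ∀ D ∈ P, (g D).Pairwise fun E F => ∀ u ∈ E, ∀ v ∈ F, r' u < r' v)
    (hr : ∀ u v, r u < r v → r' u < r' v) : Ranks r' (P.flatMap g) where
  nonempty E hE := by
    obtain ⟨D, hD, hE⟩ := List.mem_flatMap.1 hE
    exact hne D hD E hE
  cover v := by
    obtain ⟨D, hD, hv⟩ := h.cover v
    obtain ⟨E, hE, hv⟩ := hcov D hD v hv
    exact ⟨E, List.mem_flatMap.2 ⟨D, hD, hE⟩, hv⟩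
  const E hE := by
    obtain ⟨D, hD, hE⟩ := List.mem_flatMap.1 hE
    exact hconst D hD E hE
  lt := by
    rw [List.pairwise_flatMap]
    refine ⟨hlt, List.Pairwise.imp_of_mem ?_ h.lt⟩
    intro D D' hD hD' hDD E hE E' hE' u hu v hv
    exact hr u v (hDD u (hsub D hD E hE hu) v (hsub D' hD' E' hE' hv))

/-- Splitting one block of an ordered partition into two. -/
theorem split {X₁ X₂ : List (Set Q)} {S F G : Set Q} (h : Ranks r (X₁ ++ S :: X₂))
    (hFG : F ∪ G = S) (hF : F.Nonempty) (hG : G.Nonempty)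
    (hr : ∀ u v, r' u < r' v ↔ r u < r v ∨ u ∈ F ∧ v ∈ G) (hdisj : Disjoint F G) :
    Ranks r' (X₁ ++ F :: G :: X₂) := by
  classical
  have hS : S ∈ X₁ ++ S :: X₂ := by simp
  have hlt' := h.lt
  have hc := h.const
  have h0 : ∀ T ∈ X₁ ++ S :: X₂, T ≠ S → Disjoint T S := fun T hT hTS =>
    Set.disjoint_left.2 fun v hv hv' => hTS (h.eq_of_mem hT hS hv hv' rfl)
  have hFS : F ⊆ S := hFG ▸ Set.subset_union_left
  have hGS : G ⊆ S := hFG ▸ Set.subset_union_right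
  have eqr : ∀ u v, r u = r v → ¬ (u ∈ F ∧ v ∈ G) → ¬ (v ∈ F ∧ u ∈ G) → r' u = r' v := by
    intro u v e h1 h2
    have h3 := hr u v
    have h4 := hr v u
    simp only [h1, h2, or_false] at h3 h4
    omega
  have notS : ∀ T, (T ∈ X₁ ∨ T ∈ X₂) → Disjoint T S := by
    intro T hT
    simp only [List.pairwise_append, List.pairwise_cons] at hlt'
    refine Set.disjoint_left.2 fun v hv hv' => ?_
    rcases hT with hT | hT
    · exact (hlt'.2.2 T hT S (by simp) v hv v hv').ne rfl
    · exact (hlt'.2.1.1 T hT v hv' v hv).ne rfl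
  refine ⟨?_, ?_, ?_, ?_⟩
  · intro D hD
    simp only [List.mem_append, List.mem_cons] at hD
    rcases hD with hD | rfl | rfl | hD
    · exact h.nonempty D (by simp [hD])
    · exact hF
    · exact hG
    · exact h.nonempty D (by simp [hD])
  · intro v
    obtain ⟨D, hD, hv⟩ := h.cover v
    simp only [List.mem_append, List.mem_cons] at hD
    rcases hD with hD | rfl | hD
    · exact ⟨D, by simp [hD], hv⟩
    · rw [← hFG] at hv
      rcases hv with hv | hv
      · exact ⟨F, by simp, hv⟩
      · exact ⟨G, by simp, hv⟩
    · exact ⟨D, by simp [hD], hv⟩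
  · intro D hD u hu v hv
    simp only [List.mem_append, List.mem_cons] at hD
    rcases hD with hD | rfl | rfl | hD
    · have := Set.disjoint_left.1 (notS D (.inl hD))
      exact eqr u v (hc D (by simp [hD]) u hu v hv) (fun e => this hu (hFS e.1))
        (fun e => this hv (hFS e.1))
    · exact eqr u v (hc S hS u (hFS hu) v (hFS hv)) (fun e => Set.disjoint_left.1 hdisj hv e.2)
        (fun e => Set.disjoint_left.1 hdisj hu e.2)
    · exact eqr u v (hc S hS u (hGS hu) v (hGS hv)) (fun e => Set.disjoint_left.1 hdisj e.1 hu)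
        (fun e => Set.disjoint_left.1 hdisj e.1 hv)
    · have := Set.disjoint_left.1 (notS D (.inr hD))
      exact eqr u v (hc D (by simp [hD]) u hu v hv) (fun e => this hu (hFS e.1))
        (fun e => this hv (hFS e.1))
  · simp only [List.pairwise_append, List.pairwise_cons, List.mem_cons] at hlt' ⊢
    obtain ⟨h1, ⟨h2, h3⟩, h4⟩ := hlt'
    refine ⟨h1.imp fun hl u hu v hv => (hr u v).2 (.inl (hl u hu v hv)), ⟨?_, ?_,
      h3.imp fun hl u hu v hv => (hr u v).2 (.inl (hl u hu v hv))⟩, ?_⟩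
    · rintro D (rfl | hD) u hu v hv
      · exact (hr u v).2 (.inr ⟨hu, hv⟩)
      · exact (hr u v).2 (.inl (h2 D hD u (hFS hu) v hv))
    · intro D hD u hu v hv
      exact (hr u v).2 (.inl (h2 D hD u (hGS hu) v hv))
    · rintro D hD E (rfl | rfl | hE) u hu v hv
      · exact (hr u v).2 (.inl (h4 D hD S (.inl rfl) u hu v (hFS hv)))
      · exact (hr u v).2 (.inl (h4 D hD S (.inl rfl) u hu v (hGS hv)))
      · exact (hr u v).2 (.inl (h4 D hD E (.inr hE) u hu v hv))

theorem length_le [Finite Q] (h : Ranks r P) : P.length ≤ Nat.card Q := by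
  classical
  have hch : ∀ i : Fin P.length, ∃ u, u ∈ P[i] := fun i =>
    h.nonempty _ (List.getElem_mem i.2)
  choose w hw using hch
  have hinj : Function.Injective w := by
    intro i j hij
    have h1 := (h.index_le i.2 j.2 (hw i) (hw j)).2 (by rw [hij])
    have h2 := (h.index_le j.2 i.2 (hw j) (hw i)).2 (by rw [hij])
    exact Fin.ext (le_antisymm h1 h2)
  simpa using Nat.card_le_card_of_injective w hinj

/-- The blocks contained in a block of a coarser ordered partition. -/
theorem mem_blocksIn {D S : Set Q} : D ∈ blocksIn P S ↔ D ∈ P ∧ D ⊆ S := by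
  simp [blocksIn]

theorem subset_of_inter {x : Q → ℕ} {X : List (Set Q)} (h : Ranks r P) (hX : Ranks x X)
    (hrx : ∀ u v, r u ≤ r v → x u ≤ x v) {D S : Set Q} (hD : D ∈ P) (hS : S ∈ X)
    {u : Q} (hu : u ∈ D) (huS : u ∈ S) : D ⊆ S := by
  intro v hv
  have e := h.const D hD u hu v hv
  rw [hX.mem_iff hS huS]
  exact le_antisymm (hrx v u e.ge) (hrx u v e.le)

theorem head_blocksIn (h : Ranks r P) {S F : Set Q} (hF : (blocksIn P S).head? = some F) :
    F ∈ P ∧ F ⊆ S ∧ ∀ D ∈ P, D ⊆ S → ∀ u ∈ F, ∀ v ∈ D, r u ≤ r v := by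
  obtain ⟨l, hl⟩ := List.head?_eq_some_iff.1 hF
  have hFm : F ∈ blocksIn P S := by simp [hl]
  have hp : (blocksIn P S).Pairwise fun D E => ∀ u ∈ D, ∀ v ∈ E, r u < r v := h.lt.filter _
  rw [hl, List.pairwise_cons] at hp
  refine ⟨(mem_blocksIn.1 hFm).1, (mem_blocksIn.1 hFm).2, fun D hD hDS u hu v hv => ?_⟩
  have hDm : D ∈ blocksIn P S := mem_blocksIn.2 ⟨hD, hDS⟩
  rw [hl, List.mem_cons] at hDm
  rcases hDm with rfl | hDm
  · exact (h.const D hD u hu v hv).le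
  · exact (hp.1 D hDm u hu v hv).le

theorem getLast_blocksIn (h : Ranks r P) {S L : Set Q} (hL : (blocksIn P S).getLast? = some L) :
    L ∈ P ∧ L ⊆ S ∧ ∀ D ∈ P, D ⊆ S → ∀ u ∈ L, ∀ v ∈ D, r v ≤ r u := by
  obtain ⟨l, hl⟩ := List.getLast?_eq_some_iff.1 hL
  have hLm : L ∈ blocksIn P S := by simp [hl]
  have hp : (blocksIn P S).Pairwise fun D E => ∀ u ∈ D, ∀ v ∈ E, r u < r v := h.lt.filter _
  rw [hl, List.pairwise_append] at hp
  refine ⟨(mem_blocksIn.1 hLm).1, (mem_blocksIn.1 hLm).2, fun D hD hDS u hu v hv => ?_⟩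
  have hDm : D ∈ blocksIn P S := mem_blocksIn.2 ⟨hD, hDS⟩
  rw [hl, List.mem_append] at hDm
  rcases hDm with hDm | hDm
  · exact (hp.2.2 D hDm L (by simp) v hv u hu).le
  · obtain rfl : D = L := by simpa using hDm
    exact (h.const D hD v hv u hu).le

theorem compound_iff {x : Q → ℕ} {X : List (Set Q)} (h : Ranks r P) (hX : Ranks x X)
    (hrx : ∀ u v, r u ≤ r v → x u ≤ x v) {S : Set Q} (hS : S ∈ X) :
    Compound P S ↔ ∃ u ∈ S, ∃ v ∈ S, r u ≠ r v := by
  have hp : (blocksIn P S).Pairwise fun D E => ∀ u ∈ D, ∀ v ∈ E, r u < r v := h.lt.filter _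
  constructor
  · intro hc
    have h0 : 0 < (blocksIn P S).length := by unfold Compound at hc; omega
    have h1 : 1 < (blocksIn P S).length := by unfold Compound at hc; omega
    have m0 := mem_blocksIn.1 (List.getElem_mem h0)
    have m1 := mem_blocksIn.1 (List.getElem_mem h1)
    obtain ⟨u, hu⟩ := h.nonempty _ m0.1
    obtain ⟨v, hv⟩ := h.nonempty _ m1.1
    exact ⟨u, m0.2 hu, v, m1.2 hv,
      (List.pairwise_iff_getElem.1 hp 0 1 h0 h1 one_pos u hu v hv).ne⟩
  · rintro ⟨u, hu, v, hv, hne⟩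
    obtain ⟨D, hD, hu'⟩ := h.cover u
    obtain ⟨E, hE, hv'⟩ := h.cover v
    have mD := mem_blocksIn.2 ⟨hD, h.subset_of_inter hX hrx hD hS hu' hu⟩
    have mE := mem_blocksIn.2 ⟨hE, h.subset_of_inter hX hrx hE hS hv' hv⟩
    by_contra hc
    unfold Compound at hc
    have : ∃ G, ∀ T ∈ blocksIn P S, T = G := by
      match hl : blocksIn P S with
      | [] => simp [hl] at mD
      | [G] => exact ⟨G, by simp⟩
      | _ :: _ :: _ => simp [hl] at hc
    obtain ⟨G, hG⟩ := this
    rw [hG D mD] at hu' hD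
    rw [hG E mE] at hv'
    exact hne (h.const G hD u hu' v hv')

theorem head?_blocksIn_eq (h : Ranks r P) {S : Set Q} {w : Q} (hsub : {u | r u = r w} ⊆ S)
    (hmin : ∀ u ∈ S, r w ≤ r u) : (blocksIn P S).head? = some {u | r u = r w} := by
  have hm : {u | r u = r w} ∈ blocksIn P S := mem_blocksIn.2 ⟨h.fiber_mem w, hsub⟩
  match hl : (blocksIn P S).head? with
  | none => simp [List.head?_eq_none_iff.1 hl] at hm
  | some F =>
    have hF := h.head_blocksIn hl
    obtain ⟨u, hu⟩ := h.nonempty F hF.1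
    have h1 := hF.2.2 _ (h.fiber_mem w) hsub u hu w rfl
    rw [h.eq_of_mem hF.1 (h.fiber_mem w) hu rfl (le_antisymm h1 (hmin u (hF.2.1 hu)))]

theorem getLast?_blocksIn_eq (h : Ranks r P) {S : Set Q} {w : Q} (hsub : {u | r u = r w} ⊆ S)
    (hmax : ∀ u ∈ S, r u ≤ r w) : (blocksIn P S).getLast? = some {u | r u = r w} := by
  have hm : {u | r u = r w} ∈ blocksIn P S := mem_blocksIn.2 ⟨h.fiber_mem w, hsub⟩
  match hl : (blocksIn P S).getLast? with
  | none => simp [List.getLast?_eq_none_iff.1 hl] at hm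
  | some F =>
    have hF := h.getLast_blocksIn hl
    obtain ⟨u, hu⟩ := h.nonempty F hF.1
    have h1 := hF.2.2 _ (h.fiber_mem w) hsub u hu w rfl
    rw [h.eq_of_mem hF.1 (h.fiber_mem w) hu rfl (le_antisymm (hmax u (hF.2.1 hu)) h1)]

end Ranks

/-! ### The three-way split of a block -/

namespace SourceNFA

variable {Sig Q : Type*}

theorem mem_imgAll {A : SourceNFA Sig Q} {T : Set Q} {v : Q} :
    v ∈ A.imgAll T ↔ ∃ a, ∃ u ∈ T, v ∈ A.step u a := by
  simp [imgAll, img]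

theorem imgAll_mono (A : SourceNFA Sig Q) {T U : Set Q} (h : T ⊆ U) :
    A.imgAll T ⊆ A.imgAll U := fun v hv => by
  obtain ⟨a, u, hu, hs⟩ := mem_imgAll.1 hv
  exact mem_imgAll.2 ⟨a, u, h hu, hs⟩

open Classical in
/-- The part of its block to which a state belongs when the splitter is `B` and the compound
block is `S`: `0` for `D₁₂`, `1` for `D₁₁`, `2` for `D₂`. -/
noncomputable def splitClass (A : SourceNFA Sig Q) (B S : Set Q) (v : Q) : ℕ :=
  if v ∈ A.imgAll B then if v ∈ A.imgAll (S \ B) then 1 else 0 else 2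

theorem mem_part12 {A : SourceNFA Sig Q} {B S D : Set Q} {v : Q} :
    v ∈ A.part12 B S D ↔ v ∈ D ∧ A.splitClass B S v = 0 := by
  unfold part12 part11 part1 splitClass
  split_ifs <;> simp_all

theorem mem_part11 {A : SourceNFA Sig Q} {B S D : Set Q} {v : Q} :
    v ∈ A.part11 B S D ↔ v ∈ D ∧ A.splitClass B S v = 1 := by
  unfold part11 part1 splitClass
  split_ifs <;> simp_all

theorem mem_part2 {A : SourceNFA Sig Q} (B S : Set Q) {D : Set Q} {v : Q} :
    v ∈ A.part2 B D ↔ v ∈ D ∧ A.splitClass B S v = 2 := by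
  unfold part2 part1 splitClass
  split_ifs <;> simp_all

theorem splitClass_le (A : SourceNFA Sig Q) (B S : Set Q) (v : Q) : A.splitClass B S v ≤ 2 := by
  unfold splitClass
  split_ifs <;> omega

theorem mem_nonemptySets {P : List (Set Q)} {D : Set Q} :
    D ∈ nonemptySets P ↔ D ∈ P ∧ D.Nonempty := by
  simp [nonemptySets]

theorem ranks_splitFirst (A : SourceNFA Sig Q) {r r' : Q → ℕ} {P : List (Set Q)}
    (h : Ranks r P) (B S : Set Q)
    (hr : ∀ u v, r' u < r' v ↔ r u < r v ∨
      r u = r v ∧ A.splitClass B S u < A.splitClass B S v) :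
    Ranks r' (P.flatMap (A.splitFirst B S)) := by
  have heq : ∀ u v, r u = r v → A.splitClass B S u = A.splitClass B S v → r' u = r' v := by
    intro u v e e'
    have := hr u v
    have := hr v u
    omega
  have hmem : ∀ D E, E ∈ A.splitFirst B S D ↔
      (E = A.part12 B S D ∨ E = A.part11 B S D ∨ E = A.part2 B D) ∧ E.Nonempty := by
    intro D E
    simp [splitFirst, mem_nonemptySets]
  refine h.flatMap _ ?_ ?_ ?_ ?_ ?_ (fun u v huv => (hr u v).2 (.inl huv))
  · rintro D - E hE v hv
    rcases ((hmem D E).1 hE).1 with rfl | rfl | rfl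
    · exact (mem_part12.1 hv).1
    · exact (mem_part11.1 hv).1
    · exact ((mem_part2 B S).1 hv).1
  · rintro D - E hE
    exact ((hmem D E).1 hE).2
  · intro D _ v hv
    have hle := A.splitClass_le B S v
    have : A.splitClass B S v = 0 ∨ A.splitClass B S v = 1 ∨ A.splitClass B S v = 2 := by omega
    rcases this with e | e | e
    · have hv' : v ∈ A.part12 B S D := mem_part12.2 ⟨hv, e⟩
      exact ⟨_, (hmem D _).2 ⟨.inl rfl, v, hv'⟩, hv'⟩
    · have hv' : v ∈ A.part11 B S D := mem_part11.2 ⟨hv, e⟩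
      exact ⟨_, (hmem D _).2 ⟨.inr (.inl rfl), v, hv'⟩, hv'⟩
    · have hv' : v ∈ A.part2 B D := (mem_part2 B S).2 ⟨hv, e⟩
      exact ⟨_, (hmem D _).2 ⟨.inr (.inr rfl), v, hv'⟩, hv'⟩
  · intro D hD E hE u hu v hv
    rcases ((hmem D E).1 hE).1 with rfl | rfl | rfl
    · rw [mem_part12] at hu hv
      exact heq u v (h.const D hD u hu.1 v hv.1) (hu.2.trans hv.2.symm)
    · rw [mem_part11] at hu hv
      exact heq u v (h.const D hD u hu.1 v hv.1) (hu.2.trans hv.2.symm)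
    · rw [mem_part2 B S] at hu hv
      exact heq u v (h.const D hD u hu.1 v hv.1) (hu.2.trans hv.2.symm)
  · intro D hD
    have hc := h.const D hD
    refine List.Pairwise.filter _ ?_
    simp only [List.pairwise_cons, List.mem_cons, List.not_mem_nil, or_false, forall_eq_or_imp,
      forall_eq, mem_part12, mem_part11, mem_part2 B S, hr]
    refine ⟨⟨?_, ?_⟩, ?_, by simp, List.Pairwise.nil⟩ <;>
    · intro u hu v hv
      have := hc u hu.1 v hv.1
      omega

theorem ranks_splitLast (A : SourceNFA Sig Q) {r r' : Q → ℕ} {P : List (Set Q)}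
    (h : Ranks r P) (B S : Set Q)
    (hr : ∀ u v, r' u < r' v ↔ r u < r v ∨
      r u = r v ∧ A.splitClass B S v < A.splitClass B S u) :
    Ranks r' (P.flatMap (A.splitLast B S)) := by
  have heq : ∀ u v, r u = r v → A.splitClass B S u = A.splitClass B S v → r' u = r' v := by
    intro u v e e'
    have := hr u v
    have := hr v u
    omega
  have hmem : ∀ D E, E ∈ A.splitLast B S D ↔
      (E = A.part2 B D ∨ E = A.part11 B S D ∨ E = A.part12 B S D) ∧ E.Nonempty := by
    intro D E
    simp [splitLast, mem_nonemptySets]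
  refine h.flatMap _ ?_ ?_ ?_ ?_ ?_ (fun u v huv => (hr u v).2 (.inl huv))
  · rintro D - E hE v hv
    rcases ((hmem D E).1 hE).1 with rfl | rfl | rfl
    · exact ((mem_part2 B S).1 hv).1
    · exact (mem_part11.1 hv).1
    · exact (mem_part12.1 hv).1
  · rintro D - E hE
    exact ((hmem D E).1 hE).2
  · intro D _ v hv
    have hle := A.splitClass_le B S v
    have : A.splitClass B S v = 0 ∨ A.splitClass B S v = 1 ∨ A.splitClass B S v = 2 := by omega
    rcases this with e | e | e
    · have hv' : v ∈ A.part12 B S D := mem_part12.2 ⟨hv, e⟩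
      exact ⟨_, (hmem D _).2 ⟨.inr (.inr rfl), v, hv'⟩, hv'⟩
    · have hv' : v ∈ A.part11 B S D := mem_part11.2 ⟨hv, e⟩
      exact ⟨_, (hmem D _).2 ⟨.inr (.inl rfl), v, hv'⟩, hv'⟩
    · have hv' : v ∈ A.part2 B D := (mem_part2 B S).2 ⟨hv, e⟩
      exact ⟨_, (hmem D _).2 ⟨.inl rfl, v, hv'⟩, hv'⟩
  · intro D hD E hE u hu v hv
    rcases ((hmem D E).1 hE).1 with rfl | rfl | rfl
    · rw [mem_part2 B S] at hu hv
      exact heq u v (h.const D hD u hu.1 v hv.1) (hu.2.trans hv.2.symm)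
    · rw [mem_part11] at hu hv
      exact heq u v (h.const D hD u hu.1 v hv.1) (hu.2.trans hv.2.symm)
    · rw [mem_part12] at hu hv
      exact heq u v (h.const D hD u hu.1 v hv.1) (hu.2.trans hv.2.symm)
  · intro D hD
    have hc := h.const D hD
    refine List.Pairwise.filter _ ?_
    simp only [List.pairwise_cons, List.mem_cons, List.not_mem_nil, or_false, forall_eq_or_imp,
      forall_eq, mem_part12, mem_part11, mem_part2 B S, hr]
    refine ⟨⟨?_, ?_⟩, ?_, by simp, List.Pairwise.nil⟩ <;>
    · intro u hu v hv
      have := hc u hu.1 v hv.1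
      omega

/-! ### One step of the refinement in terms of rank functions -/

/-- The choice of the splitter: the class of `v₁` is the first and the class of `v₂` is the last
block of `P` in the first compound block of `X`. -/
structure SplitChoice (r x : Q → ℕ) (v₁ v₂ : Q) : Prop where
  simple : ∀ u v, x u = x v → x u < x v₁ → r u = r v
  same : x v₁ = x v₂
  ne : r v₁ ≠ r v₂
  min : ∀ u, x u = x v₁ → r v₁ ≤ r u
  max : ∀ u, x u = x v₁ → r u ≤ r v₂

theorem SplitChoice.lists {r x : Q → ℕ} {v₁ v₂ : Q} (hc : SplitChoice r x v₁ v₂)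
    {X P : List (Set Q)} (hP : Ranks r P) (hX : Ranks x X)
    (hrx : ∀ u v, r u ≤ r v → x u ≤ x v) :
    ∃ X₁ X₂, X = X₁ ++ {u | x u = x v₁} :: X₂ ∧ (∀ T ∈ X₁, ¬ Compound P T) ∧
      Compound P {u | x u = x v₁} ∧
      (blocksIn P {u | x u = x v₁}).head? = some {u | r u = r v₁} ∧
      (blocksIn P {u | x u = x v₁}).getLast? = some {u | r u = r v₂} ∧ X ≠ P := by
  have hS := hX.fiber_mem v₁
  obtain ⟨X₁, X₂, e⟩ := List.append_of_mem hS
  have hcomp : Compound P {u | x u = x v₁} :=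
    (hP.compound_iff hX hrx hS).2 ⟨v₁, rfl, v₂, hc.same.symm, hc.ne⟩
  have hsub : ∀ v, x v = x v₁ → {u | r u = r v} ⊆ {u | x u = x v₁} := by
    intro v hv u hu
    have h1 := hrx u v (le_of_eq hu)
    have h2 := hrx v u (le_of_eq hu.symm)
    exact (le_antisymm h1 h2).trans hv
  refine ⟨X₁, X₂, e, ?_, hcomp, hP.head?_blocksIn_eq (hsub v₁ rfl) hc.min,
    hP.getLast?_blocksIn_eq (hsub v₂ hc.same.symm) hc.max, ?_⟩
  · intro T hT hcT
    have hTX : T ∈ X := by simp [e, hT]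
    obtain ⟨u, hu, v, hv, hne⟩ := (hP.compound_iff hX hrx hTX).1 hcT
    have hlt := hX.lt
    rw [e, List.pairwise_append] at hlt
    exact hne (hc.simple u v (hX.const T hTX u hu v hv)
      (hlt.2.2 T hT _ (List.mem_cons_self) u hu v₁ rfl))
  · rintro rfl
    exact hc.ne (hP.const _ hS v₁ rfl v₂ hc.same.symm)

theorem SplitChoice.iter_first {r x : Q → ℕ} {v₁ v₂ : Q} (hc : SplitChoice r x v₁ v₂)
    (A : SourceNFA Sig Q) {X P : List (Set Q)} (hP : Ranks r P) (hX : Ranks x X)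
    (hrx : ∀ u v, r u ≤ r v → x u ≤ x v)
    (hcard : {u | r u = r v₁}.ncard ≤ {u | r u = r v₂}.ncard) {r' x' : Q → ℕ}
    (hr : ∀ u v, r' u < r' v ↔ r u < r v ∨ r u = r v ∧
      A.splitClass {u | r u = r v₁} {u | x u = x v₁} u <
        A.splitClass {u | r u = r v₁} {u | x u = x v₁} v)
    (hx : ∀ u v, x' u < x' v ↔ x u < x v ∨ r u = r v₁ ∧ x v = x v₁ ∧ r v ≠ r v₁) :
    ∃ X' P', A.RefineIter ⟨X, P⟩ ⟨X', P'⟩ ∧ Ranks x' X' ∧ Ranks r' P' := by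
  obtain ⟨X₁, X₂, rfl, h1, h2, h3, h4, h5⟩ := hc.lists hP hX hrx
  refine ⟨_, _, ⟨h5, .first X₁ X₂ P _ _ _ h1 h2 h3 h4 hcard⟩, ?_,
    A.ranks_splitFirst hP _ _ hr⟩
  refine hX.split (F := {u | r u = r v₁}) ?_ ⟨v₁, rfl⟩ ⟨v₂, hc.same.symm, hc.ne.symm⟩ ?_
    Set.disjoint_sdiff_right
  · exact Set.union_sdiff_cancel (hP.head_blocksIn h3).2.1
  · intro u v
    rw [hx]
    rfl

theorem SplitChoice.iter_last {r x : Q → ℕ} {v₁ v₂ : Q} (hc : SplitChoice r x v₁ v₂)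
    (A : SourceNFA Sig Q) {X P : List (Set Q)} (hP : Ranks r P) (hX : Ranks x X)
    (hrx : ∀ u v, r u ≤ r v → x u ≤ x v)
    (hcard : {u | r u = r v₂}.ncard ≤ {u | r u = r v₁}.ncard) {r' x' : Q → ℕ}
    (hr : ∀ u v, r' u < r' v ↔ r u < r v ∨ r u = r v ∧
      A.splitClass {u | r u = r v₂} {u | x u = x v₁} v <
        A.splitClass {u | r u = r v₂} {u | x u = x v₁} u)
    (hx : ∀ u v, x' u < x' v ↔ x u < x v ∨ (x u = x v₁ ∧ r u ≠ r v₂) ∧ r v = r v₂) :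
    ∃ X' P', A.RefineIter ⟨X, P⟩ ⟨X', P'⟩ ∧ Ranks x' X' ∧ Ranks r' P' := by
  obtain ⟨X₁, X₂, rfl, h1, h2, h3, h4, h5⟩ := hc.lists hP hX hrx
  refine ⟨_, _, ⟨h5, .last X₁ X₂ P _ _ _ h1 h2 h3 h4 hcard⟩, ?_,
    A.ranks_splitLast hP _ _ hr⟩
  refine hX.split (G := {u | r u = r v₂}) ?_ ⟨v₁, rfl, hc.ne⟩ ⟨v₂, rfl⟩ ?_
    Set.disjoint_sdiff_left
  · exact Set.sdiff_union_of_subset (hP.getLast_blocksIn h4).2.1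
  · intro u v
    rw [hx]
    rfl

/-! ### The invariant of the refinement -/

/-- The invariant of the algorithm at the head of the loop; `r` and `x` describe the orders of the
two partitions. -/
structure RefineInv [LT Sig] (A : SourceNFA Sig Q) (c : RefineConfig Q) (r x : Q → ℕ) :
    Prop where
  ranksP : Ranks r c.P
  ranksX : Ranks x c.X
  mono : ∀ u v, r u ≤ r v → x u ≤ x v
  letter : ∀ u v u' v' a b, r v = r v' → v ∈ A.step u a → v' ∈ A.step u' b → a = b
  /-- `P` is stable with respect to the blocks of `X`. -/
  stable : ∀ S ∈ c.X, ∀ v v', r v = r v' → v ∈ A.imgAll S → v' ∈ A.imgAll S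
  /-- Every forward-stable partition refines `P`. -/
  coarse : ∀ F : Setoid Q, A.FwdStablePartition F → ∀ u v, F u v → r u = r v
  /-- The order of `P` is compatible with every Wheeler preorder. -/
  wheeler : ∀ ρ, A.IsWheelerPreorder ρ → ∀ u v, ρ u v → r u ≤ r v

/-- The image of a union of classes of a forward-stable partition is a union of classes. -/
theorem FwdStablePartition.imgAll_iff {A : SourceNFA Sig Q} {F : Setoid Q}
    (hF : A.FwdStablePartition F) {T : Set Q} (hT : ∀ u v, F u v → u ∈ T → v ∈ T) {u v : Q}
    (huv : F u v) : u ∈ A.imgAll T ↔ v ∈ A.imgAll T := by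
  have key : ∀ u v, F u v → u ∈ A.imgAll T → v ∈ A.imgAll T := by
    intro u v huv hu
    obtain ⟨a, w, hw, hs⟩ := mem_imgAll.1 hu
    have hst := hF {z | F z u} ⟨u, rfl⟩ {z | F z w} ⟨w, rfl⟩ a
    have hu' : u ∈ A.img a {z | F z w} := ⟨w, F.refl w, hs⟩
    rcases hst with h | h
    · obtain ⟨z, hz, hs'⟩ := h (F.symm huv : v ∈ {z | F z u})
      exact mem_imgAll.2 ⟨a, z, hT w z (F.symm hz) hw, hs'⟩
    · have hm : u ∈ {z | F z u} ∩ A.img a {z | F z w} := ⟨F.refl u, hu'⟩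
      rw [h] at hm
      exact hm.elim
  exact ⟨key u v huv, key v u (F.symm huv)⟩

/-- In a Wheeler preorder, transitions with the same letter preserve the order up to
equivalence. -/
theorem IsWheelerPreorder.step_or [LT Sig] {A : SourceNFA Sig Q} {ρ : Q → Q → Prop}
    {h : TotalPreorderRel ρ} (hw : (A.quotient h.toSetoid).IsWheelerOrder h.quotLT)
    {p q u v : Q} {a : Sig} (hv : v ∈ A.step p a) (hu : u ∈ A.step q a) (hpq : ¬ ρ q p)
    (huv : ρ u v) : h.toSetoid u v := by
  by_contra hne
  have hlt : h.quotLT (Quotient.mk _ p) (Quotient.mk _ q) :=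
    ⟨p, q, rfl, rfl, (h.total p q).resolve_right hpq, hpq⟩
  have hne' : Quotient.mk h.toSetoid v ≠ Quotient.mk h.toSetoid u := fun e =>
    hne (h.toSetoid.symm (Quotient.exact e))
  obtain ⟨v', u', ev, eu, -, h2⟩ := hw.of_lt _ _ _ _ a ⟨p, v, rfl, rfl, hv⟩
    ⟨q, u, rfl, rfl, hu⟩ hlt hne'
  have hvv : h.toSetoid v' v := Quotient.exact ev
  have huu : h.toSetoid u' u := Quotient.exact eu
  exact h2 (h.trans _ _ _ huu.1 (h.trans _ _ _ huv hvv.2))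

section Step

variable [LT Sig] {A : SourceNFA Sig Q} {c : RefineConfig Q} {r x : Q → ℕ}

theorem RefineInv.subset_block (h : A.RefineInv c r x) {B S : Set Q} (hS : S ∈ c.X)
    (hB : B ∈ c.P) {v : Q} : v ∈ S \ B → {u | r u = r v} ⊆ S \ B := by
  rintro ⟨h1, h2⟩ u (hu : r u = r v)
  refine ⟨?_, fun h3 => h2 ?_⟩
  · exact h.ranksP.subset_of_inter h.ranksX h.mono (h.ranksP.fiber_mem v) hS
      (rfl : v ∈ {u | r u = r v}) h1 hu
  · exact (h.ranksP.mem_iff hB h3).2 hu.symm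

/-- States that are equivalent in a forward-stable partition are not separated: `B` and `S \ B` are
unions of its classes. -/
theorem RefineInv.splitClass_eq (h : A.RefineInv c r x) {B S : Set Q} (hS : S ∈ c.X)
    (hB : B ∈ c.P) {F : Setoid Q} (hF : A.FwdStablePartition F) {u v : Q}
    (huv : F u v) : A.splitClass B S u = A.splitClass B S v := by
  have h1 := hF.imgAll_iff (T := B)
    (fun u v e hu => (h.ranksP.mem_iff hB hu).2 (h.coarse F hF u v e).symm) huv
  have h2 := hF.imgAll_iff (T := S \ B)
    (fun u v e hu => h.subset_block hS hB hu (h.coarse F hF u v e).symm) huv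
  unfold splitClass
  rw [h1, h2]

theorem RefineInv.mem_img_of_splitClass_lt (h : A.RefineInv c r x) {B S : Set Q} (hS : S ∈ c.X)
    (hBS : B ⊆ S) {u v : Q} (huv : r u = r v)
    (hlt : A.splitClass B S v < A.splitClass B S u) :
    v ∈ A.imgAll B ∧ u ∈ A.imgAll (S \ B) := by
  have hv : v ∈ A.imgAll B := by
    by_contra hv
    have := A.splitClass_le B S u
    simp [splitClass, hv] at hlt
    unfold splitClass at this
    split_ifs at hlt this <;> omega
  refine ⟨hv, ?_⟩
  obtain ⟨a, w, hw, hs⟩ :=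
    mem_imgAll.1 (h.stable S hS v u huv.symm (A.imgAll_mono hBS hv))
  by_cases hwB : w ∈ B
  · by_contra hu
    have hu' : u ∈ A.imgAll B := mem_imgAll.2 ⟨a, w, hwB, hs⟩
    simp [splitClass, hu, hu'] at hlt
  · exact mem_imgAll.2 ⟨a, w, ⟨hw, hwB⟩, hs⟩

/-- The parts of the invariant that do not depend on whether the first or the last block is the
splitter. -/
theorem RefineInv.step (h : A.RefineInv c r x) {B S : Set Q} (hS : S ∈ c.X) (hB : B ∈ c.P)
    (hBS : B ⊆ S) {d : RefineConfig Q} {r' x' : Q → ℕ} (hP : Ranks r' d.P) (hX : Ranks x' d.X)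
    (hr : ∀ u v, r' u = r' v ↔ r u = r v ∧ A.splitClass B S u = A.splitClass B S v)
    (hdX : ∀ T ∈ d.X, T ∈ c.X ∨ T = B ∨ T = S \ B)
    (hmono : ∀ u v, r' u ≤ r' v → x' u ≤ x' v)
    (hord : ∀ u v, r u < r v → r' u < r' v)
    (hclass : ∀ u v, r u = r v → r' v < r' u →
      A.splitClass B S v < A.splitClass B S u ∧ (∀ p ∈ B, ∀ q ∈ S \ B, r p < r q) ∨
      A.splitClass B S u < A.splitClass B S v ∧ (∀ p ∈ B, ∀ q ∈ S \ B, r q < r p)) :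
    A.RefineInv d r' x' := by
  have hcoarse : ∀ F : Setoid Q, A.FwdStablePartition F → ∀ u v, F u v → r' u = r' v :=
    fun F hF u v huv => (hr u v).2 ⟨h.coarse F hF u v huv, h.splitClass_eq hS hB hF huv⟩
  refine ⟨hP, hX, hmono, fun u v u' v' a b e => h.letter u v u' v' a b ((hr v v').1 e).1, ?_,
    hcoarse, ?_⟩
  · intro T hT v v' e hv
    obtain ⟨e1, e2⟩ := (hr v v').1 e
    rcases hdX T hT with hT | rfl | rfl
    · exact h.stable T hT v v' e1 hv
    · by_contra hv'
      rw [splitClass, if_pos hv, splitClass, if_neg hv'] at e2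
      split_ifs at e2
      omega
    · by_contra hv'
      rw [splitClass, splitClass, if_pos hv, if_neg hv'] at e2
      by_cases hb : v' ∈ A.imgAll B
      · simp only [if_pos hb] at e2
        split_ifs at e2
      · have hvS := h.stable S hS v v' e1 (A.imgAll_mono Set.sdiff_subset hv)
        obtain ⟨a, w, hw, hs⟩ := mem_imgAll.1 hvS
        by_cases hwB : w ∈ B
        · exact hb (mem_imgAll.2 ⟨a, w, hwB, hs⟩)
        · exact hv' (mem_imgAll.2 ⟨a, w, ⟨hw, hwB⟩, hs⟩)
  · intro ρ hρ u v huv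
    by_contra hlt
    rw [not_le] at hlt
    have hrle := h.wheeler ρ hρ u v huv
    have hruv : r u = r v := by
      refine le_antisymm hrle ?_
      by_contra hc
      exact absurd (hord u v (not_le.1 hc)) hlt.asymm
    have aux : ∀ {p q : Q} {a b : Sig}, v ∈ A.step p a → u ∈ A.step q b → r p < r q → False := by
      intro p q a b hp hq hpq
      obtain rfl := h.letter p v q u a b hruv.symm hp hq
      have hqp : ¬ ρ q p := fun hc => (h.wheeler ρ hρ q p hc).not_gt hpq
      obtain ⟨hpre, hst, hw⟩ := hρ
      exact hlt.ne' (hcoarse _ hst.1 u v (IsWheelerPreorder.step_or hw hp hq hqp huv))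
    rcases hclass u v hruv hlt with ⟨hcl, hpq⟩ | ⟨hcl, hpq⟩
    · obtain ⟨h1, h2⟩ := h.mem_img_of_splitClass_lt hS hBS hruv hcl
      obtain ⟨a, p, hp, hsp⟩ := mem_imgAll.1 h1
      obtain ⟨b, q, hq, hsq⟩ := mem_imgAll.1 h2
      exact aux hsp hsq (hpq p hp q hq)
    · obtain ⟨h1, h2⟩ := h.mem_img_of_splitClass_lt hS hBS hruv.symm hcl
      obtain ⟨a, p, hp, hsp⟩ := mem_imgAll.1 h1
      obtain ⟨b, q, hq, hsq⟩ := mem_imgAll.1 h2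
      exact aux hsq hsp (hpq p hp q hq)

/-- The body of the loop preserves the invariant, for some rank functions of the new partitions. -/
theorem RefineInv.exists_body (h : A.RefineInv c r x) {d : RefineConfig Q}
    (hd : A.RefineBody c d) :
    (∃ r' x', A.RefineInv d r' x') ∧ d.X.length = c.X.length + 1 := by
  classical
  rcases hd with ⟨X₁, X₂, P, S, F, L, hX₁, hS, hF, hL, hFL⟩ |
    ⟨X₁, X₂, P, S, F, L, hX₁, hS, hF, hL, hFL⟩
  · refine ⟨?_, by simp; omega⟩
    have hSX : S ∈ X₁ ++ S :: X₂ := by simp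
    have hP : Ranks r P := h.ranksP
    have hX : Ranks x (X₁ ++ S :: X₂) := h.ranksX
    obtain ⟨hFP, hFS, hFmin⟩ := hP.head_blocksIn hF
    obtain ⟨u₀, hu₀, v₀, hv₀, hne⟩ := (hP.compound_iff hX h.mono hSX).1 hS
    have hmin : ∀ p ∈ F, ∀ q ∈ S, r p ≤ r q := fun p hp q hq =>
      hFmin _ (hP.fiber_mem q) (hP.subset_of_inter hX h.mono (hP.fiber_mem q) hSX
        (rfl : q ∈ {z | r z = r q}) hq) p hp q rfl
    have hlt : ∀ p ∈ F, ∀ q ∈ S \ F, r p < r q := fun p hp q hq =>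
      (hmin p hp q hq.1).lt_of_ne fun e => hq.2 ((hP.mem_iff hFP hp).2 e.symm)
    have hrest : (S \ F).Nonempty := by
      by_contra hc
      have hall : ∀ q ∈ S, q ∈ F := fun q hq => by
        by_contra hqF
        exact hc ⟨q, hq, hqF⟩
      exact hne (hP.const F hFP _ (hall _ hu₀) _ (hall _ hv₀))
    have hxS : ∀ u v, x u = x v → u ∈ S → v ∈ S := fun u v e hu =>
      (hX.mem_iff hSX hu).2 e.symm
    refine ⟨fun v => 3 * r v + A.splitClass F S v,
      fun v => 2 * x v + if v ∈ S \ F then 1 else 0,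
      h.step (B := F) (S := S) hSX hFP hFS (ranks_splitFirst A hP F S ?_)
      (hX.split (F := F) (G := S \ F) (Set.union_sdiff_cancel hFS) (hP.nonempty F hFP) hrest ?_
        Set.disjoint_sdiff_right) ?_ ?_ ?_ ?_ ?_⟩
    · intro u v
      have := A.splitClass_le F S u
      have := A.splitClass_le F S v
      omega
    · intro u v
      constructor
      · intro hlt'
        by_cases hxx : x u < x v
        · exact .inl hxx
        · split_ifs at hlt' with h1 h2 h2
          all_goals first | omega | skip
          have e : x u = x v := by omega
          exact .inr ⟨by_contra fun hc => h1 ⟨hxS v u e.symm h2.1, hc⟩, h2⟩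
      · rintro (hlt' | ⟨h1, h2⟩)
        · split_ifs <;> omega
        · have e : x u = x v := hX.const S hSX u (hFS h1) v h2.1
          rw [if_pos h2, if_neg (fun hc => hc.2 h1)]
          omega
    · intro u v
      have := A.splitClass_le F S u
      have := A.splitClass_le F S v
      omega
    · intro T hT
      simp only [List.mem_append, List.mem_cons] at hT ⊢
      tauto
    · intro u v huv
      have h1 := A.splitClass_le F S u
      have h2 := A.splitClass_le F S v
      have hru : r u ≤ r v := by omega
      have hxu := h.mono u v hru
      split_ifs with h3 h4 h4
      all_goals first | omega | skip
      rcases hxu.lt_or_eq with hxu | hxu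
      · omega
      · have hvF : v ∈ F := by_contra fun hc => h4 ⟨hxS u v hxu h3.1, hc⟩
        exact absurd (hlt v hvF u h3) (by omega)
    · intro u v huv
      have := A.splitClass_le F S u
      omega
    · intro u v e hlt'
      exact .inl ⟨by omega, hlt⟩
  · refine ⟨?_, by simp; omega⟩
    have hSX : S ∈ X₁ ++ S :: X₂ := by simp
    have hP : Ranks r P := h.ranksP
    have hX : Ranks x (X₁ ++ S :: X₂) := h.ranksX
    obtain ⟨hLP, hLS, hLmax⟩ := hP.getLast_blocksIn hL
    obtain ⟨u₀, hu₀, v₀, hv₀, hne⟩ := (hP.compound_iff hX h.mono hSX).1 hS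
    have hmax : ∀ p ∈ L, ∀ q ∈ S, r q ≤ r p := fun p hp q hq =>
      hLmax _ (hP.fiber_mem q) (hP.subset_of_inter hX h.mono (hP.fiber_mem q) hSX
        (rfl : q ∈ {z | r z = r q}) hq) p hp q rfl
    have hlt : ∀ p ∈ L, ∀ q ∈ S \ L, r q < r p := fun p hp q hq =>
      (hmax p hp q hq.1).lt_of_ne fun e => hq.2 ((hP.mem_iff hLP hp).2 e)
    have hrest : (S \ L).Nonempty := by
      by_contra hc
      have hall : ∀ q ∈ S, q ∈ L := fun q hq => by
        by_contra hqF
        exact hc ⟨q, hq, hqF⟩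
      exact hne (hP.const L hLP _ (hall _ hu₀) _ (hall _ hv₀))
    have hxS : ∀ u v, x u = x v → u ∈ S → v ∈ S := fun u v e hu =>
      (hX.mem_iff hSX hu).2 e.symm
    refine ⟨fun v => 3 * r v + (2 - A.splitClass L S v),
      fun v => 2 * x v + if v ∈ L then 1 else 0,
      h.step (B := L) (S := S) hSX hLP hLS (ranks_splitLast A hP L S ?_)
      (hX.split (F := S \ L) (G := L) (Set.sdiff_union_of_subset hLS) hrest (hP.nonempty L hLP) ?_
        Set.disjoint_sdiff_left) ?_ ?_ ?_ ?_ ?_⟩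
    · intro u v
      have := A.splitClass_le L S u
      have := A.splitClass_le L S v
      omega
    · intro u v
      constructor
      · intro hlt'
        by_cases hxx : x u < x v
        · exact .inl hxx
        · split_ifs at hlt' with h1 h2 h2
          all_goals first | omega | skip
          have e : x u = x v := by omega
          exact .inr ⟨⟨hxS v u e.symm (hLS h2), h1⟩, h2⟩
      · rintro (hlt' | ⟨h1, h2⟩)
        · split_ifs <;> omega
        · have e : x u = x v := hX.const S hSX u h1.1 v (hLS h2)
          rw [if_pos h2, if_neg h1.2]
          omega
    · intro u v
      have := A.splitClass_le L S u
      have := A.splitClass_le L S v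
      omega
    · intro T hT
      simp only [List.mem_append, List.mem_cons] at hT ⊢
      tauto
    · intro u v huv
      have h1 := A.splitClass_le L S u
      have h2 := A.splitClass_le L S v
      have hru : r u ≤ r v := by omega
      have hxu := h.mono u v hru
      split_ifs with h3 h4 h4
      all_goals first | omega | skip
      rcases hxu.lt_or_eq with hxu | hxu
      · omega
      · exact absurd (hlt u h3 v ⟨hxS u v hxu (hLS h3), h4⟩) (by omega)
    · intro u v huv
      have := A.splitClass_le L S v
      omega
    · intro u v e hlt'
      exact .inr ⟨by omega, hlt⟩

end Step

/-! ### Termination and correctness of the refinement -/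

/-- A rank function of the initial partition: the source comes first, the other states are ordered
by their letters. -/
structure LetterRank (A : SourceNFA Sig Q) (g : Sig → ℕ) (key : Q → ℕ) : Prop where
  src : key A.src = 0
  step : ∀ u v a, v ∈ A.step u a → key v = g a + 1

theorem Standard.exists_step {A : SourceNFA Sig Q} (hA : A.Standard) {v : Q} (hv : v ≠ A.src) :
    ∃ u a, v ∈ A.step u a := by
  obtain ⟨a, ⟨u, hu⟩, -⟩ := hA.inputConsistent v hv
  exact ⟨u, a, hu⟩

theorem Standard.letter_unique {A : SourceNFA Sig Q} (hA : A.Standard) {u u' v : Q} {a b : Sig}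
    (h : v ∈ A.step u a) (h' : v ∈ A.step u' b) : a = b := by
  have hv : v ≠ A.src := fun e => hA.not_mem_src u a (e ▸ h)
  exact (hA.inputConsistent v hv).unique ⟨u, h⟩ ⟨u', h'⟩

open Classical in
theorem Standard.exists_letterRank {A : SourceNFA Sig Q} (hA : A.Standard) (g : Sig → ℕ) :
    ∃ key, A.LetterRank g key := by
  refine ⟨fun v => if h : ∃ a u, v ∈ A.step u a then g h.choose + 1 else 0, ?_, ?_⟩
  · rw [dif_neg]
    rintro ⟨a, u, h⟩
    exact hA.not_mem_src u a h
  · intro u v a h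
    have hex : ∃ a u, v ∈ A.step u a := ⟨a, u, h⟩
    rw [dif_pos hex]
    obtain ⟨u', hu'⟩ := hex.choose_spec
    rw [hA.letter_unique hu' h]

theorem ranks_refineInit [Fintype Sig] [LinearOrder Sig] {A : SourceNFA Sig Q} (hA : A.Standard)
    {g : Sig → ℕ} (hg : StrictMono g) {key : Q → ℕ} (h : A.LetterRank g key) :
    Ranks key A.refineInit.P := by
  have himg : ∀ a v, v ∈ A.img a Set.univ ↔ ∃ u, v ∈ A.step u a := by simp [img]
  refine ⟨?_, ?_, ?_, ?_⟩
  · intro D hD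
    simp only [refineInit, List.mem_cons, List.mem_map, Finset.mem_sort, Finset.mem_univ,
      true_and] at hD
    rcases hD with rfl | ⟨a, rfl⟩
    · exact Set.singleton_nonempty _
    · obtain ⟨u, v, hv⟩ := hA.letter_used a
      exact ⟨v, (himg a v).2 ⟨u, hv⟩⟩
  · intro v
    by_cases hv : v = A.src
    · exact ⟨{A.src}, by simp [refineInit], hv⟩
    · obtain ⟨u, a, hs⟩ := hA.exists_step hv
      exact ⟨A.img a Set.univ, by simp [refineInit], (himg a v).2 ⟨u, hs⟩⟩
  · intro D hD u hu v hv
    simp only [refineInit, List.mem_cons, List.mem_map, Finset.mem_sort, Finset.mem_univ,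
      true_and] at hD
    rcases hD with rfl | ⟨a, rfl⟩
    · rw [Set.mem_singleton_iff.1 hu, Set.mem_singleton_iff.1 hv]
    · obtain ⟨p, hp⟩ := (himg a u).1 hu
      obtain ⟨q, hq⟩ := (himg a v).1 hv
      rw [h.step p u a hp, h.step q v a hq]
  · simp only [refineInit, List.pairwise_cons, List.mem_map, List.pairwise_map]
    constructor
    · rintro D ⟨a, -, rfl⟩ u hu v hv
      obtain ⟨q, hq⟩ := (himg a v).1 hv
      rw [Set.mem_singleton_iff.1 hu, h.src, h.step q v a hq]
      omega
    · refine (Finset.sortedLT_sort (Finset.univ : Finset Sig)).pairwise.imp ?_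
      intro a b hab u hu v hv
      obtain ⟨p, hp⟩ := (himg a u).1 hu
      obtain ⟨q, hq⟩ := (himg b v).1 hv
      rw [h.step p u a hp, h.step q v b hq]
      have := hg hab
      omega

theorem FwdStablePartition.step_iff {A : SourceNFA Sig Q} {F : Setoid Q}
    (hF : A.FwdStablePartition F) {p u v : Q} {a : Sig} (huv : F u v) (hu : u ∈ A.step p a) :
    ∃ q, v ∈ A.step q a := by
  rcases hF {z | F z u} ⟨u, rfl⟩ {z | F z p} ⟨p, rfl⟩ a with h | h
  · obtain ⟨q, -, hq⟩ := h (F.symm huv : v ∈ {z | F z u})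
    exact ⟨q, hq⟩
  · have hm : u ∈ {z | F z u} ∩ A.img a {z | F z p} := ⟨F.refl u, p, F.refl p, hu⟩
    rw [h] at hm
    exact hm.elim

theorem refineInv_init [Fintype Sig] [LinearOrder Sig] {A : SourceNFA Sig Q} (hA : A.Standard)
    {g : Sig → ℕ} (hg : StrictMono g) {key : Q → ℕ} (h : A.LetterRank g key) :
    A.RefineInv A.refineInit key fun _ => 0 where
  ranksP := ranks_refineInit hA hg h
  ranksX := ⟨fun D hD => ⟨A.src, by simp_all [refineInit]⟩, by simp [refineInit], by simp,
    by simp [refineInit]⟩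
  mono := by simp
  letter u v u' v' a b e hv hv' := by
    rw [h.step u v a hv, h.step u' v' b hv'] at e
    exact hg.injective (by omega)
  stable S hS v v' e hv := by
    obtain rfl : S = Set.univ := by simpa [refineInit] using hS
    obtain ⟨a, u, -, hs⟩ := mem_imgAll.1 hv
    have hv' : v' ≠ A.src := by
      rintro rfl
      rw [h.src, h.step u v a hs] at e
      omega
    obtain ⟨u', b, hs'⟩ := hA.exists_step hv'
    exact mem_imgAll.2 ⟨b, u', trivial, hs'⟩
  coarse F hF u v huv := by
    by_cases hu : u = A.src
    · by_cases hv : v = A.src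
      · rw [hu, hv]
      · obtain ⟨p, a, hs⟩ := hA.exists_step hv
        obtain ⟨q, hq⟩ := hF.step_iff (F.symm huv) hs
        exact (hA.not_mem_src q a (hu ▸ hq)).elim
    · obtain ⟨p, a, hs⟩ := hA.exists_step hu
      obtain ⟨q, hq⟩ := hF.step_iff huv hs
      rw [h.step p u a hs, h.step q v a hq]
  wheeler := by
    rintro ρ ⟨hρ, hst, hw⟩ u v huv
    have key_lt : ∀ {u v}, hρ.quotLT (Quotient.mk _ v) (Quotient.mk _ u) → ¬ ρ u v := by
      rintro u v ⟨v', u', ev, eu, -, h2⟩ huv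
      exact h2 (hρ.trans _ _ _ (Quotient.exact eu).1 (hρ.trans _ _ _ huv (Quotient.exact ev).2))
    by_contra hlt
    rw [not_le] at hlt
    have hu : u ≠ A.src := by
      rintro rfl
      rw [h.src] at hlt
      omega
    obtain ⟨p, a, hs⟩ := hA.exists_step hu
    by_cases hv : v = A.src
    · subst hv
      by_cases he : Quotient.mk hρ.toSetoid u = Quotient.mk hρ.toSetoid A.src
      · have he' : hρ.toSetoid u A.src := Quotient.exact he
        obtain ⟨q, hq⟩ := hst.1.step_iff he' hs
        exact hA.not_mem_src q a hq
      · exact key_lt (hw.src_lt _ he) huv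
    · obtain ⟨q, b, hs'⟩ := hA.exists_step hv
      rw [h.step p u a hs, h.step q v b hs'] at hlt
      have hba : b < a := hg.lt_iff_lt.1 (by omega)
      exact key_lt (hw.of_letter_lt _ _ b _ _ a ⟨q, v, rfl, rfl, hs'⟩ ⟨p, u, rfl, rfl, hs⟩ hba) huv

section Run

variable [LinearOrder Sig] {A : SourceNFA Sig Q}

theorem Standard.exists_refineInv_init [Fintype Sig] (hA : A.Standard) :
    ∃ r x, A.RefineInv A.refineInit r x := by
  let g : Sig → ℕ := fun a => (Fintype.orderIsoFinOfCardEq Sig rfl).symm a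
  have hg : StrictMono g := fun a b hab => by
    simpa [g] using hab
  obtain ⟨key, hkey⟩ := hA.exists_letterRank g
  exact ⟨key, _, refineInv_init hA hg hkey⟩

theorem Standard.exists_refineInv [Fintype Sig] (hA : A.Standard) {c : RefineConfig Q}
    (hc : A.RefineReaches c) : ∃ r x, A.RefineInv c r x := by
  induction hc with
  | refl => exact hA.exists_refineInv_init
  | tail _ hstep ih =>
    obtain ⟨r, x, h⟩ := ih
    exact (h.exists_body hstep.2).1

theorem Standard.acc_refineInit [Fintype Sig] [Finite Q] (hA : A.Standard) :
    Acc (fun d c => A.RefineIter c d) A.refineInit := by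
  have key : ∀ (k : ℕ) (c : RefineConfig Q) (r x : Q → ℕ), A.RefineInv c r x →
      Nat.card Q - c.X.length = k → Acc (fun d c => A.RefineIter c d) c := by
    intro k
    induction k using Nat.strong_induction_on with
    | _ k ih =>
      intro c r x h hk
      refine ⟨_, fun d hd => ?_⟩
      obtain ⟨⟨r', x', h'⟩, hlen⟩ := h.exists_body hd.2
      have := h'.ranksX.length_le
      exact ih (Nat.card Q - d.X.length) (by omega) d r' x' h' rfl
  obtain ⟨r, x, h⟩ := hA.exists_refineInv_init
  exact key _ _ r x h rfl

/-- If every block of `X` is a block of `P`, then the two ordered partitions agree. -/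
theorem _root_.Ranks.eq_of_mono {r x : Q → ℕ} {P X : List (Set Q)} (hP : Ranks r P)
    (hX : Ranks x X) (hrx : ∀ u v, r u ≤ r v → x u ≤ x v) (h : ∀ u v, x u = x v → r u = r v) :
    X = P := by
  refine hX.unique (hP.of_order fun u v => ?_)
  have h1 := hrx u v
  have h2 := hrx v u
  have h3 := h u v
  omega

theorem RefineInv.exists_iter [Finite Q] {c : RefineConfig Q} {r x : Q → ℕ}
    (h : A.RefineInv c r x) (hne : c.X ≠ c.P) : ∃ d, A.RefineIter c d := by
  classical
  have hex : ∃ k, ∃ u v, x u = k ∧ x v = k ∧ r u ≠ r v := by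
    by_contra hc
    refine hne (h.ranksP.eq_of_mono h.ranksX h.mono fun u v e => ?_)
    by_contra hr
    exact hc ⟨x v, u, v, e, rfl, hr⟩
  obtain ⟨u, v, hu, hv, huv⟩ := Nat.find_spec hex
  have hS : {w | x w = Nat.find hex}.Nonempty := ⟨u, hu⟩
  obtain ⟨v₁, h₁, hmin⟩ := (Set.toFinite {w | x w = Nat.find hex}).exists_minimalFor r _ hS
  obtain ⟨v₂, h₂, hmax⟩ := (Set.toFinite {w | x w = Nat.find hex}).exists_maximalFor r _ hS
  have hmin' : ∀ w, x w = Nat.find hex → r v₁ ≤ r w := fun w hw =>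
    (le_total (r v₁) (r w)).elim id fun hle => hmin hw hle
  have hmax' : ∀ w, x w = Nat.find hex → r w ≤ r v₂ := fun w hw =>
    (le_total (r w) (r v₂)).elim id fun hle => hmax hw hle
  have h₁' : x v₁ = Nat.find hex := h₁
  have h₂' : x v₂ = Nat.find hex := h₂
  have hch : SplitChoice r x v₁ v₂ := by
    refine ⟨?_, h₁'.trans h₂'.symm, ?_, ?_, ?_⟩
    · intro p q e hlt
      by_contra hc
      exact Nat.find_min hex (h₁' ▸ hlt) ⟨p, q, rfl, e.symm, hc⟩
    · have := hmin' u hu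
      have := hmin' v hv
      have := hmax' u hu
      have := hmax' v hv
      omega
    · exact fun w hw => hmin' w (hw.trans h₁')
    · exact fun w hw => hmax' w (hw.trans h₁')
  obtain ⟨X₁, X₂, e, h1, h2, h3, h4, h5⟩ := hch.lists h.ranksP h.ranksX h.mono
  obtain ⟨X, P⟩ := c
  obtain rfl : X = _ := e
  rcases le_total {w | r w = r v₁}.ncard {w | r w = r v₂}.ncard with hle | hle
  · exact ⟨_, hne, .first X₁ X₂ P _ _ _ h1 h2 h3 h4 hle⟩
  · exact ⟨_, hne, .last X₁ X₂ P _ _ _ h1 h2 h3 h4 hle⟩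

/-- When the loop ends, the partition is the coarsest forward-stable one. -/
theorem RefineInv.isCoarsest {P : List (Set Q)} {r x : Q → ℕ} (h : A.RefineInv ⟨P, P⟩ r x)
    (hp : TotalPreorderRel (partLE P)) : A.IsCoarsestFwdStable hp.toSetoid := by
  have hP : Ranks r P := h.ranksP
  have hiff : ∀ u v, hp.toSetoid u v ↔ r u = r v := by
    intro u v
    change partLE P u v ∧ partLE P v u ↔ _
    rw [hP.partLE_iff, hP.partLE_iff]
    omega
  refine ⟨?_, fun F hF => fun {u v} huv => (hiff u v).2 (h.coarse F hF u v huv)⟩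
  rintro _ ⟨u, rfl⟩ _ ⟨w, rfl⟩ a
  have hT : {z | hp.toSetoid z w} = {z | r z = r w} := by
    ext z
    exact hiff z w
  by_cases hex : ∃ v, hp.toSetoid v u ∧ v ∈ A.img a {z | hp.toSetoid z w}
  · refine .inl fun v' hv' => ?_
    obtain ⟨v, hv, p, hp', hs⟩ := hex
    have e : r v = r v' := ((hiff v u).1 hv).trans ((hiff v' u).1 hv').symm
    have hst := h.stable {z | r z = r w} (hP.fiber_mem w) v v' e
      (mem_imgAll.2 ⟨a, p, hT ▸ hp', hs⟩)
    obtain ⟨b, q, hq, hs'⟩ := mem_imgAll.1 hst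
    obtain rfl := h.letter p v q v' a b e hs hs'
    exact ⟨q, hT ▸ hq, hs'⟩
  · refine .inr (Set.eq_empty_of_forall_notMem ?_)
    rintro v ⟨hv, hv'⟩
    exact hex ⟨v, hv, hv'⟩

/-- When the loop ends, `r` and any Wheeler preorder have the same classes, on which `r` is monotone
and injective; so they are the same preorder. -/
theorem RefineInv.isWheelerPreorder_iff {P : List (Set Q)} {r x : Q → ℕ}
    (h : A.RefineInv ⟨P, P⟩ r x) : A.IsWheelerPreorder (partLE P) ↔ A.QuasiWheeler := by
  refine ⟨fun hw => ⟨_, hw⟩, ?_⟩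
  rintro ⟨ρ, hρ⟩
  have hP : Ranks r P := h.ranksP
  have hc := h.isCoarsest hP.totalPreorderRel
  obtain ⟨hpre, hst, hw⟩ := id hρ
  have hle := hst.2 _ hc.1
  have : partLE P = ρ := by
    funext u v
    apply propext
    rw [hP.partLE_iff]
    refine ⟨fun huv => ?_, h.wheeler ρ hρ u v⟩
    rcases hpre.total u v with h1 | h1
    · exact h1
    · have h2 := h.wheeler ρ hρ v u h1
      have h3 : hP.totalPreorderRel.toSetoid u v :=
        ⟨(hP.partLE_iff u v).2 huv, (hP.partLE_iff v u).2 h2⟩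
      exact (hle h3).1
  rwa [this]

end Run

end SourceNFA

/-! ### Reasoning about programs of the random access machine -/

/-- `p.Runs s Φ`: started in `s`, the program `p` halts after some number `t` of steps in a memory
`s₂` with `Φ t s₂`. -/
def RamProg.Runs (p : RamProg) (s : RamState) (Φ : ℕ → RamState → Prop) : Prop :=
  ∃ t s₂, RamExec p s t s₂ ∧ Φ t s₂

namespace RamProg

variable {s : RamState} {Φ Ψ : ℕ → RamState → Prop}

theorem Runs.mono {p : RamProg} (h : p.Runs s Φ) (hΦ : ∀ t s₂, Φ t s₂ → Ψ t s₂) : p.Runs s Ψ :=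
  let ⟨t, s₂, he, hp⟩ := h
  ⟨t, s₂, he, hΦ t s₂ hp⟩

theorem runs_const {x c : ℕ} : (const x c).Runs s Φ ↔ Φ 1 (s.setReg x c) :=
  ⟨fun ⟨_, _, he, h⟩ => by cases he; exact h, fun h => ⟨_, _, .const s x c, h⟩⟩

theorem runs_copy {x y : ℕ} : (copy x y).Runs s Φ ↔ Φ 1 (s.setReg x (s.reg y)) :=
  ⟨fun ⟨_, _, he, h⟩ => by cases he; exact h, fun h => ⟨_, _, .copy s x y, h⟩⟩

theorem runs_inc {x : ℕ} : (inc x).Runs s Φ ↔ Φ 1 (s.setReg x (s.reg x + 1)) :=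
  ⟨fun ⟨_, _, he, h⟩ => by cases he; exact h, fun h => ⟨_, _, .inc s x, h⟩⟩

theorem runs_dec {x : ℕ} : (dec x).Runs s Φ ↔ Φ 1 (s.setReg x (s.reg x - 1)) :=
  ⟨fun ⟨_, _, he, h⟩ => by cases he; exact h, fun h => ⟨_, _, .dec s x, h⟩⟩

theorem runs_load {x a y : ℕ} :
    (load x a y).Runs s Φ ↔ Φ 1 (s.setReg x (s.arr a (s.reg y))) :=
  ⟨fun ⟨_, _, he, h⟩ => by cases he; exact h, fun h => ⟨_, _, .load s x a y, h⟩⟩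

theorem runs_store {a x y : ℕ} :
    (store a x y).Runs s Φ ↔ Φ 1 (s.setArr a (s.reg x) (s.reg y)) :=
  ⟨fun ⟨_, _, he, h⟩ => by cases he; exact h, fun h => ⟨_, _, .store s a x y, h⟩⟩

theorem runs_seq {p q : RamProg} :
    (seq p q).Runs s Φ ↔ p.Runs s fun t s₂ => q.Runs s₂ fun t₂ s₃ => Φ (t + t₂) s₃ := by
  constructor
  · rintro ⟨_, _, he, h⟩
    cases he with
    | seq h1 h2 => exact ⟨_, _, h1, _, _, h2, h⟩
  · rintro ⟨_, _, h1, _, _, h2, h⟩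
    exact ⟨_, _, .seq h1 h2, h⟩

theorem runs_cond {b : RamTest} {p q : RamProg} :
    (cond b p q).Runs s Φ ↔ (b.Holds s → p.Runs s fun t => Φ (t + 1)) ∧
      (¬ b.Holds s → q.Runs s fun t => Φ (t + 1)) := by
  constructor
  · rintro ⟨_, _, he, h⟩
    cases he with
    | condTrue hb h1 => exact ⟨fun _ => ⟨_, _, h1, h⟩, fun hc => absurd hb hc⟩
    | condFalse hb h1 => exact ⟨fun hc => absurd hc hb, fun _ => ⟨_, _, h1, h⟩⟩
  · rintro ⟨h1, h2⟩
    by_cases hb : b.Holds s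
    · obtain ⟨t, s₂, he, h⟩ := h1 hb
      exact ⟨_, _, .condTrue hb he, h⟩
    · obtain ⟨t, s₂, he, h⟩ := h2 hb
      exact ⟨_, _, .condFalse hb he, h⟩

theorem runs_loop {b : RamTest} {p : RamProg} :
    (loop b p).Runs s Φ ↔
      (b.Holds s → p.Runs s fun t s₂ => (loop b p).Runs s₂ fun t₂ s₃ => Φ (t + t₂ + 1) s₃) ∧
      (¬ b.Holds s → Φ 1 s) := by
  constructor
  · rintro ⟨_, _, he, h⟩
    cases he with
    | loopTrue hb h1 h2 => exact ⟨fun _ => ⟨_, _, h1, _, _, h2, h⟩, fun hc => absurd hb hc⟩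
    | loopFalse hb => exact ⟨fun hc => absurd hc hb, fun _ => h⟩
  · rintro ⟨h1, h2⟩
    by_cases hb : b.Holds s
    · obtain ⟨_, _, e1, _, _, e2, h⟩ := h1 hb
      exact ⟨_, _, .loopTrue hb e1 e2, h⟩
    · exact ⟨_, _, .loopFalse hb, h2 hb⟩

/-- A loop with the invariant `I k t s`, where `k` is a variant and `t` is the time spent so far. -/
theorem runs_loop_of_variant {b : RamTest} {p : RamProg} (I : ℕ → ℕ → RamState → Prop) (k₀ : ℕ)
    (h0 : I k₀ 0 s)
    (hstep : ∀ k t s, I k t s → b.Holds s → p.Runs s fun t₂ s₂ => ∃ k' < k, I k' (t + t₂ + 1) s₂)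
    (hend : ∀ k t s, I k t s → ¬ b.Holds s → Φ (t + 1) s) : (loop b p).Runs s Φ := by
  have key : ∀ k t s, I k t s → (loop b p).Runs s fun t₂ => Φ (t + t₂) := by
    intro k
    induction k using Nat.strong_induction_on with
    | _ k ih =>
      intro t s hI
      rw [runs_loop]
      refine ⟨fun hb => (hstep k t s hI hb).mono ?_, fun hb => hend k t s hI hb⟩
      rintro t₂ s₂ ⟨k', hk', hI₂⟩
      refine (ih k' hk' _ s₂ hI₂).mono fun t₃ s₃ h => ?_
      rwa [show t + (t₂ + t₃ + 1) = t + t₂ + 1 + t₃ by omega]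
  simpa using key k₀ 0 s h0

/-- A loop with `N` iterations; `I i t s` is the invariant after `i` iterations and `t` steps. -/
theorem runs_loop_of_count {b : RamTest} {p : RamProg} (N : ℕ) (I : ℕ → ℕ → RamState → Prop)
    (h0 : I 0 0 s) (hb : ∀ i t s, i ≤ N → I i t s → (b.Holds s ↔ i < N))
    (hstep : ∀ i t s, i < N → I i t s → p.Runs s fun t₂ s₂ => I (i + 1) (t + t₂ + 1) s₂)
    (hend : ∀ t s, I N t s → Φ (t + 1) s) : (loop b p).Runs s Φ := by
  have key : ∀ k i t s, i + k = N → I i t s → (loop b p).Runs s fun t₂ => Φ (t + t₂) := by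
    intro k
    induction k with
    | zero =>
      intro i t s hi hI
      rw [runs_loop]
      have := hb i t s (by omega) hI
      obtain rfl : i = N := by omega
      exact ⟨fun h => absurd (this.1 h) (lt_irrefl i), fun _ => hend t s hI⟩
    | succ k ih =>
      intro i t s hi hI
      rw [runs_loop]
      have := hb i t s (by omega) hI
      refine ⟨fun h => (hstep i t s (by omega) hI).mono ?_, fun h => absurd (this.2 (by omega)) h⟩
      intro t₂ s₂ hI₂
      refine (ih (i + 1) _ s₂ (by omega) hI₂).mono fun t₃ s₃ h => ?_
      rwa [show t + (t₂ + t₃ + 1) = t + t₂ + 1 + t₃ by omega]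
  simpa using key N 0 0 s (by omega) h0

end RamProg

namespace RamState

theorem reg_setReg (s : RamState) (x c y : ℕ) :
    (s.setReg x c).reg y = if y = x then c else s.reg y := by
  simp [setReg, Function.update_apply]

theorem arr_setReg (s : RamState) (x c : ℕ) : (s.setReg x c).arr = s.arr := rfl

theorem reg_setArr (s : RamState) (a i c : ℕ) : (s.setArr a i c).reg = s.reg := rfl

theorem arr_setArr (s : RamState) (a i c b : ℕ) :
    (s.setArr a i c).arr b = if b = a then Function.update (s.arr a) i c else s.arr b := by
  by_cases h : b = a
  · subst h
    simp [setArr]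
  · simp [setArr, h]

end RamState

/-- The memories `s` and `s₂` differ at most in the registers in `R` and in the arrays in `A`. -/
def SameBut (R A : List ℕ) (s s₂ : RamState) : Prop :=
  (∀ x, x ∉ R → s₂.reg x = s.reg x) ∧ ∀ a, a ∉ A → s₂.arr a = s.arr a

namespace SameBut

variable {R R' A A' : List ℕ} {s s₂ s₃ : RamState}

theorem refl (R A : List ℕ) (s : RamState) : SameBut R A s s :=
  ⟨fun _ _ => rfl, fun _ _ => rfl⟩

theorem setReg_iff {x c : ℕ} (hx : x ∈ R) :
    SameBut R A s (s₂.setReg x c) ↔ SameBut R A s s₂ := by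
  unfold SameBut
  refine and_congr (forall_congr' fun y => forall_congr' fun hy => ?_) Iff.rfl
  rw [RamState.reg_setReg, if_neg (fun e : y = x => hy (e ▸ hx))]

theorem setArr_iff {a i c : ℕ} (ha : a ∈ A) :
    SameBut R A s (s₂.setArr a i c) ↔ SameBut R A s s₂ := by
  unfold SameBut
  refine and_congr Iff.rfl (forall_congr' fun y => forall_congr' fun hy => ?_)
  rw [RamState.arr_setArr, if_neg (fun e : y = a => hy (e ▸ ha))]

theorem trans (h : SameBut R A s s₂) (h' : SameBut R A s₂ s₃) : SameBut R A s s₃ :=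
  ⟨fun x hx => (h'.1 x hx).trans (h.1 x hx), fun a ha => (h'.2 a ha).trans (h.2 a ha)⟩

theorem mono (h : SameBut R A s s₂) (hR : ∀ x ∈ R, x ∈ R') (hA : ∀ a ∈ A, a ∈ A') :
    SameBut R' A' s s₂ :=
  ⟨fun x hx => h.1 x fun hc => hx (hR x hc), fun a ha => h.2 a fun hc => ha (hA a hc)⟩

end SameBut

/-! ### The memory layout of the program

The edges are the numbers below `m`, the states those below `n`, and the blocks of `P` are numbered
in the order of their creation. Links of linked lists are `0` for the end and `e + 1` for `e`.

Registers: `rN`, `rK`, `rM` hold the numbers of states, letters and edges, `rZero` and `rOne` the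
constants, `rBase` the number of leaves of the tree; `rBlk` and `rRec` hold the largest number of a
block and of a record; `rLen`, `rLenTwo` and `rTch` are the lengths of the lists in `aList`,
`aListTwo` and `aTch`. The other registers are temporary.

Arrays:
* `aTail`, `aLet`, `aHead` are the input and `aOut` is the output;
* `aPerm` lists the states, `aPos` is its inverse, `aBlk` maps states to their blocks, and `aSt`,
  `aEn`, `aSz` map blocks to their bounds and sizes;
* `aXe` maps the start of a block of `X` to its end;
* `aAux` maps a block that is being split to the block of the states moved from it, and `aTch` lists
  the blocks that are being split;
* `aRec` maps edges to their records, and `aCnt` maps records to the numbers of their edges;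
* `aTmp`, `aOld`, `aList`, `aListTwo` belong to the scan of edges, see `ScanInv`;
* `aHd` and `aNx` form the linked lists of the edges with the same tail, `aLhd` and `aLnx` those of
  the edges with the same letter;
* `aTree` holds the counters of the tree, and `aPar`, `aLft`, `aLeaf`, `aOff` its tables, see
  `TreeTables`. -/

notation "rN" => (0 : ℕ)
notation "rK" => (1 : ℕ)
notation "rM" => (2 : ℕ)
notation "rZero" => (4 : ℕ)
notation "rOne" => (5 : ℕ)
notation "rBase" => (6 : ℕ)
notation "rBlk" => (7 : ℕ)
notation "rRec" => (8 : ℕ)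
notation "rLen" => (9 : ℕ)
notation "rLenTwo" => (10 : ℕ)
notation "rTch" => (11 : ℕ)
notation "rJ" => (12 : ℕ)
notation "rS" => (13 : ℕ)
notation "rE" => (14 : ℕ)
notation "rF" => (15 : ℕ)
notation "rL" => (16 : ℕ)
notation "rB" => (17 : ℕ)
notation "rP" => (18 : ℕ)
notation "rQ" => (19 : ℕ)
notation "rU" => (20 : ℕ)
notation "rT" => (21 : ℕ)
notation "rW" => (22 : ℕ)
notation "rY" => (23 : ℕ)
notation "rV" => (24 : ℕ)
notation "rZ" => (25 : ℕ)
notation "rO" => (26 : ℕ)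
notation "rC" => (27 : ℕ)
notation "rI" => (28 : ℕ)
notation "rD" => (29 : ℕ)
notation "rG" => (30 : ℕ)
notation "rX" => (31 : ℕ)
notation "rH" => (32 : ℕ)
notation "rA" => (33 : ℕ)

notation "aTail" => (0 : ℕ)
notation "aLet" => (1 : ℕ)
notation "aHead" => (2 : ℕ)
notation "aOut" => (3 : ℕ)
notation "aPerm" => (4 : ℕ)
notation "aPos" => (5 : ℕ)
notation "aBlk" => (6 : ℕ)
notation "aSt" => (7 : ℕ)
notation "aEn" => (8 : ℕ)
notation "aSz" => (9 : ℕ)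
notation "aAux" => (10 : ℕ)
notation "aTch" => (11 : ℕ)
notation "aList" => (12 : ℕ)
notation "aListTwo" => (13 : ℕ)
notation "aTmp" => (14 : ℕ)
notation "aOld" => (15 : ℕ)
notation "aRec" => (16 : ℕ)
notation "aCnt" => (17 : ℕ)
notation "aHd" => (18 : ℕ)
notation "aNx" => (19 : ℕ)
notation "aLhd" => (20 : ℕ)
notation "aLnx" => (21 : ℕ)
notation "aPar" => (22 : ℕ)
notation "aLft" => (23 : ℕ)
notation "aLeaf" => (24 : ℕ)
notation "aOff" => (25 : ℕ)
notation "aTree" => (26 : ℕ)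
notation "aXe" => (27 : ℕ)

infixr:60 " ;; " => RamProg.seq

namespace RamProg

/-- No operation. -/
def skip : RamProg := copy rZero rZero

theorem runs_skip {s : RamState} {Φ : ℕ → RamState → Prop} : skip.Runs s Φ ↔ Φ 1 s := by
  rw [skip, runs_copy]
  simp [RamState.setReg]

end RamProg

/-! ### A set of natural numbers as a binary tree of counters -/

/-- `x` is an ancestor of the node `y` (or `y` itself) in the binary tree in which the children of
`x` are `2 * x` and `2 * x + 1`. -/
def IsAncestor (x y : ℕ) : Prop := ∃ k, y / 2 ^ k = x

theorem isAncestor_iff {x y : ℕ} : IsAncestor x y ↔ x = y ∨ IsAncestor x (y / 2) := by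
  constructor
  · rintro ⟨k, rfl⟩
    cases k with
    | zero => simp
    | succ k => exact .inr ⟨k, by rw [Nat.div_div_eq_div_mul, pow_succ']⟩
  · rintro (rfl | ⟨k, rfl⟩)
    · exact ⟨0, by simp⟩
    · exact ⟨k + 1, by rw [Nat.div_div_eq_div_mul, pow_succ']⟩

theorem IsAncestor.le {x y : ℕ} (h : IsAncestor x y) : x ≤ y := by
  obtain ⟨k, rfl⟩ := h
  exact Nat.div_le_self _ _

/-- The constant tables of the tree with `2 ^ h` leaves: parents, left children, and the
correspondence between the numbers below `n` and the leaves. -/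
structure TreeTables (n h : ℕ) (s : RamState) : Prop where
  zero : s.reg rZero = 0
  base : s.reg rBase = 2 ^ h
  par : ∀ y, y < 2 ^ (h + 1) → s.arr aPar y = y / 2
  lft : ∀ x, x < 2 ^ h → s.arr aLft x = 2 * x
  leaf : ∀ j, j < n → s.arr aLeaf j = 2 ^ h + j
  off : ∀ j, j < n → s.arr aOff (2 ^ h + j) = j
  le : n ≤ 2 ^ h

open Classical in
/-- The counters `tc` represent the set `M`: the counter of a node is the number of the elements of
`M` whose leaves lie below the node. -/
def TreeHolds (h : ℕ) (M : Finset ℕ) (tc : ℕ → ℕ) : Prop :=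
  ∀ x, 1 ≤ x → tc x = (M.filter fun j => IsAncestor x (2 ^ h + j)).card

namespace RamProg

/-- Apply `op` to the counters of all ancestors of the node in `rX`. -/
def walk (op : RamProg) : RamProg :=
  loop (.ne rX rZero) (load rH aTree rX ;; op ;; store aTree rX rH ;; load rX aPar rX)

open Classical in
theorem runs_walk {op : RamProg} {f : ℕ → ℕ}
    (hop : ∀ s Φ, op.Runs s Φ ↔ Φ 1 (s.setReg rH (f (s.reg rH)))) (g N : ℕ) :
    ∀ s : RamState, s.reg rZero = 0 → (∀ y, y < N → s.arr aPar y = y / 2) → s.reg rX < N →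
      s.reg rX < 2 ^ g → (walk op).Runs s fun t s₂ => t ≤ 5 * g + 1 ∧
        SameBut [rX, rH] [aTree] s s₂ ∧ ∀ y, 1 ≤ y →
          s₂.arr aTree y = if IsAncestor y (s.reg rX) then f (s.arr aTree y)
            else s.arr aTree y := by
  induction g with
  | zero =>
    intro s h0 hpar hN hg
    rw [walk, runs_loop]
    have hx : s.reg rX = 0 := by simpa using hg
    refine ⟨fun hb => absurd (hx.trans h0.symm) hb, fun _ => ⟨by omega, .refl _ _ _, ?_⟩⟩
    intro y hy
    rw [if_neg]
    intro hc
    have := hc.le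
    omega
  | succ g ih =>
    intro s h0 hpar hN hg
    rw [walk, runs_loop]
    constructor
    · intro hb
      have hx0 : s.reg rX ≠ 0 := fun e => hb (e.trans h0.symm)
      simp only [runs_seq, runs_load, runs_store, hop]
      have e : ∀ s' : RamState, s'.arr aPar = s.arr aPar → s'.reg rX = s.reg rX →
          s'.arr aPar (s'.reg rX) = s.reg rX / 2 := fun s' h1 h2 => by rw [h1, h2, hpar _ hN]
      refine (ih _ ?_ ?_ ?_ ?_).mono ?_
      · simpa [RamState.reg_setReg, RamState.reg_setArr] using h0
      · simpa [RamState.arr_setReg, RamState.arr_setArr] using hpar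
      · simp only [RamState.reg_setReg, if_true]
        rw [e _ (by simp [RamState.arr_setReg, RamState.arr_setArr])
          (by simp [RamState.reg_setReg, RamState.reg_setArr])]
        omega
      · simp only [RamState.reg_setReg, if_true]
        rw [e _ (by simp [RamState.arr_setReg, RamState.arr_setArr])
          (by simp [RamState.reg_setReg, RamState.reg_setArr])]
        rw [pow_succ] at hg
        omega
      · rintro t s₂ ⟨ht, hs, hy⟩
        refine ⟨by omega, ?_, ?_⟩
        · refine SameBut.trans ?_ hs
          simp [SameBut.setReg_iff, SameBut.setArr_iff, SameBut.refl]
        · intro y hy1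
          rw [hy y hy1]
          simp only [RamState.reg_setReg, if_true]
          rw [e _ (by simp [RamState.arr_setReg, RamState.arr_setArr])
            (by simp [RamState.reg_setReg, RamState.reg_setArr]), isAncestor_iff (y := s.reg rX)]
          simp only [RamState.arr_setReg, RamState.arr_setArr, if_true, Function.update_apply,
            Nat.reduceEqDiff, if_false]
          by_cases hyx : y = s.reg rX
          · have : ¬ IsAncestor y (s.reg rX / 2) := fun hc => by
              have := hc.le
              omega
            simp [hyx ▸ this, hyx]
          · simp [hyx]
    · intro hb
      have hx : s.reg rX = 0 := by simpa [RamTest.Holds, h0] using hb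
      refine ⟨by omega, .refl _ _ _, ?_⟩
      intro y hy
      rw [if_neg]
      intro hc
      have := hc.le
      omega

/-- Insert the number in the register `x` into the set. -/
def insertMark (x : ℕ) : RamProg := load rX aLeaf x ;; walk (inc rH)

/-- Delete the number in the register `x` from the set. -/
def deleteMark (x : ℕ) : RamProg := load rX aLeaf x ;; walk (dec rH)

theorem runs_insertMark {n h x : ℕ} {s : RamState} {M : Finset ℕ} (hs : TreeTables n h s)
    (hM : TreeHolds h M (s.arr aTree)) (hx : s.reg x < n) (hxM : s.reg x ∉ M) :
    (insertMark x).Runs s fun t s₂ => t ≤ 5 * h + 7 ∧ SameBut [rX, rH] [aTree] s s₂ ∧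
      TreeHolds h (insert (s.reg x) M) (s₂.arr aTree) := by
  classical
  have hle := hs.le
  have hpow : 2 ^ (h + 1) = 2 * 2 ^ h := pow_succ' 2 h
  rw [insertMark, runs_seq, runs_load]
  refine (runs_walk (f := (· + 1)) (fun s Φ => runs_inc) (h + 1) (2 ^ (h + 1)) _ ?_ ?_ ?_
    ?_).mono ?_
  · simpa [RamState.reg_setReg] using hs.zero
  · simpa [RamState.arr_setReg] using hs.par
  · simp only [RamState.reg_setReg, if_true, hs.leaf _ hx]
    omega
  · simp only [RamState.reg_setReg, if_true, hs.leaf _ hx]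
    omega
  · rintro t s₂ ⟨ht, hsame, htree⟩
    refine ⟨by omega, ?_, ?_⟩
    · refine SameBut.trans ?_ hsame
      simp [SameBut.setReg_iff, SameBut.refl]
    · intro y hy
      rw [htree y hy]
      simp only [RamState.reg_setReg, if_true, hs.leaf _ hx, RamState.arr_setReg, hM y hy,
        Finset.filter_insert]
      split_ifs
      · rw [Finset.card_insert_of_notMem (fun hc => hxM (Finset.mem_filter.1 hc).1)]
      · rfl

theorem runs_deleteMark {n h x : ℕ} {s : RamState} {M : Finset ℕ} (hs : TreeTables n h s)
    (hM : TreeHolds h M (s.arr aTree)) (hx : s.reg x < n) (hxM : s.reg x ∈ M) :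
    (deleteMark x).Runs s fun t s₂ => t ≤ 5 * h + 7 ∧ SameBut [rX, rH] [aTree] s s₂ ∧
      TreeHolds h (M.erase (s.reg x)) (s₂.arr aTree) := by
  classical
  have hle := hs.le
  have hpow : 2 ^ (h + 1) = 2 * 2 ^ h := pow_succ' 2 h
  rw [deleteMark, runs_seq, runs_load]
  refine (runs_walk (f := (· - 1)) (fun s Φ => runs_dec) (h + 1) (2 ^ (h + 1)) _ ?_ ?_ ?_
    ?_).mono ?_
  · simpa [RamState.reg_setReg] using hs.zero
  · simpa [RamState.arr_setReg] using hs.par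
  · simp only [RamState.reg_setReg, if_true, hs.leaf _ hx]
    omega
  · simp only [RamState.reg_setReg, if_true, hs.leaf _ hx]
    omega
  · rintro t s₂ ⟨ht, hsame, htree⟩
    refine ⟨by omega, ?_, ?_⟩
    · refine SameBut.trans ?_ hsame
      simp [SameBut.setReg_iff, SameBut.refl]
    · intro y hy
      rw [htree y hy]
      simp only [RamState.reg_setReg, if_true, hs.leaf _ hx, RamState.arr_setReg, hM y hy,
        Finset.filter_erase]
      split_ifs with hc
      · rw [Finset.card_erase_of_mem (Finset.mem_filter.2 ⟨hxM, hc⟩)]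
      · have hn : s.reg x ∉ M.filter fun j => IsAncestor y (2 ^ h + j) :=
          fun h' => hc (Finset.mem_filter.1 h').2
        rw [Finset.erase_eq_of_notMem hn]

/-- Descend to the leftmost leaf with a positive counter. -/
def findMark : RamProg :=
  const rX 1 ;; loop (.lt rX rBase) (load rX aLft rX ;; load rH aTree rX ;;
    cond (.eq rH rZero) (inc rX) skip) ;; load rJ aOff rX

theorem log_div_pow {h a g x : ℕ} (ha : 2 ^ h ≤ a) (ha' : a < 2 ^ (h + 1))
    (hx : a / 2 ^ g = x) (hx1 : 1 ≤ x) : g ≤ h ∧ Nat.log 2 x = h - g := by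
  have hlog : Nat.log 2 a = h := Nat.log_eq_of_pow_le_of_lt_pow ha ha'
  constructor
  · by_contra hc
    have : a / 2 ^ g = 0 :=
      Nat.div_eq_of_lt (ha'.trans_le (Nat.pow_le_pow_right two_pos (by omega)))
    omega
  · rw [← hx, Nat.log_div_base_pow, hlog]

/-- The loop of `findMark`, from a node with `g` levels below it that is the leftmost node of its
level with a positive counter. -/
theorem runs_descend {n h : ℕ} {M : Finset ℕ} (hMn : ∀ j ∈ M, j < n) (g : ℕ) :
    ∀ s : RamState, TreeTables n h s → TreeHolds h M (s.arr aTree) → 1 ≤ s.reg rX →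
      (∃ j ∈ M, (2 ^ h + j) / 2 ^ g = s.reg rX) →
      (∀ j ∈ M, s.reg rX ≤ (2 ^ h + j) / 2 ^ g) →
      (loop (.lt rX rBase) (load rX aLft rX ;; load rH aTree rX ;;
        cond (.eq rH rZero) (inc rX) skip)).Runs s fun t s₂ => t ≤ 5 * g + 1 ∧
          SameBut [rX, rH] [] s s₂ ∧ ∃ j ∈ M, s₂.reg rX = 2 ^ h + j ∧ ∀ i ∈ M, j ≤ i := by
  classical
  have hpow : 2 ^ (h + 1) = 2 * 2 ^ h := pow_succ' 2 h
  induction g with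
  | zero =>
    rintro s hs hM h1 ⟨j, hj, hjx⟩ hmin
    rw [runs_loop]
    simp only [pow_zero, Nat.div_one] at hjx hmin
    have hb := hs.base
    refine ⟨fun hc => ?_, fun _ => ⟨by omega, .refl _ _ _, j, hj, hjx.symm, fun i hi => ?_⟩⟩
    · simp only [RamTest.Holds] at hc
      omega
    · have := hmin i hi
      omega
  | succ g ih =>
    rintro s hs hM h1 ⟨j, hj, hjx⟩ hmin
    have hle := hs.le
    have hjn := hMn j hj
    obtain ⟨hgh, hlog⟩ := log_div_pow (h := h) (by omega) (by omega) hjx h1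
    have hdiv : ∀ i, (2 ^ h + i) / 2 ^ (g + 1) = (2 ^ h + i) / 2 ^ g / 2 := fun i => by
      rw [Nat.div_div_eq_div_mul, pow_succ]
    have hlt : s.reg rX < 2 ^ h := by
      rw [← hjx]
      refine Nat.div_lt_of_lt_mul ?_
      have : 2 ^ 1 ≤ 2 ^ (g + 1) := Nat.pow_le_pow_right two_pos (by omega)
      nlinarith [Nat.pos_of_ne_zero (show 2 ^ h ≠ 0 by positivity)]
    have hl : s.arr aLft (s.reg rX) = 2 * s.reg rX := hs.lft _ hlt
    rw [runs_loop]
    refine ⟨fun _ => ?_, fun hc => absurd (by simpa [RamTest.Holds, hs.base] using hlt) hc⟩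
    have hcount := hM (2 * s.reg rX) (by omega)
    simp only [runs_seq, runs_load, runs_cond, runs_inc, runs_skip, RamTest.Holds,
      RamState.reg_setReg, RamState.arr_setReg, if_true, Nat.reduceEqDiff, if_false, hs.zero, hl]
    have htab : ∀ y z, TreeTables n h ((s.setReg rX y).setReg rH z) := fun y z =>
      ⟨hs.zero, hs.base, hs.par, hs.lft, hs.leaf, hs.off, hs.le⟩
    constructor
    · intro hz
      have hno : ∀ i ∈ M, (2 ^ h + i) / 2 ^ g ≠ 2 * s.reg rX := by
        intro i hi hc
        rw [hz] at hcount
        have := Finset.card_eq_zero.1 hcount.symm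
        have hm : i ∈ M.filter fun j => IsAncestor (2 * s.reg rX) (2 ^ h + j) :=
          Finset.mem_filter.2 ⟨hi, g, hc⟩
        rw [this] at hm
        simp at hm
      refine (ih (((s.setReg rX (2 * s.reg rX)).setReg rH _).setReg rX (2 * s.reg rX + 1))
        ?_ ?_ ?_ ?_ ?_).mono ?_
      · exact ⟨hs.zero, hs.base, hs.par, hs.lft, hs.leaf, hs.off, hs.le⟩
      · simpa [RamState.arr_setReg] using hM
      · simp [RamState.reg_setReg]
      · refine ⟨j, hj, ?_⟩
        have h2 := hno j hj
        rw [hdiv] at hjx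
        simp only [RamState.reg_setReg, if_true]
        omega
      · intro i hi
        have h2 := hno i hi
        have h3 := hmin i hi
        rw [hdiv] at h3
        simp only [RamState.reg_setReg, if_true]
        omega
      · rintro t s₂ ⟨ht, hsame, hres⟩
        refine ⟨by omega, SameBut.trans ?_ hsame, hres⟩
        simp [SameBut.setReg_iff, SameBut.refl]
    · intro hz
      have hyes : ∃ i ∈ M, (2 ^ h + i) / 2 ^ g = 2 * s.reg rX := by
        rw [hcount] at hz
        obtain ⟨i, hi⟩ := Finset.card_pos.1 (Nat.pos_of_ne_zero hz)
        obtain ⟨hi, k, hk⟩ := Finset.mem_filter.1 hi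
        refine ⟨i, hi, ?_⟩
        have hin := hMn i hi
        obtain ⟨hkh, hlog'⟩ := log_div_pow (h := h) (by omega) (by omega) hk (by omega)
        rw [mul_comm, Nat.log_mul_base (by omega) (by omega), hlog] at hlog'
        obtain rfl : k = g := by omega
        exact hk
      refine (ih ((s.setReg rX (2 * s.reg rX)).setReg rH _) (htab _ _) ?_ ?_ ?_ ?_).mono ?_
      · simpa [RamState.arr_setReg] using hM
      · simp [RamState.reg_setReg]
        omega
      · obtain ⟨i, hi, he⟩ := hyes
        exact ⟨i, hi, by simpa [RamState.reg_setReg] using he⟩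
      · intro i hi
        have h3 := hmin i hi
        rw [hdiv] at h3
        simp only [RamState.reg_setReg, if_true, Nat.reduceEqDiff, if_false]
        omega
      · rintro t s₂ ⟨ht, hsame, hres⟩
        refine ⟨by omega, SameBut.trans ?_ hsame, hres⟩
        simp [SameBut.setReg_iff, SameBut.refl]

theorem runs_findMark {n h : ℕ} {s : RamState} {M : Finset ℕ} (hs : TreeTables n h s)
    (hM : TreeHolds h M (s.arr aTree)) (hMn : ∀ j ∈ M, j < n) (hne : M.Nonempty) :
    findMark.Runs s fun t s₂ => t ≤ 5 * h + 3 ∧ SameBut [rX, rH, rJ] [] s s₂ ∧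
      s₂.reg rJ ∈ M ∧ ∀ i ∈ M, s₂.reg rJ ≤ i := by
  have hle := hs.le
  have hone : ∀ j ∈ M, (2 ^ h + j) / 2 ^ h = 1 := by
    intro j hj
    have := hMn j hj
    rw [Nat.add_div_left _ (by positivity), Nat.div_eq_of_lt (by omega)]
  simp only [findMark, runs_seq, runs_const, runs_load]
  refine (runs_descend hMn h (s.setReg rX 1)
    ⟨hs.zero, hs.base, hs.par, hs.lft, hs.leaf, hs.off, hs.le⟩ ?_ ?_ ?_ ?_).mono ?_
  · simpa [RamState.arr_setReg] using hM
  · simp [RamState.reg_setReg]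
  · obtain ⟨j, hj⟩ := hne
    exact ⟨j, hj, by simpa [RamState.reg_setReg] using hone j hj⟩
  · intro j hj
    simp [RamState.reg_setReg, hone j hj]
  · rintro t s₂ ⟨ht, hsame, j, hj, hjx, hmin⟩
    have hoff : s₂.arr aOff (s₂.reg rX) = j := by
      rw [hsame.2 aOff (by simp), RamState.arr_setReg, hjx, hs.off j (hMn j hj)]
    refine ⟨by omega, ?_, ?_, ?_⟩
    · rw [SameBut.setReg_iff (by simp)]
      refine SameBut.trans ?_ (hsame.mono (by simp) (by simp))
      simp [SameBut.setReg_iff, SameBut.refl]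
    · simpa [RamState.reg_setReg, hoff] using hj
    · simpa [RamState.reg_setReg, hoff] using hmin

end RamProg

/-! ### Lists of edges and of states in the memory -/

/-- The entries `lst 0, …, lst (len - 1)` are the elements of `Z`, each of them once. -/
structure Enumerates (lst : ℕ → ℕ) (len : ℕ) (Z : Set ℕ) : Prop where
  inj : ∀ i j, i < len → j < len → lst i = lst j → i = j
  mem : ∀ v, v ∈ Z ↔ ∃ i < len, lst i = v

theorem Enumerates.empty (lst : ℕ → ℕ) : Enumerates lst 0 ∅ :=
  ⟨by omega, by simp⟩

theorem Enumerates.push {lst : ℕ → ℕ} {len : ℕ} {Z : Set ℕ} (h : Enumerates lst len Z) {v : ℕ}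
    (hv : v ∉ Z) : Enumerates (Function.update lst len v) (len + 1) (insert v Z) := by
  have hne : ∀ i < len, lst i ≠ v := fun i hi e => hv ((h.mem v).2 ⟨i, hi, e⟩)
  constructor
  · intro i j hi hj e
    simp only [Function.update_apply] at e
    split_ifs at e with h1 h2 h2
    · omega
    · exact absurd e.symm (hne j (by omega))
    · exact absurd e (hne i (by omega))
    · exact h.inj i j (by omega) (by omega) e
  · intro w
    rw [Set.mem_insert_iff, h.mem]
    constructor
    · rintro (rfl | ⟨i, hi, rfl⟩)
      · exact ⟨len, by omega, by simp⟩
      · exact ⟨i, by omega, by simp [hi.ne]⟩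
    · rintro ⟨i, hi, e⟩
      simp only [Function.update_apply] at e
      split_ifs at e with h1
      · exact .inl e.symm
      · exact .inr ⟨i, by omega, e⟩

theorem Enumerates.congr_set {lst : ℕ → ℕ} {len : ℕ} {Z Z' : Set ℕ} (h : Enumerates lst len Z)
    (hZ : ∀ v, v ∈ Z ↔ v ∈ Z') : Enumerates lst len Z' :=
  ⟨h.inj, fun v => (hZ v).symm.trans (h.mem v)⟩

/-- The link `w` starts the linked list with the entries `l`: a link is `0` at the end of the list
and `e + 1` if the next entry is `e`; the link after the entry `e` is `nx e`. -/
def IsLinkedList (nx : ℕ → ℕ) : ℕ → List ℕ → Prop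
  | w, [] => w = 0
  | w, e :: l => w = e + 1 ∧ IsLinkedList nx (nx e) l

theorem IsLinkedList.congr {nx nx' : ℕ → ℕ} {l : List ℕ} {w : ℕ} (h : IsLinkedList nx w l)
    (hn : ∀ e ∈ l, nx' e = nx e) : IsLinkedList nx' w l := by
  induction l generalizing w with
  | nil => exact h
  | cons e l ih =>
    refine ⟨h.1, ?_⟩
    rw [hn e (by simp)]
    exact ih h.2 fun e' he' => hn e' (by simp [he'])

/-! ### Counting the edges with the same record -/

/-- The number of edges with the record `r`. -/
def countRec (m : ℕ) (rc : ℕ → ℕ) (r : ℕ) : ℕ := ((Finset.range m).filter fun e => rc e = r).card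

theorem countRec_update {m e : ℕ} (he : e < m) (rc : ℕ → ℕ) (z r : ℕ) :
    countRec m (Function.update rc e z) r + (if rc e = r then 1 else 0) =
      countRec m rc r + if z = r then 1 else 0 := by
  have hm : e ∈ Finset.range m := Finset.mem_range.2 he
  unfold countRec
  rw [Finset.card_filter, Finset.card_filter, ← Finset.add_sum_erase _ _ hm,
    ← Finset.add_sum_erase (Finset.range m) (fun i => if rc i = r then 1 else 0) hm]
  have : ∑ x ∈ (Finset.range m).erase e, (if Function.update rc e z x = r then 1 else 0) =
      ∑ x ∈ (Finset.range m).erase e, if rc x = r then 1 else 0 := by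
    refine Finset.sum_congr rfl fun x hx => ?_
    rw [Function.update_of_ne (Finset.ne_of_mem_erase hx)]
  rw [this, Function.update_self]
  omega

/-- The invariant of a scan of edges. The edges in `E` have been scanned; `rec₀` and `k₀` are the
records of the edges and the largest record before the scan. Every head `v` of an edge in `E` is
put on the list `lst` once; it gets a new record `tmp v`, which replaces the former record of all
scanned edges with the head `v`; one of these former records is stored in `old v`. -/
structure ScanInv (m : ℕ) (head rec₀ : ℕ → ℕ) (k₀ : ℕ) (E : Set ℕ) (k len : ℕ)
    (lst tmp old rc cnt : ℕ → ℕ) : Prop where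
  rec_le : ∀ e < m, rec₀ e ≤ k₀
  le : k₀ ≤ k
  rec_of_notMem : ∀ e, e ∉ E → rc e = rec₀ e
  rec_of_mem : ∀ e ∈ E, rc e = tmp (head e)
  tmp_ne : ∀ v, tmp v ≠ 0 ↔ ∃ e ∈ E, head e = v
  tmp_mem : ∀ v, tmp v ≠ 0 → k₀ < tmp v ∧ tmp v ≤ k
  tmp_inj : ∀ v w, tmp v ≠ 0 → tmp v = tmp w → v = w
  enum : Enumerates lst len {v | tmp v ≠ 0}
  old : ∀ v, tmp v ≠ 0 → ∃ e ∈ E, head e = v ∧ old v = rec₀ e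
  count : ∀ r, 1 ≤ r → cnt r = countRec m rc r

namespace ScanInv

variable {m : ℕ} {head rec₀ : ℕ → ℕ} {k₀ : ℕ} {E : Set ℕ} {k len : ℕ}
  {lst tmp old rc cnt : ℕ → ℕ}

theorem start {rc cnt lst tmp old : ℕ → ℕ} {k : ℕ} (hr : ∀ e < m, rc e ≤ k)
    (ht : ∀ v, tmp v = 0) (hc : ∀ r, 1 ≤ r → cnt r = countRec m rc r) :
    ScanInv m head rc k ∅ k 0 lst tmp old rc cnt where
  rec_le := hr
  le := le_rfl
  rec_of_notMem _ _ := rfl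
  rec_of_mem := by simp
  tmp_ne := by simp [ht]
  tmp_mem := by simp [ht]
  tmp_inj := by simp [ht]
  enum := (Enumerates.empty lst).congr_set (by simp [ht])
  old := by simp [ht]
  count := hc

theorem count_step (h : ScanInv m head rec₀ k₀ E k len lst tmp old rc cnt) {e z : ℕ}
    (he : e < m) (heE : e ∉ E) (hz : k₀ < z) (r : ℕ) (hr : 1 ≤ r) :
    Function.update (Function.update cnt (rc e) (cnt (rc e) - 1)) z
      (Function.update cnt (rc e) (cnt (rc e) - 1) z + 1) r =
      countRec m (Function.update rc e z) r := by
  have h1 := countRec_update he rc z r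
  have h2 := h.count r hr
  have h3 : rc e ≤ k₀ := by rw [h.rec_of_notMem e heE]; exact h.rec_le e he
  simp only [Function.update_apply]
  have h4 : z ≠ rc e := by omega
  by_cases hrz : r = z
  · subst hrz
    simp only [if_true, h4, h4.symm, if_false] at h1 ⊢
    omega
  · by_cases hro : r = rc e
    · subst hro
      simp only [if_true, h4, hrz, if_false] at h1 ⊢
      omega
    · have h5 : ¬ rc e = r := fun e => hro e.symm
      have h6 : ¬ z = r := fun e => hrz e.symm
      simp only [h5, h6, hrz, hro, if_false] at h1 ⊢
      omega

theorem step_new (h : ScanInv m head rec₀ k₀ E k len lst tmp old rc cnt) {e : ℕ} (he : e < m)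
    (heE : e ∉ E) (hv : tmp (head e) = 0) :
    ScanInv m head rec₀ k₀ (insert e E) (k + 1) (len + 1) (Function.update lst len (head e))
      (Function.update tmp (head e) (k + 1)) (Function.update old (head e) (rc e))
      (Function.update rc e (k + 1))
      (Function.update (Function.update cnt (rc e) (cnt (rc e) - 1)) (k + 1)
        (Function.update cnt (rc e) (cnt (rc e) - 1) (k + 1) + 1)) := by
  have hle := h.le
  have hnE : ∀ e' ∈ E, head e' ≠ head e := fun e' he' hc =>
    (h.tmp_ne (head e)).2 ⟨e', he', hc⟩ hv
  refine ⟨h.rec_le, by omega, ?_, ?_, ?_, ?_, ?_, ?_, ?_, h.count_step he heE (by omega)⟩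
  · intro e' he'
    rw [Set.mem_insert_iff, not_or] at he'
    rw [Function.update_of_ne he'.1]
    exact h.rec_of_notMem e' he'.2
  · rintro e' (rfl | he')
    · simp
    · rw [Function.update_of_ne (fun hc : e' = e => heE (hc ▸ he')),
        Function.update_of_ne (hnE e' he')]
      exact h.rec_of_mem e' he'
  · intro v
    by_cases hve : v = head e
    · simp [hve]
    · have hve' : ¬ head e = v := fun hc => hve hc.symm
      simp [hve, hve', h.tmp_ne v]
  · intro v
    have := h.tmp_mem v
    simp only [Function.update_apply]
    split_ifs <;> omega
  · intro v w
    have h1 := h.tmp_mem v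
    have h2 := h.tmp_mem w
    have h3 := h.tmp_inj v w
    simp only [Function.update_apply]
    split_ifs <;> omega
  · refine (h.enum.push (v := head e) (by simp [hv])).congr_set fun v => ?_
    by_cases hve : v = head e <;> simp [hve, Function.update_apply]
  · intro v
    simp only [Function.update_apply]
    split_ifs with hve
    · intro _
      exact ⟨e, by simp, hve.symm, h.rec_of_notMem e heE⟩
    · intro hne
      obtain ⟨e', he', h1, h2⟩ := h.old v hne
      exact ⟨e', by simp [he'], h1, h2⟩

theorem step_old (h : ScanInv m head rec₀ k₀ E k len lst tmp old rc cnt) {e : ℕ} (he : e < m)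
    (heE : e ∉ E) (hv : tmp (head e) ≠ 0) :
    ScanInv m head rec₀ k₀ (insert e E) k len lst tmp old
      (Function.update rc e (tmp (head e)))
      (Function.update (Function.update cnt (rc e) (cnt (rc e) - 1)) (tmp (head e))
        (Function.update cnt (rc e) (cnt (rc e) - 1) (tmp (head e)) + 1)) := by
  refine ⟨h.rec_le, h.le, ?_, ?_, ?_, h.tmp_mem, h.tmp_inj, h.enum, ?_,
    h.count_step he heE (h.tmp_mem _ hv).1⟩
  · intro e' he'
    rw [Set.mem_insert_iff, not_or] at he'
    rw [Function.update_of_ne he'.1]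
    exact h.rec_of_notMem e' he'.2
  · rintro e' (rfl | he')
    · simp
    · rw [Function.update_of_ne (fun hc : e' = e => heE (hc ▸ he'))]
      exact h.rec_of_mem e' he'
  · intro v
    rw [h.tmp_ne v]
    constructor
    · rintro ⟨e', he', h1⟩
      exact ⟨e', by simp [he'], h1⟩
    · rintro ⟨e', rfl | he', h1⟩
      · exact (h.tmp_ne v).1 (h1 ▸ hv)
      · exact ⟨e', he', h1⟩
  · intro v hne
    obtain ⟨e', he', h1, h2⟩ := h.old v hne
    exact ⟨e', by simp [he'], h1, h2⟩

end ScanInv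

/-- The scan invariant for the contents of a memory. -/
def ScanHolds (m : ℕ) (head rec₀ : ℕ → ℕ) (k₀ : ℕ) (E : Set ℕ) (s : RamState) : Prop :=
  ScanInv m head rec₀ k₀ E (s.reg rRec) (s.reg rLen) (s.arr aList) (s.arr aTmp) (s.arr aOld)
    (s.arr aRec) (s.arr aCnt)

namespace RamProg

/-- Scan the edge in `rY`. -/
def scanEdge : RamProg :=
  load rV aHead rY ;; load rZ aTmp rV ;;
  cond (.eq rZ rZero)
    (inc rRec ;; copy rZ rRec ;; store aTmp rV rZ ;; store aList rLen rV ;; inc rLen ;;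
      load rO aRec rY ;; store aOld rV rO) skip ;;
  load rO aRec rY ;; load rC aCnt rO ;; dec rC ;; store aCnt rO rC ;;
  load rC aCnt rZ ;; inc rC ;; store aCnt rZ rC ;; store aRec rY rZ

/-- Scan the edges of the linked list that starts at `rW`. -/
def scanChain (nx : ℕ) : RamProg :=
  loop (.ne rW rZero) (copy rY rW ;; dec rY ;; scanEdge ;; load rW nx rY)

variable {m : ℕ} {head rec₀ : ℕ → ℕ} {k₀ : ℕ} {E : Set ℕ}

theorem runs_scanEdge {s : RamState} (h0 : s.reg rZero = 0) (hh : s.arr aHead = head)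
    (h : ScanHolds m head rec₀ k₀ E s) (he : s.reg rY < m) (heE : s.reg rY ∉ E) :
    scanEdge.Runs s fun t s₂ => t ≤ 18 ∧
      SameBut [rV, rZ, rO, rC, rRec, rLen] [aTmp, aList, aOld, aRec, aCnt] s s₂ ∧
      ScanHolds m head rec₀ k₀ (insert (s.reg rY) E) s₂ ∧ s₂.reg rLen ≤ s.reg rLen + 1 := by
  simp only [scanEdge, runs_seq, runs_load, runs_cond, runs_inc, runs_dec, runs_copy, runs_store,
    runs_skip, RamTest.Holds, RamState.reg_setReg, RamState.reg_setArr, RamState.arr_setReg,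
    RamState.arr_setArr, if_true, Nat.reduceEqDiff, if_false, h0, hh, SameBut.setReg_iff,
    SameBut.setArr_iff, List.mem_cons, true_or, or_true, SameBut.refl, true_and]
  refine ⟨fun hz => ⟨by omega, ?_, by omega⟩, fun hz => ⟨by omega, ?_, by omega⟩⟩
  · have := h.step_new he heE hz
    simpa only [ScanHolds, RamState.reg_setReg, RamState.reg_setArr, RamState.arr_setReg,
      RamState.arr_setArr, if_true, Nat.reduceEqDiff, if_false] using this
  · have := h.step_old he heE hz
    simpa only [ScanHolds, RamState.reg_setReg, RamState.reg_setArr, RamState.arr_setReg,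
      RamState.arr_setArr, if_true, Nat.reduceEqDiff, if_false] using this

theorem runs_scanChain {nx : ℕ} (hnx : nx ∉ [aTmp, aList, aOld, aRec, aCnt]) (l : List ℕ) :
    ∀ (E : Set ℕ) (s : RamState), s.reg rZero = 0 → s.arr aHead = head →
      ScanHolds m head rec₀ k₀ E s → IsLinkedList (s.arr nx) (s.reg rW) l → l.Nodup →
      (∀ e ∈ l, e < m) → (∀ e ∈ l, e ∉ E) →
      (scanChain nx).Runs s fun t s₂ => t ≤ 22 * l.length + 1 ∧
        SameBut [rW, rY, rV, rZ, rO, rC, rRec, rLen] [aTmp, aList, aOld, aRec, aCnt] s s₂ ∧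
        ScanHolds m head rec₀ k₀ (E ∪ {e | e ∈ l}) s₂ ∧
        s₂.reg rLen ≤ s.reg rLen + l.length := by
  induction l with
  | nil =>
    intro E s h0 hh h hc _ _ _
    rw [scanChain, runs_loop]
    refine ⟨fun hb => absurd (hc.trans h0.symm) hb, fun _ => ⟨by omega, .refl _ _ _, ?_, by simp⟩⟩
    simpa using h
  | cons e l ih =>
    intro E s h0 hh h hc hnd hlt hE
    rw [scanChain, runs_loop]
    obtain ⟨hw, hc⟩ := hc
    refine ⟨fun _ => ?_, fun hb => ?_⟩
    · simp only [runs_seq, runs_copy, runs_dec, RamState.reg_setReg, if_true, hw,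
        Nat.add_sub_cancel]
      set s₁ := (s.setReg rY (e + 1)).setReg rY e with hs₁
      have hY : s₁.reg rY = e := by simp [hs₁, RamState.reg_setReg]
      have hsame₁ : SameBut [rW, rY, rV, rZ, rO, rC, rRec, rLen] [aTmp, aList, aOld, aRec, aCnt]
          s s₁ := by
        simp [hs₁, SameBut.setReg_iff, SameBut.refl]
      have h₁ : ScanHolds m head rec₀ k₀ E s₁ := by
        simpa [ScanHolds, hs₁, RamState.reg_setReg, RamState.arr_setReg] using h
      refine (runs_scanEdge ((hsame₁.1 _ (by simp)).trans h0) ((hsame₁.2 _ (by simp)).trans hh)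
        h₁ (by rw [hY]; exact hlt e (by simp)) (by rw [hY]; exact hE e (by simp))).mono ?_
      rintro t s₂ ⟨ht, hsame, h₂, hlen⟩
      rw [runs_load]
      have hY₂ : s₂.reg rY = e := (hsame.1 _ (by simp)).trans hY
      have hnx₂ : s₂.arr nx = s.arr nx := (hsame.2 _ hnx).trans (hsame₁.2 _ hnx)
      have hsame₂ : SameBut [rW, rY, rV, rZ, rO, rC, rRec, rLen] [aTmp, aList, aOld, aRec, aCnt]
          s (s₂.setReg rW (s₂.arr nx (s₂.reg rY))) := by
        rw [SameBut.setReg_iff (by simp)]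
        exact hsame₁.trans (hsame.mono (by simp +contextual) (by simp))
      rw [hY] at h₂
      refine (ih (insert e E) _ ((hsame₂.1 _ (by simp)).trans h0)
        ((hsame₂.2 _ (by simp)).trans hh) ?_ ?_ (List.nodup_cons.1 hnd).2
        (fun e' he' => hlt e' (by simp [he'])) ?_).mono ?_
      · simpa [ScanHolds, RamState.reg_setReg, RamState.arr_setReg] using h₂
      · simpa [RamState.reg_setReg, RamState.arr_setReg, hY₂, hnx₂] using hc
      · intro e' he'
        rw [Set.mem_insert_iff, not_or]
        exact ⟨fun hc => (List.nodup_cons.1 hnd).1 (hc ▸ he'), hE e' (by simp [he'])⟩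
      · rintro t' s₃ ⟨ht', hsame₃, h₃, hlen₃⟩
        have e1 : s₁.reg rLen = s.reg rLen := by simp [hs₁, RamState.reg_setReg]
        simp only [RamState.reg_setReg, Nat.reduceEqDiff, if_false] at hlen₃
        refine ⟨by simp only [List.length_cons]; omega, hsame₂.trans hsame₃, ?_,
          by simp only [List.length_cons]; omega⟩
        convert h₃ using 1
        ext e'
        simp only [Set.mem_union, Set.mem_ofPred_eq, List.mem_cons, Set.mem_insert_iff]
        tauto
    · exact absurd (not_not.1 hb) (by omega)

/-- Scan the edges that leave the states of the block in `rB`. -/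
def scanBlock : RamProg :=
  load rP aSt rB ;; load rQ aEn rB ;;
  loop (.lt rP rQ) (load rU aPerm rP ;; load rW aHd rU ;; scanChain aNx ;; inc rP)

theorem runs_scanBlock {n : ℕ} {out : ℕ → List ℕ} {tail : ℕ → ℕ}
    (hnd : ∀ u < n, (out u).Nodup) (hout : ∀ u < n, ∀ e, e ∈ out u ↔ e < m ∧ tail e = u)
    {s : RamState} (h0 : s.reg rZero = 0)
    (hh : s.arr aHead = head) (hch : ∀ u < n, IsLinkedList (s.arr aNx) (s.arr aHd u) (out u))
    (h : ScanHolds m head rec₀ k₀ ∅ s) (hlen : s.reg rLen = 0) {a b : ℕ}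
    (ha : s.arr aSt (s.reg rB) = a) (hb : s.arr aEn (s.reg rB) = b) (hab : a ≤ b)
    (hperm : ∀ i, i < b → s.arr aPerm i < n)
    (hinj : ∀ i j, i < b → j < b → s.arr aPerm i = s.arr aPerm j → i = j) :
    scanBlock.Runs s fun t s₂ =>
      t ≤ ∑ i ∈ Finset.Ico a b, (22 * (out (s.arr aPerm i)).length + 5) + 3 ∧
      SameBut [rW, rY, rV, rZ, rO, rC, rRec, rLen, rP, rQ, rU]
        [aTmp, aList, aOld, aRec, aCnt] s s₂ ∧
      ScanHolds m head rec₀ k₀ {e | e < m ∧ ∃ i, a ≤ i ∧ i < b ∧ tail e = s.arr aPerm i} s₂ ∧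
      s₂.reg rLen ≤ ∑ i ∈ Finset.Ico a b, (out (s.arr aPerm i)).length := by
  simp only [scanBlock, runs_seq, runs_load, RamState.reg_setReg, RamState.arr_setReg,
    Nat.reduceEqDiff, if_false, ha, hb]
  refine runs_loop_of_count (b - a) (fun k t s₂ => s₂.reg rP = a + k ∧ s₂.reg rQ = b ∧
    t ≤ ∑ i ∈ Finset.Ico a (a + k), (22 * (out (s.arr aPerm i)).length + 5) ∧
    SameBut [rW, rY, rV, rZ, rO, rC, rRec, rLen, rP, rQ, rU]
        [aTmp, aList, aOld, aRec, aCnt] s s₂ ∧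
    ScanHolds m head rec₀ k₀ {e | e < m ∧ ∃ i, a ≤ i ∧ i < a + k ∧ tail e = s.arr aPerm i} s₂ ∧
    s₂.reg rLen ≤ ∑ i ∈ Finset.Ico a (a + k), (out (s.arr aPerm i)).length) ?_ ?_ ?_ ?_
  · refine ⟨by simp [RamState.reg_setReg], by simp [RamState.reg_setReg], by simp, ?_, ?_, ?_⟩
    · simp [SameBut.setReg_iff, SameBut.refl]
    · have : {e | e < m ∧ ∃ i, a ≤ i ∧ i < a + 0 ∧ tail e = s.arr aPerm i} = ∅ := by
        ext e
        simp only [Set.mem_ofPred_eq, Set.mem_empty_iff_false, iff_false]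
        rintro ⟨-, i, h1, h2, -⟩
        omega
      rw [this]
      simpa [ScanHolds, RamState.reg_setReg, RamState.arr_setReg] using h
    · simp [RamState.reg_setReg, hlen]
  · rintro i t s₂ hi ⟨h1, h2, -⟩
    simp only [RamTest.Holds, h1, h2]
    omega
  · rintro i t s₂ hi ⟨h1, h2, h3, h4, h5, h6⟩
    simp only [runs_seq, runs_load, runs_inc, RamState.reg_setReg, RamState.arr_setReg,
      if_true, h1]
    have hper : s₂.arr aPerm = s.arr aPerm := h4.2 _ (by simp)
    set u := s.arr aPerm (a + i) with hu
    have hun : u < n := hperm _ (by omega)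
    rw [hper, ← hu]
    set s₃ := (s₂.setReg rU u).setReg rW (s₂.arr aHd u) with hs₃
    have hsame₃ : SameBut [rW, rY, rV, rZ, rO, rC, rRec, rLen, rP, rQ, rU]
        [aTmp, aList, aOld, aRec, aCnt] s s₃ := by
      simpa [hs₃, SameBut.setReg_iff] using h4
    refine (runs_scanChain (rec₀ := rec₀) (k₀ := k₀) (by simp) (out u)
      {e | e < m ∧ ∃ j, a ≤ j ∧ j < a + i ∧ tail e = s.arr aPerm j} s₃
      ((hsame₃.1 _ (by simp)).trans h0) ((hsame₃.2 _ (by simp)).trans hh) ?_ ?_ (hnd u hun)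
      (fun e he => ((hout u hun e).1 he).1) ?_).mono ?_
    · simpa [ScanHolds, hs₃, RamState.reg_setReg, RamState.arr_setReg] using h5
    · have e1 : s₃.arr aNx = s.arr aNx := hsame₃.2 _ (by simp)
      have e2 : s₃.reg rW = s.arr aHd u := by
        simp [hs₃, RamState.reg_setReg, h4.2 aHd (by simp)]
      rw [e1, e2]
      exact hch u hun
    · rintro e he ⟨-, j, hj1, hj2, hj3⟩
      have h7 := ((hout u hun e).1 he).2
      have := hinj j (a + i) (by omega) (by omega) (by rw [← hj3, h7])
      omega
    · rintro t' s₄ ⟨ht', hsame₄, h₄, hlen₄⟩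
      have e1 : s₃.reg rLen = s₂.reg rLen := by simp [hs₃, RamState.reg_setReg]
      have e2 : s₄.reg rP = a + i := by
        rw [hsame₄.1 _ (by simp)]
        simp [hs₃, RamState.reg_setReg, h1]
      have e3 : s₄.reg rQ = b := by
        rw [hsame₄.1 _ (by simp)]
        simp [hs₃, RamState.reg_setReg, h2]
      have hsum : ∀ f : ℕ → ℕ, ∑ j ∈ Finset.Ico a (a + (i + 1)), f j =
          ∑ j ∈ Finset.Ico a (a + i), f j + f (a + i) := fun f => by
        rw [← add_assoc, Finset.sum_Ico_succ_top (by omega)]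
      refine ⟨?_, ?_, ?_, ?_, ?_, ?_⟩
      · simp [e2, add_assoc]
      · simp [e3]
      · rw [hsum, ← hu]
        omega
      · rw [SameBut.setReg_iff (by simp)]
        exact hsame₃.trans (hsame₄.mono (by simp +contextual) (by simp))
      · have : {e | e < m ∧ ∃ j, a ≤ j ∧ j < a + (i + 1) ∧ tail e = s.arr aPerm j} =
            {e | e < m ∧ ∃ j, a ≤ j ∧ j < a + i ∧ tail e = s.arr aPerm j} ∪ {e | e ∈ out u} := by
          ext e
          simp only [Set.mem_union, Set.mem_ofPred_eq, hout u hun]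
          constructor
          · rintro ⟨he, j, hj1, hj2, hj3⟩
            by_cases hj : j < a + i
            · exact .inl ⟨he, j, hj1, hj, hj3⟩
            · obtain rfl : j = a + i := by omega
              exact .inr ⟨he, hj3⟩
          · rintro (⟨he, j, hj1, hj2, hj3⟩ | ⟨he, he'⟩)
            · exact ⟨he, j, hj1, by omega, hj3⟩
            · exact ⟨he, a + i, by omega, by omega, he'⟩
        rw [this]
        simpa [ScanHolds, RamState.reg_setReg, RamState.arr_setReg] using h₄
      · rw [hsum, ← hu]
        simp only [Nat.reduceEqDiff, if_false]
        omega
  · rintro t s₂ ⟨h1, h2, h3, h4, h5, h6⟩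
    rw [Nat.add_sub_cancel' hab] at h3 h5 h6
    exact ⟨by omega, h4, h5, h6⟩

/-- Put those states `v` of the first list for which the counter of `old v` has dropped to `0` on
the second list, and reset `tmp`. -/
def filterList : RamProg :=
  const rI 0 ;; const rLenTwo 0 ;;
  loop (.lt rI rLen) (load rV aList rI ;; store aTmp rV rZero ;; load rO aOld rV ;;
    load rC aCnt rO ;; cond (.eq rC rZero) (store aListTwo rLenTwo rV ;; inc rLenTwo) skip ;;
    inc rI)

theorem runs_filterList {s : RamState} (h0 : s.reg rZero = 0) {Z : Set ℕ}
    (hZ : Enumerates (s.arr aList) (s.reg rLen) Z) (htmp : ∀ v, v ∉ Z → s.arr aTmp v = 0) :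
    filterList.Runs s fun t s₂ => t ≤ 9 * s.reg rLen + 3 ∧
      SameBut [rI, rV, rO, rC, rLenTwo] [aTmp, aListTwo] s s₂ ∧ (∀ v, s₂.arr aTmp v = 0) ∧
      s₂.reg rLenTwo ≤ s.reg rLen ∧
      Enumerates (s₂.arr aListTwo) (s₂.reg rLenTwo) {v ∈ Z | s.arr aCnt (s.arr aOld v) = 0} := by
  simp only [filterList, runs_seq, runs_const]
  refine runs_loop_of_count (s.reg rLen) (fun i t s₂ => s₂.reg rI = i ∧ t ≤ 9 * i ∧
    SameBut [rI, rV, rO, rC, rLenTwo] [aTmp, aListTwo] s s₂ ∧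
    (∀ v, (v ∉ Z ∨ ∃ j < i, s.arr aList j = v) → s₂.arr aTmp v = 0) ∧ s₂.reg rLenTwo ≤ i ∧
    Enumerates (s₂.arr aListTwo) (s₂.reg rLenTwo)
      {v | (∃ j < i, s.arr aList j = v) ∧ s.arr aCnt (s.arr aOld v) = 0}) ?_ ?_ ?_ ?_
  · refine ⟨by simp [RamState.reg_setReg], by simp, ?_, ?_, by simp [RamState.reg_setReg], ?_⟩
    · simp [SameBut.setReg_iff, SameBut.refl]
    · simpa [RamState.arr_setReg] using htmp
    · simpa [RamState.reg_setReg, RamState.arr_setReg] using Enumerates.empty (s.arr aListTwo)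
  · rintro i t s₂ hi ⟨h1, h2, h3, -⟩
    simp only [RamTest.Holds, h1, h3.1 rLen (by simp)]
  · rintro i t s₂ hi ⟨h1, h2, h3, h4, h5, h6⟩
    have e1 : s₂.arr aList = s.arr aList := h3.2 _ (by simp)
    have e2 : s₂.arr aOld = s.arr aOld := h3.2 _ (by simp)
    have e3 : s₂.arr aCnt = s.arr aCnt := h3.2 _ (by simp)
    have e4 : s₂.reg rZero = 0 := (h3.1 _ (by simp)).trans h0
    simp only [runs_seq, runs_load, runs_cond, runs_inc, runs_store,
      runs_skip, RamTest.Holds, RamState.reg_setReg, RamState.reg_setArr, RamState.arr_setReg,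
      RamState.arr_setArr, if_true, Nat.reduceEqDiff, if_false, e1, e2, e3, e4, h1,
      SameBut.setReg_iff, SameBut.setArr_iff, List.mem_cons, true_or, or_true, h3, true_and]
    have htmp' : ∀ v, (v ∉ Z ∨ ∃ j < i + 1, s.arr aList j = v) →
        Function.update (s₂.arr aTmp) (s.arr aList i) 0 v = 0 := by
      intro v hv
      rw [Function.update_apply]
      split_ifs with hvi
      · rfl
      · refine h4 v (hv.imp_right ?_)
        rintro ⟨j, hj, rfl⟩
        refine ⟨j, ?_, rfl⟩
        rcases Nat.lt_succ_iff_lt_or_eq.1 hj with hj | rfl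
        · exact hj
        · exact absurd rfl hvi
    have hsucc : ∀ v, (∃ j < i + 1, s.arr aList j = v) ↔
        v = s.arr aList i ∨ ∃ j < i, s.arr aList j = v := by
      intro v
      constructor
      · rintro ⟨j, hj, rfl⟩
        rcases Nat.lt_succ_iff_lt_or_eq.1 hj with hj | rfl
        · exact .inr ⟨j, hj, rfl⟩
        · exact .inl rfl
      · rintro (rfl | ⟨j, hj, rfl⟩)
        · exact ⟨i, by omega, rfl⟩
        · exact ⟨j, by omega, rfl⟩
    refine ⟨fun hz => ⟨by omega, htmp', by omega, ?_⟩, fun hz => ⟨by omega, htmp', by omega, ?_⟩⟩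
    · refine (h6.push (v := s.arr aList i) ?_).congr_set fun v => ?_
      · rintro ⟨⟨j, hj, e⟩, -⟩
        have := hZ.inj j i (by omega) hi e
        omega
      · simp only [Set.mem_insert_iff, Set.mem_ofPred_eq, hsucc]
        constructor
        · rintro (rfl | h)
          · exact ⟨.inl rfl, hz⟩
          · exact ⟨.inr h.1, h.2⟩
        · rintro ⟨rfl | h, h'⟩
          · exact .inl rfl
          · exact .inr ⟨h, h'⟩
    · refine h6.congr_set fun v => ?_
      simp only [Set.mem_ofPred_eq, hsucc]
      constructor
      · rintro ⟨h, h'⟩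
        exact ⟨.inr h, h'⟩
      · rintro ⟨rfl | h, h'⟩
        · exact absurd h' hz
        · exact ⟨h, h'⟩
  · rintro t s₂ ⟨h1, h2, h3, h4, h5, h6⟩
    refine ⟨by omega, h3, fun v => h4 v ?_, h5, h6.congr_set fun v => ?_⟩
    · rw [← hZ.mem]
      exact (em _).symm
    · simp [hZ.mem v]

end RamProg

/-! ### An ordered partition as a segmentation of an array -/

/-- The array `perm`, with the inverse `pos`, lists the numbers below `n` (the states). The state
`v` lies in the block number `blk v`; the block `b ≤ k` occupies the `sz b` positions from `st b`
to `en b - 1`. Some of the blocks may be empty. -/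
structure Seg (n k : ℕ) (perm pos blk st en sz : ℕ → ℕ) : Prop where
  perm_lt : ∀ i, i < n → perm i < n
  pos_lt : ∀ v, v < n → pos v < n
  pos_perm : ∀ i, i < n → pos (perm i) = i
  perm_pos : ∀ v, v < n → perm (pos v) = v
  blk_le : ∀ v, v < n → blk v ≤ k
  st_le : ∀ v, v < n → st (blk v) ≤ pos v
  lt_en : ∀ v, v < n → pos v < en (blk v)
  en_le : ∀ b, b ≤ k → en b ≤ n
  blk_perm : ∀ b, b ≤ k → ∀ i, st b ≤ i → i < en b → blk (perm i) = b
  sz_eq : ∀ b, b ≤ k → st b + sz b = en b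

namespace Seg

variable {n k : ℕ} {perm pos blk st en sz : ℕ → ℕ}

theorem create (h : Seg n k perm pos blk st en sz) {q : ℕ} (hq : q ≤ n) :
    Seg n (k + 1) perm pos blk (Function.update st (k + 1) q) (Function.update en (k + 1) q)
      (Function.update sz (k + 1) 0) := by
  obtain ⟨h1, h2, h3, h4, h5, h6, h7, h8, h9, h10⟩ := h
  have hne : ∀ v, v < n → blk v ≠ k + 1 := fun v hv => by
    have := h5 v hv
    omega
  refine ⟨h1, h2, h3, h4, fun v hv => (h5 v hv).trans (by omega), ?_, ?_, ?_, ?_, ?_⟩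
  · intro v hv
    rw [Function.update_of_ne (hne v hv)]
    exact h6 v hv
  · intro v hv
    rw [Function.update_of_ne (hne v hv)]
    exact h7 v hv
  · intro b hb
    rw [Function.update_apply]
    split_ifs with hbk
    · exact hq
    · exact h8 b (by omega)
  · intro b hb i
    simp only [Function.update_apply]
    split_ifs with hbk
    · omega
    · exact h9 b (by omega) i
  · intro b hb
    simp only [Function.update_apply]
    split_ifs with hbk
    · omega
    · exact h10 b (by omega)

/-- Move the state `v` from the front of its block `d` to the adjacent block `c` before it. -/
theorem move_front (h : Seg n k perm pos blk st en sz) {v c d i j w : ℕ} (hv : v < n)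
    (hd : blk v = d) (hc : c ≤ k) (hcd : c ≠ d) (hadj : en c = st d) (hi : pos v = i)
    (hj : st d = j) (hw : perm j = w) :
    Seg n k (Function.update (Function.update perm i w) j v)
      (Function.update (Function.update pos w i) v j) (Function.update blk v c)
      (Function.update st d (j + 1)) (Function.update en c (j + 1))
      (Function.update (Function.update sz d (sz d - 1)) c (sz c + 1)) := by
  obtain ⟨h1, h2, h3, h4, h5, h6, h7, h8, h9, h10⟩ := h
  have a1 := h2 v hv
  have a2 := h4 v hv
  have a3 := h5 v hv
  have a4 := h6 v hv
  have a5 := h7 v hv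
  have a6 := h10 c hc
  have a7 := h10 d (hd ▸ a3)
  have a8 := h8 d (hd ▸ a3)
  rw [hd] at a4 a5
  have a9 := h9 d (hd ▸ a3) j
  have a10 := h3 j (by omega)
  have a11 := h1 j (by omega)
  refine ⟨?_, ?_, ?_, ?_, ?_, ?_, ?_, ?_, ?_, ?_⟩ <;> simp only [Function.update_apply]
  · intro i' hi'
    have := h1 i' hi'
    split_ifs <;> omega
  · intro v' hv'
    have := h2 v' hv'
    split_ifs <;> omega
  · intro i' hi'
    have := h3 i' hi'
    clear h1 h2 h3 h4 h5 h6 h7 h8 h9 h10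
    grind
  · intro v' hv'
    have := h4 v' hv'
    clear h1 h2 h3 h4 h5 h6 h7 h8 h9 h10
    grind
  · intro v' hv'
    have := h5 v' hv'
    clear h1 h2 h3 h4 h5 h6 h7 h8 h9 h10
    grind
  · intro v' hv'
    have := h6 v' hv'
    have := h4 v' hv'
    clear h1 h2 h3 h4 h5 h6 h7 h8 h9 h10
    grind
  · intro v' hv'
    have := h7 v' hv'
    have := h4 v' hv'
    clear h1 h2 h3 h4 h5 h6 h7 h8 h9 h10
    grind
  · intro b hb
    have := h8 b hb
    clear h1 h2 h3 h4 h5 h6 h7 h8 h9 h10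
    grind
  · intro b hb i'
    have := h9 b hb i'
    have := h8 b hb
    have := h3 i'
    clear h1 h2 h3 h4 h5 h6 h7 h8 h9 h10
    grind
  · intro b hb
    have := h10 b hb
    clear h1 h2 h3 h4 h5 h6 h7 h8 h9 h10
    grind

/-- Move the state `v` from the back of its block `d` to the adjacent block `c` after it. -/
theorem move_back (h : Seg n k perm pos blk st en sz) {v c d i j w : ℕ} (hv : v < n)
    (hd : blk v = d) (hc : c ≤ k) (hcd : c ≠ d) (hadj : en d = st c) (hi : pos v = i)
    (hj : en d - 1 = j) (hw : perm j = w) :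
    Seg n k (Function.update (Function.update perm i w) j v)
      (Function.update (Function.update pos w i) v j) (Function.update blk v c)
      (Function.update st c j) (Function.update en d j)
      (Function.update (Function.update sz d (sz d - 1)) c (sz c + 1)) := by
  obtain ⟨h1, h2, h3, h4, h5, h6, h7, h8, h9, h10⟩ := h
  have a1 := h2 v hv
  have a2 := h4 v hv
  have a3 := h5 v hv
  have a4 := h6 v hv
  have a5 := h7 v hv
  have a6 := h10 c hc
  have a7 := h10 d (hd ▸ a3)
  have a8 := h8 d (hd ▸ a3)
  rw [hd] at a4 a5
  have a9 := h9 d (hd ▸ a3) j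
  have a10 := h3 j (by omega)
  have a11 := h1 j (by omega)
  have a12 := h8 c hc
  refine ⟨?_, ?_, ?_, ?_, ?_, ?_, ?_, ?_, ?_, ?_⟩ <;> simp only [Function.update_apply]
  · intro i' hi'
    have := h1 i' hi'
    split_ifs <;> omega
  · intro v' hv'
    have := h2 v' hv'
    split_ifs <;> omega
  · intro i' hi'
    have := h3 i' hi'
    clear h1 h2 h3 h4 h5 h6 h7 h8 h9 h10
    grind
  · intro v' hv'
    have := h4 v' hv'
    clear h1 h2 h3 h4 h5 h6 h7 h8 h9 h10
    grind
  · intro v' hv'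
    have := h5 v' hv'
    clear h1 h2 h3 h4 h5 h6 h7 h8 h9 h10
    grind
  · intro v' hv'
    have := h6 v' hv'
    have := h4 v' hv'
    clear h1 h2 h3 h4 h5 h6 h7 h8 h9 h10
    grind
  · intro v' hv'
    have := h7 v' hv'
    have := h4 v' hv'
    clear h1 h2 h3 h4 h5 h6 h7 h8 h9 h10
    grind
  · intro b hb
    have := h8 b hb
    clear h1 h2 h3 h4 h5 h6 h7 h8 h9 h10
    grind
  · intro b hb i'
    have := h9 b hb i'
    have := h8 b hb
    have := h3 i'
    clear h1 h2 h3 h4 h5 h6 h7 h8 h9 h10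
    grind
  · intro b hb
    have := h10 b hb
    clear h1 h2 h3 h4 h5 h6 h7 h8 h9 h10
    grind

end Seg

/-! ### Splitting all blocks of a segmentation by a set of states -/

namespace Seg

variable {n k : ℕ} {perm pos blk st en sz : ℕ → ℕ}

theorem eq_of_mem (h : Seg n k perm pos blk st en sz) {b c i : ℕ} (hb : b ≤ k) (hc : c ≤ k)
    (h1 : st b ≤ i) (h2 : i < en b) (h3 : st c ≤ i) (h4 : i < en c) : b = c :=
  (h.blk_perm b hb i h1 h2).symm.trans (h.blk_perm c hc i h3 h4)

theorem en_le_st (h : Seg n k perm pos blk st en sz) {u v : ℕ} (hu : u < n) (hv : v < n)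
    (hlt : st (blk u) < st (blk v)) : en (blk u) ≤ st (blk v) := by
  by_contra hc
  have h1 := h.eq_of_mem (h.blk_le u hu) (h.blk_le v hv) hlt.le (not_le.1 hc) le_rfl
    ((h.st_le v hv).trans_lt (h.lt_en v hv))
  rw [h1] at hlt
  exact lt_irrefl _ hlt

theorem eq_of_st_eq (h : Seg n k perm pos blk st en sz) {u v : ℕ} (hu : u < n) (hv : v < n)
    (he : st (blk u) = st (blk v)) : blk u = blk v :=
  h.eq_of_mem (h.blk_le u hu) (h.blk_le v hv) le_rfl ((h.st_le u hu).trans_lt (h.lt_en u hu))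
    he.ge (he.trans_lt ((h.st_le v hv).trans_lt (h.lt_en v hv)))

end Seg

/-- The block `c` has been split off from the block `d`, at the front or at the back; `st₀` and
`en₀` are the former bounds of `d`. -/
def SplitOff (front : Bool) (st en st₀ en₀ : ℕ → ℕ) (c d : ℕ) : Prop :=
  match front with
  | true => st c = st₀ d ∧ en c = st d ∧ en d = en₀ d
  | false => st d = st₀ d ∧ en d = st c ∧ en c = en₀ d

/-- The invariant of a pass that splits all blocks by a set of states. The states in `Z` have been
moved from their former blocks, which form the set `U`; the states of the block `d ∈ U` have been
moved to the new block `aux d`. The subscript `₀` marks the values before the pass. -/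
structure PassInv (front : Bool) (n k₀ : ℕ) (blk₀ st₀ en₀ : ℕ → ℕ) (Z U : Set ℕ) (k len : ℕ)
    (perm pos blk st en sz aux tch : ℕ → ℕ) : Prop where
  seg : Seg n k perm pos blk st en sz
  le : k₀ ≤ k
  blk_le : ∀ v, v < n → blk₀ v ≤ k₀
  blk_of_notMem : ∀ v, v < n → v ∉ Z → blk v = blk₀ v
  blk_of_mem : ∀ v, v < n → v ∈ Z → blk v = aux (blk₀ v)
  aux_ne : ∀ d, aux d ≠ 0 ↔ d ∈ U
  le_of_mem : ∀ d ∈ U, d ≤ k₀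
  untouched : ∀ d, d ≤ k₀ → d ∉ U → st d = st₀ d ∧ en d = en₀ d
  lt_aux : ∀ d ∈ U, k₀ < aux d
  aux_le : ∀ d ∈ U, aux d ≤ k
  splitOff : ∀ d ∈ U, SplitOff front st en st₀ en₀ (aux d) d
  aux_inj : ∀ d ∈ U, ∀ d' ∈ U, aux d = aux d' → d = d'
  enum : Enumerates tch len U

namespace PassInv

variable {front : Bool} {n k₀ : ℕ} {blk₀ st₀ en₀ : ℕ → ℕ} {Z U : Set ℕ} {k len : ℕ}
  {perm pos blk st en sz aux tch : ℕ → ℕ}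

theorem start (front : Bool) (h : Seg n k perm pos blk st en sz) (ha : ∀ d, aux d = 0) :
    PassInv front n k blk st en ∅ ∅ k 0 perm pos blk st en sz aux tch where
  seg := h
  le := le_rfl
  blk_le := h.blk_le
  blk_of_notMem _ _ _ := rfl
  blk_of_mem := by simp
  aux_ne := by simp [ha]
  le_of_mem := by simp
  untouched _ _ _ := ⟨rfl, rfl⟩
  lt_aux := by simp
  aux_le := by simp
  splitOff := by simp
  aux_inj := by simp
  enum := .empty _

theorem create (h : PassInv front n k₀ blk₀ st₀ en₀ Z U k len perm pos blk st en sz aux tch)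
    (hZU : ∀ v ∈ Z, blk₀ v ∈ U) {d : ℕ} (hd : d ≤ k₀) (hdU : d ∉ U) {q : ℕ}
    (hq : q = bif front then st d else en d) :
    PassInv front n k₀ blk₀ st₀ en₀ Z (insert d U) (k + 1) (len + 1) perm pos blk
      (Function.update st (k + 1) q) (Function.update en (k + 1) q) (Function.update sz (k + 1) 0)
      (Function.update aux d (k + 1)) (Function.update tch len d) := by
  have hle := h.le
  have hqn : q ≤ n := by
    have h1 := h.seg.en_le d (by omega)
    have h2 := h.seg.sz_eq d (by omega)
    cases front <;> simp only [cond_true, cond_false] at hq <;> omega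
  have hU : ∀ d' ∈ U, d' ≠ d := fun d' hd' e => hdU (e ▸ hd')
  refine ⟨h.seg.create hqn, by omega, h.blk_le, h.blk_of_notMem, ?_, ?_, ?_, ?_, ?_, ?_, ?_, ?_,
    h.enum.push hdU⟩
  · intro v hv hvZ
    rw [Function.update_of_ne (hU _ (hZU v hvZ))]
    exact h.blk_of_mem v hv hvZ
  · intro d'
    rw [Function.update_apply, Set.mem_insert_iff]
    split_ifs with hdd
    · simp [hdd]
    · simpa [hdd] using h.aux_ne d'
  · rintro d' (rfl | hd')
    · exact hd
    · exact h.le_of_mem d' hd'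
  · intro d' hd' hdU'
    rw [Set.mem_insert_iff, not_or] at hdU'
    rw [Function.update_of_ne (by omega), Function.update_of_ne (by omega)]
    exact h.untouched d' hd' hdU'.2
  · rintro d' (rfl | hd')
    · simp only [Function.update_self]
      omega
    · rw [Function.update_of_ne (hU d' hd')]
      exact h.lt_aux d' hd'
  · rintro d' (rfl | hd')
    · simp only [Function.update_self]
      omega
    · rw [Function.update_of_ne (hU d' hd')]
      exact (h.aux_le d' hd').trans (by omega)
  · rintro d' (rfl | hd')
    · obtain ⟨e1, e2⟩ := h.untouched d' hd hdU
      have hne : d' ≠ k + 1 := by omega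
      cases front <;> simp only [cond_true, cond_false] at hq <;>
        simp [SplitOff, hne, hq, e1, e2]
    · have h1 := h.le_of_mem d' hd'
      have h2 := h.aux_le d' hd'
      have hne1 : d' ≠ k + 1 := by omega
      have hne2 : aux d' ≠ k + 1 := by omega
      have h3 := h.splitOff d' hd'
      cases front <;> simpa [SplitOff, hne1, hne2, hU d' hd'] using h3
  · intro d₁ h₁ d₂ h₂ e
    have h3 := h.aux_le d₁
    have h4 := h.aux_le d₂
    have h5 := h.aux_inj d₁
    simp only [Function.update_apply] at e
    split_ifs at e with c1 c2 c2
    · rw [c1, c2]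
    · have := h4 (h₂.resolve_left c2)
      omega
    · have := h3 (h₁.resolve_left c1)
      omega
    · exact h5 (h₁.resolve_left c1) d₂ (h₂.resolve_left c2) e

/-- Moving a state does not affect the parts of the invariant about the other blocks. -/
theorem move_aux (h : PassInv front n k₀ blk₀ st₀ en₀ Z U k len perm pos blk st en sz aux tch)
    {v d : ℕ} (hv : v < n) (hvZ : v ∉ Z) (hd : blk v = d) (hdU : d ∈ U)
    {perm' pos' st' en' sz' : ℕ → ℕ}
    (hseg : Seg n k perm' pos' (Function.update blk v (aux d)) st' en' sz')
    (hst : ∀ b, b ≠ d → b ≠ aux d → st' b = st b) (hen : ∀ b, b ≠ d → b ≠ aux d → en' b = en b)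
    (hsplit : SplitOff front st' en' st₀ en₀ (aux d) d) :
    PassInv front n k₀ blk₀ st₀ en₀ (insert v Z) U k len perm' pos' (Function.update blk v (aux d))
      st' en' sz' aux tch := by
  have hd₀ : blk₀ v = d := (h.blk_of_notMem v hv hvZ).symm.trans hd
  have hda := h.lt_aux d hdU
  have hdk := h.le_of_mem d hdU
  refine ⟨hseg, h.le, h.blk_le, ?_, ?_, h.aux_ne, h.le_of_mem, ?_, h.lt_aux, h.aux_le, ?_,
    h.aux_inj, h.enum⟩
  · intro u hu huZ
    rw [Set.mem_insert_iff, not_or] at huZ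
    rw [Function.update_of_ne huZ.1]
    exact h.blk_of_notMem u hu huZ.2
  · rintro u hu (rfl | huZ)
    · rw [Function.update_self, hd₀]
    · rw [Function.update_of_ne (fun e : u = v => hvZ (e ▸ huZ))]
      exact h.blk_of_mem u hu huZ
  · intro d' hd' hdU'
    have hne : d' ≠ d := fun e => hdU' (e ▸ hdU)
    rw [hst d' hne (by omega), hen d' hne (by omega)]
    exact h.untouched d' hd' hdU'
  · intro d' hdU'
    by_cases hne : d' = d
    · rw [hne]
      exact hsplit
    · have h1 := h.le_of_mem d' hdU'
      have h2 := h.lt_aux d' hdU'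
      have h3 : aux d' ≠ aux d := fun e => hne (h.aux_inj d' hdU' d hdU e)
      have h4 := h.splitOff d' hdU'
      have e1 := hst d' hne (by omega)
      have e2 := hen d' hne (by omega)
      have e3 := hst (aux d') (by omega) h3
      have e4 := hen (aux d') (by omega) h3
      unfold SplitOff at h4 ⊢
      rwa [e1, e2, e3, e4]

theorem move_front (h : PassInv true n k₀ blk₀ st₀ en₀ Z U k len perm pos blk st en sz aux tch)
    {v c d i j w : ℕ} (hv : v < n) (hvZ : v ∉ Z) (hd : blk v = d) (hdU : d ∈ U) (hc : aux d = c)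
    (hi : pos v = i) (hj : st d = j) (hw : perm j = w) :
    PassInv true n k₀ blk₀ st₀ en₀ (insert v Z) U k len
      (Function.update (Function.update perm i w) j v)
      (Function.update (Function.update pos w i) v j) (Function.update blk v c)
      (Function.update st d (j + 1)) (Function.update en c (j + 1))
      (Function.update (Function.update sz d (sz d - 1)) c (sz c + 1)) aux tch := by
  have hda := h.lt_aux d hdU
  have hdk := h.le_of_mem d hdU
  obtain ⟨s1, s2, s3⟩ := h.splitOff d hdU
  rw [← hc]
  refine h.move_aux hv hvZ hd hdU (h.seg.move_front hv hd (h.aux_le d hdU) (by omega) s2 hi hj hw)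
    (fun b hb _ => Function.update_of_ne hb _ _) (fun b _ hb => Function.update_of_ne hb _ _) ?_
  have hne : aux d ≠ d := by omega
  simp only [SplitOff, Function.update_apply, hne, hne.symm, if_true, if_false]
  exact ⟨s1, trivial, s3⟩

theorem move_back (h : PassInv false n k₀ blk₀ st₀ en₀ Z U k len perm pos blk st en sz aux tch)
    {v c d i j w : ℕ} (hv : v < n) (hvZ : v ∉ Z) (hd : blk v = d) (hdU : d ∈ U) (hc : aux d = c)
    (hi : pos v = i) (hj : en d - 1 = j) (hw : perm j = w) :
    PassInv false n k₀ blk₀ st₀ en₀ (insert v Z) U k len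
      (Function.update (Function.update perm i w) j v)
      (Function.update (Function.update pos w i) v j) (Function.update blk v c)
      (Function.update st c j) (Function.update en d j)
      (Function.update (Function.update sz d (sz d - 1)) c (sz c + 1)) aux tch := by
  have hda := h.lt_aux d hdU
  have hdk := h.le_of_mem d hdU
  obtain ⟨s1, s2, s3⟩ := h.splitOff d hdU
  rw [← hc]
  refine h.move_aux hv hvZ hd hdU (h.seg.move_back hv hd (h.aux_le d hdU) (by omega) s2 hi hj hw)
    (fun b _ hb => Function.update_of_ne hb _ _) (fun b hb _ => Function.update_of_ne hb _ _) ?_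
  have hne : aux d ≠ d := by omega
  simp only [SplitOff, Function.update_apply, hne, hne.symm, if_true, if_false]
  exact ⟨s1, trivial, s3⟩

section Final

variable {perm₀ pos₀ sz₀ : ℕ → ℕ}

theorem bounds (h : PassInv front n k₀ blk₀ st₀ en₀ Z U k len perm pos blk st en sz aux tch)
    (hZU : ∀ v ∈ Z, blk₀ v ∈ U) {v : ℕ} (hv : v < n) :
    st₀ (blk₀ v) ≤ st (blk v) ∧ en (blk v) ≤ en₀ (blk₀ v) := by
  have h1 := h.blk_le v hv
  have h2 := h.le
  have h3 := h.seg.sz_eq (blk₀ v) (by omega)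
  by_cases hd : blk₀ v ∈ U
  · have h4 := h.seg.sz_eq (aux (blk₀ v)) (h.aux_le _ hd)
    have h5 := h.splitOff _ hd
    by_cases hvZ : v ∈ Z
    · rw [h.blk_of_mem v hv hvZ]
      cases front <;> simp only [SplitOff] at h5 <;> omega
    · rw [h.blk_of_notMem v hv hvZ]
      cases front <;> simp only [SplitOff] at h5 <;> omega
  · have h5 := h.untouched _ h1 hd
    rw [h.blk_of_notMem v hv fun hc => hd (hZU v hc)]
    omega

/-- After the pass, the order of the blocks is the lexicographic one. -/
theorem lt_iff (h : PassInv front n k₀ blk₀ st₀ en₀ Z U k len perm pos blk st en sz aux tch)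
    (h₀ : Seg n k₀ perm₀ pos₀ blk₀ st₀ en₀ sz₀) (hZU : ∀ v ∈ Z, blk₀ v ∈ U)
    {u v : ℕ} (hu : u < n) (hv : v < n) :
    st (blk u) < st (blk v) ↔ st₀ (blk₀ u) < st₀ (blk₀ v) ∨
      st₀ (blk₀ u) = st₀ (blk₀ v) ∧
        bif front then u ∈ Z ∧ v ∉ Z else u ∉ Z ∧ v ∈ Z := by
  have bu := h.bounds hZU hu
  have bv := h.bounds hZU hv
  have pu := (h.seg.st_le u hu).trans_lt (h.seg.lt_en u hu)
  have pv := (h.seg.st_le v hv).trans_lt (h.seg.lt_en v hv)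
  rcases lt_trichotomy (st₀ (blk₀ u)) (st₀ (blk₀ v)) with hlt | heq | hlt
  · have := h₀.en_le_st hu hv hlt
    refine iff_of_true (by omega) (.inl hlt)
  · have hb := h₀.eq_of_st_eq hu hv heq
    have key : ∀ {u v}, u < n → v < n → blk₀ u = blk₀ v → u ∈ Z → v ∉ Z →
        if front then st (blk u) < st (blk v) else st (blk v) < st (blk u) := by
      intro u v hu hv hb huZ hvZ
      have pu := (h.seg.st_le u hu).trans_lt (h.seg.lt_en u hu)
      have pv := (h.seg.st_le v hv).trans_lt (h.seg.lt_en v hv)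
      have h5 := h.splitOff _ (hZU u huZ)
      rw [h.blk_of_mem u hu huZ] at pu ⊢
      rw [h.blk_of_notMem v hv hvZ, ← hb] at pv ⊢
      cases front <;> simp only [SplitOff, if_true, Bool.false_eq_true, if_false] at h5 ⊢ <;> omega
    have same : ∀ {u v}, u < n → v < n → blk₀ u = blk₀ v → (u ∈ Z ↔ v ∈ Z) →
        blk u = blk v := by
      intro u v hu hv hb hZ
      by_cases hvZ : v ∈ Z
      · rw [h.blk_of_mem u hu (hZ.2 hvZ), h.blk_of_mem v hv hvZ, hb]
      · rw [h.blk_of_notMem u hu (fun hc => hvZ (hZ.1 hc)), h.blk_of_notMem v hv hvZ, hb]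
    by_cases huZ : u ∈ Z <;> by_cases hvZ : v ∈ Z
    · rw [same hu hv hb (by tauto)]
      cases front <;> simp [huZ, hvZ, heq]
    · have := key hu hv hb huZ hvZ
      cases front <;> simp [huZ, hvZ, heq] at this ⊢ <;> omega
    · have := key hv hu hb.symm hvZ huZ
      cases front <;> simp [huZ, hvZ, heq] at this ⊢ <;> omega
    · rw [same hu hv hb (by tauto)]
      cases front <;> simp [huZ, hvZ, heq]
  · have := h₀.en_le_st hv hu hlt
    refine iff_of_false (by omega) ?_
    rintro (hc | hc) <;> omega

/-- The position of the boundary inside a block that has been split. -/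
def boundary (front : Bool) (st en : ℕ → ℕ) (d : ℕ) : ℕ := bif front then st d else en d

/-- The new boundary lies strictly inside the former block. -/
theorem boundary_mem
    (h : PassInv front n k₀ blk₀ st₀ en₀ Z U k len perm pos blk st en sz aux tch)
    (hUZ : ∀ d ∈ U, ∃ v ∈ Z, v < n ∧ blk₀ v = d) {d : ℕ} (hd : d ∈ U) (hne : st d < en d) :
    st₀ d < boundary front st en d ∧ boundary front st en d < en₀ d := by
  obtain ⟨v, hvZ, hv, rfl⟩ := hUZ d hd
  have h1 := h.seg.st_le v hv
  have h2 := h.seg.lt_en v hv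
  rw [h.blk_of_mem v hv hvZ] at h1 h2
  have h3 := h.splitOff _ hd
  cases front <;> simp only [SplitOff, boundary, cond_true, cond_false] at h3 ⊢ <;> omega

theorem boundary_inj
    (h : PassInv front n k₀ blk₀ st₀ en₀ Z U k len perm pos blk st en sz aux tch)
    (h₀ : Seg n k₀ perm₀ pos₀ blk₀ st₀ en₀ sz₀)
    (hUZ : ∀ d ∈ U, ∃ v ∈ Z, v < n ∧ blk₀ v = d) {d d' : ℕ} (hd : d ∈ U) (hne : st d < en d)
    (hd' : d' ∈ U) (hne' : st d' < en d')
    (he : boundary front st en d = boundary front st en d') : d = d' := by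
  have h1 := h.boundary_mem hUZ hd hne
  have h2 := h.boundary_mem hUZ hd' hne'
  exact h₀.eq_of_mem (h.le_of_mem d hd) (h.le_of_mem d' hd') h1.1.le h1.2 (he ▸ h2.1.le)
    (he ▸ h2.2)

theorem boundary_ne
    (h : PassInv front n k₀ blk₀ st₀ en₀ Z U k len perm pos blk st en sz aux tch)
    (h₀ : Seg n k₀ perm₀ pos₀ blk₀ st₀ en₀ sz₀)
    (hUZ : ∀ d ∈ U, ∃ v ∈ Z, v < n ∧ blk₀ v = d) {d : ℕ} (hd : d ∈ U) (hne : st d < en d)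
    {u : ℕ} (hu : u < n) : st₀ (blk₀ u) ≠ boundary front st en d := by
  intro he
  have h1 := h.boundary_mem hUZ hd hne
  have h2 := (h₀.st_le u hu).trans_lt (h₀.lt_en u hu)
  have := h₀.eq_of_mem (h.le_of_mem d hd) (h₀.blk_le u hu) h1.1.le h1.2 he.le (he ▸ h2)
  subst this
  omega

theorem exists_st_eq_boundary
    (h : PassInv front n k₀ blk₀ st₀ en₀ Z U k len perm pos blk st en sz aux tch)
    (hUZ : ∀ d ∈ U, ∃ v ∈ Z, v < n ∧ blk₀ v = d) {d : ℕ} (hd : d ∈ U) (hne : st d < en d) :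
    ∃ v < n, st (blk v) = boundary front st en d := by
  have hdk := (h.le_of_mem d hd).trans h.le
  have h3 := h.splitOff d hd
  cases front
  · obtain ⟨v, hvZ, hv, rfl⟩ := hUZ d hd
    refine ⟨v, hv, ?_⟩
    rw [h.blk_of_mem v hv hvZ]
    exact h3.2.1.symm
  · have hn := h.seg.en_le d hdk
    exact ⟨perm (st d), h.seg.perm_lt _ (by omega), by
      rw [h.seg.blk_perm d hdk _ le_rfl hne]
      rfl⟩

theorem st_cases
    (h : PassInv front n k₀ blk₀ st₀ en₀ Z U k len perm pos blk st en sz aux tch)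
    (hZU : ∀ v ∈ Z, blk₀ v ∈ U) {v : ℕ} (hv : v < n) :
    st (blk v) = st₀ (blk₀ v) ∨
      blk₀ v ∈ U ∧ st (blk₀ v) < en (blk₀ v) ∧ st (blk v) = boundary front st en (blk₀ v) := by
  have h4 := (h.seg.st_le v hv).trans_lt (h.seg.lt_en v hv)
  have h6 := h.seg.sz_eq (blk₀ v) ((h.blk_le v hv).trans h.le)
  by_cases hd : blk₀ v ∈ U
  · have h3 := h.splitOff _ hd
    by_cases hvZ : v ∈ Z
    · rw [h.blk_of_mem v hv hvZ] at h4 ⊢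
      by_cases hc : st (blk₀ v) < en (blk₀ v)
      · cases front <;>
          simp only [SplitOff, boundary, cond_true, cond_false, hd, hc, true_and] at h3 ⊢ <;> omega
      · left
        cases front <;> simp only [SplitOff] at h3 <;> omega
    · rw [h.blk_of_notMem v hv hvZ] at h4 ⊢
      cases front
      · exact .inl h3.1
      · exact .inr ⟨hd, h4, rfl⟩
  · rw [h.blk_of_notMem v hv fun hc => hd (hZU v hc)]
    exact .inl (h.untouched _ (h.blk_le v hv) hd).1

theorem exists_st_eq
    (h : PassInv front n k₀ blk₀ st₀ en₀ Z U k len perm pos blk st en sz aux tch)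
    (hZU : ∀ v ∈ Z, blk₀ v ∈ U) (hUZ : ∀ d ∈ U, ∃ v ∈ Z, v < n ∧ blk₀ v = d)
    {v : ℕ} (hv : v < n) : ∃ u < n, st (blk u) = st₀ (blk₀ v) := by
  by_cases hd : blk₀ v ∈ U
  · have h3 := h.splitOff _ hd
    obtain ⟨u, huZ, hu, he⟩ := hUZ _ hd
    cases front
    · by_cases hc : st (blk₀ v) < en (blk₀ v)
      · have hdk := (h.blk_le v hv).trans h.le
        have hn := h.seg.en_le _ hdk
        refine ⟨perm (st (blk₀ v)), h.seg.perm_lt _ (by omega), ?_⟩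
        rw [h.seg.blk_perm _ hdk _ le_rfl hc]
        exact h3.1
      · refine ⟨u, hu, ?_⟩
        rw [h.blk_of_mem u hu huZ, he]
        have h6 := h.seg.sz_eq (blk₀ v) ((h.blk_le v hv).trans h.le)
        simp only [SplitOff] at h3
        omega
    · refine ⟨u, hu, ?_⟩
      rw [h.blk_of_mem u hu huZ, he]
      exact h3.1
  · refine ⟨v, hv, ?_⟩
    rw [h.blk_of_notMem v hv fun hc => hd (hZU v hc)]
    exact (h.untouched _ (h.blk_le v hv) hd).1

end Final

end PassInv

/-- The segmentation in a memory. -/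
def SegHolds (n : ℕ) (s : RamState) : Prop :=
  Seg n (s.reg rBlk) (s.arr aPerm) (s.arr aPos) (s.arr aBlk) (s.arr aSt) (s.arr aEn) (s.arr aSz)

/-- The first position of the block of `v`. -/
def RamState.blockStart (s : RamState) (v : ℕ) : ℕ := s.arr aSt (s.arr aBlk v)

/-- The first positions of all blocks. -/
def RamState.starts (n : ℕ) (s : RamState) : Finset ℕ := (Finset.range n).image s.blockStart

theorem RamState.mem_starts {n : ℕ} {s : RamState} {i : ℕ} :
    i ∈ s.starts n ↔ ∃ v < n, s.blockStart v = i := by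
  simp [RamState.starts]

/-- The invariant of a pass for the contents of a memory; `s₀` is the memory before the pass. -/
def PassHolds (front : Bool) (n : ℕ) (s₀ : RamState) (Z U : Set ℕ) (s : RamState) : Prop :=
  PassInv front n (s₀.reg rBlk) (s₀.arr aBlk) (s₀.arr aSt) (s₀.arr aEn) Z U (s.reg rBlk)
    (s.reg rTch) (s.arr aPerm) (s.arr aPos) (s.arr aBlk) (s.arr aSt) (s.arr aEn) (s.arr aSz)
    (s.arr aAux) (s.arr aTch)

namespace RamProg

/-- Provide the block `rD` with a block `rC` into which states are moved. -/
def touchBlock (front : Bool) : RamProg :=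
  load rC aAux rD ;;
  cond (.eq rC rZero)
    (inc rBlk ;; copy rC rBlk ;; store aAux rD rC ;; load rG (bif front then aSt else aEn) rD ;;
      store aSt rC rG ;; store aEn rC rG ;; store aSz rC rZero ;; store aTch rTch rD ;; inc rTch)
    skip

/-- Move the state `rV` from the front of its block `rD` to the adjacent block `rC`. -/
def shiftFront : RamProg :=
  load rY aPos rV ;; load rG aSt rD ;; load rW aPerm rG ;; store aPerm rY rW ;;
  store aPos rW rY ;; store aPerm rG rV ;; store aPos rV rG ;; store aBlk rV rC ;;
  inc rG ;; store aSt rD rG ;; store aEn rC rG ;;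
  load rZ aSz rD ;; dec rZ ;; store aSz rD rZ ;; load rZ aSz rC ;; inc rZ ;; store aSz rC rZ

/-- Move the state `rV` from the back of its block `rD` to the adjacent block `rC`. -/
def shiftBack : RamProg :=
  load rY aPos rV ;; load rG aEn rD ;; dec rG ;; load rW aPerm rG ;; store aPerm rY rW ;;
  store aPos rW rY ;; store aPerm rG rV ;; store aPos rV rG ;; store aBlk rV rC ;;
  store aEn rD rG ;; store aSt rC rG ;;
  load rZ aSz rD ;; dec rZ ;; store aSz rD rZ ;; load rZ aSz rC ;; inc rZ ;; store aSz rC rZ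

/-- Move the state `rV` out of its block. -/
def moveState (front : Bool) : RamProg :=
  load rD aBlk rV ;; touchBlock front ;; bif front then shiftFront else shiftBack

variable {front : Bool} {n : ℕ} {s₀ : RamState} {Z U : Set ℕ}

theorem runs_touchBlock {s : RamState} (h0 : s.reg rZero = 0)
    (h : PassHolds front n s₀ Z U s) (hZU : ∀ v ∈ Z, s₀.arr aBlk v ∈ U)
    (hd : s.reg rD ≤ s₀.reg rBlk) :
    (touchBlock front).Runs s fun t s₂ => t ≤ 11 ∧
      SameBut [rC, rG, rBlk, rTch] [aSt, aEn, aSz, aAux, aTch] s s₂ ∧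
      PassHolds front n s₀ Z (insert (s.reg rD) U) s₂ ∧ s₂.reg rC = s₂.arr aAux (s.reg rD) := by
  simp only [touchBlock, runs_seq, runs_load, runs_cond, runs_inc, runs_copy, runs_store,
    runs_skip, RamTest.Holds, RamState.reg_setReg, RamState.reg_setArr, RamState.arr_setReg,
    RamState.arr_setArr, if_true, Nat.reduceEqDiff, if_false, h0, SameBut.setReg_iff,
    SameBut.setArr_iff, List.mem_cons, true_or, or_true, SameBut.refl, true_and]
  refine ⟨fun hz => ⟨by omega, ?_, by simp⟩, fun hz => ⟨by omega, ?_, trivial⟩⟩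
  · have hdU : s.reg rD ∉ U := fun hc => (h.aux_ne _).2 hc hz
    have := PassInv.create h hZU hd hdU rfl
    cases front <;>
      simpa only [PassHolds, RamState.reg_setReg, RamState.reg_setArr, RamState.arr_setReg,
        RamState.arr_setArr, if_true, Nat.reduceEqDiff, if_false, cond_true, cond_false] using this
  · have hdU : s.reg rD ∈ U := (h.aux_ne _).1 hz
    rw [Set.insert_eq_of_mem hdU]
    simpa only [PassHolds, RamState.reg_setReg, RamState.reg_setArr, RamState.arr_setReg,
        RamState.arr_setArr, if_true, Nat.reduceEqDiff, if_false] using h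

theorem runs_shift {s : RamState} (h : PassHolds front n s₀ Z U s) (hv : s.reg rV < n)
    (hvZ : s.reg rV ∉ Z) (hd : s.arr aBlk (s.reg rV) = s.reg rD) (hdU : s.reg rD ∈ U)
    (hc : s.reg rC = s.arr aAux (s.reg rD)) :
    (bif front then shiftFront else shiftBack).Runs s fun t s₂ => t ≤ 18 ∧
      SameBut [rY, rG, rW, rZ] [aPerm, aPos, aBlk, aSt, aEn, aSz] s s₂ ∧
      PassHolds front n s₀ (insert (s.reg rV) Z) U s₂ := by
  have hcd : s.reg rC ≠ s.reg rD := by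
    have h1 := h.lt_aux _ hdU
    have h2 := h.le_of_mem _ hdU
    omega
  cases front
  · simp only [cond_false, shiftBack, runs_seq, runs_load, runs_inc, runs_dec, runs_store,
      RamState.reg_setReg, RamState.reg_setArr, RamState.arr_setReg,
      RamState.arr_setArr, if_true, Nat.reduceEqDiff, if_false, SameBut.setReg_iff,
      SameBut.setArr_iff, List.mem_cons, true_or, or_true, SameBut.refl, true_and]
    refine ⟨by omega, ?_⟩
    have := PassInv.move_back h hv hvZ hd hdU hc.symm rfl rfl rfl
    simpa only [PassHolds, RamState.reg_setReg, RamState.reg_setArr, RamState.arr_setReg,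
        RamState.arr_setArr, if_true, Nat.reduceEqDiff, if_false,
        Function.update_of_ne hcd] using this
  · simp only [cond_true, shiftFront, runs_seq, runs_load, runs_inc, runs_dec, runs_store,
      RamState.reg_setReg, RamState.reg_setArr, RamState.arr_setReg,
      RamState.arr_setArr, if_true, Nat.reduceEqDiff, if_false, SameBut.setReg_iff,
      SameBut.setArr_iff, List.mem_cons, true_or, or_true, SameBut.refl, true_and]
    refine ⟨by omega, ?_⟩
    have := PassInv.move_front h hv hvZ hd hdU hc.symm rfl rfl rfl
    simpa only [PassHolds, RamState.reg_setReg, RamState.reg_setArr, RamState.arr_setReg,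
        RamState.arr_setArr, if_true, Nat.reduceEqDiff, if_false,
        Function.update_of_ne hcd] using this

theorem runs_moveState {s : RamState} (h0 : s.reg rZero = 0)
    (h : PassHolds front n s₀ Z U s) (hZU : ∀ v ∈ Z, s₀.arr aBlk v ∈ U) (hv : s.reg rV < n)
    (hvZ : s.reg rV ∉ Z) :
    (moveState front).Runs s fun t s₂ => t ≤ 30 ∧
      SameBut [rD, rC, rY, rG, rW, rZ, rBlk, rTch]
        [aPerm, aPos, aBlk, aSt, aEn, aSz, aAux, aTch] s s₂ ∧
      PassHolds front n s₀ (insert (s.reg rV) Z) (insert (s₀.arr aBlk (s.reg rV)) U) s₂ := by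
  rw [moveState, runs_seq, runs_load, runs_seq]
  have hd₀ : s.arr aBlk (s.reg rV) = s₀.arr aBlk (s.reg rV) := h.blk_of_notMem _ hv hvZ
  set s₁ := s.setReg rD (s.arr aBlk (s.reg rV)) with hs₁
  have hD : s₁.reg rD = s₀.arr aBlk (s.reg rV) := by simp [hs₁, RamState.reg_setReg, hd₀]
  have hV : s₁.reg rV = s.reg rV := by simp [hs₁, RamState.reg_setReg]
  have h₁ : PassHolds front n s₀ Z U s₁ := by
    simpa [PassHolds, hs₁, RamState.reg_setReg, RamState.arr_setReg] using h
  have hsame₁ : SameBut [rD, rC, rY, rG, rW, rZ, rBlk, rTch]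
      [aPerm, aPos, aBlk, aSt, aEn, aSz, aAux, aTch] s s₁ := by
    simp [hs₁, SameBut.setReg_iff, SameBut.refl]
  refine (runs_touchBlock ((hsame₁.1 _ (by simp)).trans h0) h₁ hZU
    (by rw [hD]; exact h.blk_le _ hv)).mono ?_
  rintro t₂ s₂ ⟨ht₂, hsame₂, h₂, hC₂⟩
  have hV₂ : s₂.reg rV = s.reg rV := (hsame₂.1 _ (by simp)).trans hV
  have hD₂ : s₂.reg rD = s₁.reg rD := hsame₂.1 _ (by simp)
  have hB₂ : s₂.arr aBlk = s.arr aBlk := hsame₂.2 _ (by simp)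
  rw [← hD₂] at h₂ hC₂
  refine (runs_shift h₂ (by rw [hV₂]; exact hv) (by rw [hV₂]; exact hvZ)
    (by rw [hV₂, hB₂, hD₂, hD, hd₀]) (by simp) hC₂).mono ?_
  rintro t₃ s₃ ⟨ht₃, hsame₃, h₃⟩
  refine ⟨by omega, ?_, ?_⟩
  · exact (hsame₁.trans (hsame₂.mono (by simp) (by simp))).trans (hsame₃.mono (by simp) (by simp))
  · rwa [hV₂, hD₂, hD] at h₃

/-- Split all blocks by the set of the states in the list `la` of the length in `rl`. -/
def splitPass (front : Bool) (la rl : ℕ) : RamProg :=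
  const rTch 0 ;; const rI 0 ;;
  loop (.lt rI rl) (load rV la rI ;; moveState front ;; inc rI) ;;
  const rI 0 ;;
  loop (.lt rI rTch) (load rD aTch rI ;; store aAux rD rZero ;; load rG aSt rD ;;
    load rY aEn rD ;; cond (.lt rG rY) (insertMark (bif front then rG else rY)) skip ;; inc rI)

theorem runs_moveLoop {la rl : ℕ} (hla : la ∉ [aPerm, aPos, aBlk, aSt, aEn, aSz, aAux, aTch])
    (hrl : rl ∉ [rI, rV, rD, rC, rY, rG, rW, rZ, rBlk, rTch]) {s : RamState}
    (h0 : s.reg rZero = 0) (hseg : SegHolds n s) (haux : ∀ d, s.arr aAux d = 0)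
    (hZ : Enumerates (s.arr la) (s.reg rl) Z) (hZn : ∀ v ∈ Z, v < n) (hT : s.reg rTch = 0)
    (hI : s.reg rI = 0) :
    (loop (.lt rI rl) (load rV la rI ;; moveState front ;; inc rI)).Runs s fun t s₂ =>
      t ≤ 33 * s.reg rl + 1 ∧
      SameBut [rI, rV, rD, rC, rY, rG, rW, rZ, rBlk, rTch]
        [aPerm, aPos, aBlk, aSt, aEn, aSz, aAux, aTch] s s₂ ∧
      PassHolds front n s Z {d | ∃ v ∈ Z, s.arr aBlk v = d} s₂ ∧ s₂.reg rTch ≤ s.reg rl := by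
  refine runs_loop_of_count (s.reg rl) (fun i t s₂ => s₂.reg rI = i ∧ t ≤ 33 * i ∧
    SameBut [rI, rV, rD, rC, rY, rG, rW, rZ, rBlk, rTch]
        [aPerm, aPos, aBlk, aSt, aEn, aSz, aAux, aTch] s s₂ ∧
    PassHolds front n s {v | ∃ j < i, s.arr la j = v}
      {d | ∃ j < i, s.arr aBlk (s.arr la j) = d} s₂) ?_ ?_ ?_ ?_
  · refine ⟨hI, by simp, .refl _ _ _, ?_⟩
    have := PassInv.start front hseg haux (tch := s.arr aTch)
    unfold PassHolds
    rw [hT]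
    convert this using 1 <;> simp
  · rintro i t s₂ hi ⟨h1, h2, h3, -⟩
    simp only [RamTest.Holds, h1, h3.1 rl hrl]
  · rintro i t s₂ hi ⟨h1, h2, h3, h4⟩
    rw [runs_seq, runs_load, runs_seq, h3.2 la hla, h1]
    set s₃ := s₂.setReg rV (s.arr la i) with hs₃
    have hV : s₃.reg rV = s.arr la i := by simp [hs₃, RamState.reg_setReg]
    have hsame₃ : SameBut [rI, rV, rD, rC, rY, rG, rW, rZ, rBlk, rTch]
        [aPerm, aPos, aBlk, aSt, aEn, aSz, aAux, aTch] s s₃ := by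
      simpa [hs₃, SameBut.setReg_iff] using h3
    have h₃ : PassHolds front n s {v | ∃ j < i, s.arr la j = v}
        {d | ∃ j < i, s.arr aBlk (s.arr la j) = d} s₃ := by
      simpa [PassHolds, hs₃, RamState.reg_setReg, RamState.arr_setReg] using h4
    refine (runs_moveState ((hsame₃.1 _ (by simp)).trans h0) h₃ ?_ ?_ ?_).mono ?_
    · rintro v ⟨j, hj, rfl⟩
      exact ⟨j, hj, rfl⟩
    · rw [hV]
      exact hZn _ ((hZ.mem _).2 ⟨i, hi, rfl⟩)
    · rw [hV]
      rintro ⟨j, hj, e⟩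
      have := hZ.inj j i (by omega) hi e
      omega
    · rintro t' s₄ ⟨ht', hsame₄, h₄⟩
      have hI₄ : s₄.reg rI = i := by
        rw [hsame₄.1 _ (by simp)]
        simp [hs₃, RamState.reg_setReg, h1]
      rw [runs_inc, hI₄]
      refine ⟨by simp [RamState.reg_setReg], by omega, ?_, ?_⟩
      · rw [SameBut.setReg_iff (by simp)]
        exact hsame₃.trans (hsame₄.mono (by simp +contextual) (by simp))
      · have key : ∀ f : ℕ → ℕ, {v | ∃ j < i + 1, f j = v} =
            insert (f i) {v | ∃ j < i, f j = v} := by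
          intro f
          ext v
          simp only [Set.mem_insert_iff, Set.mem_ofPred_eq]
          constructor
          · rintro ⟨j, hj, rfl⟩
            rcases Nat.lt_succ_iff_lt_or_eq.1 hj with hj | rfl
            · exact .inr ⟨j, hj, rfl⟩
            · exact .inl rfl
          · rintro (rfl | ⟨j, hj, rfl⟩)
            · exact ⟨i, by omega, rfl⟩
            · exact ⟨j, by omega, rfl⟩
        rw [key, key fun j => s.arr aBlk (s.arr la j)]
        rw [hV] at h₄
        simpa [PassHolds, RamState.reg_setReg, RamState.arr_setReg] using h₄
  · rintro t s₂ ⟨h1, h2, h3, h4⟩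
    have e1 : {v | ∃ j < s.reg rl, s.arr la j = v} = Z := by
      ext v
      exact (hZ.mem v).symm
    have e2 : {d | ∃ j < s.reg rl, s.arr aBlk (s.arr la j) = d} =
        {d | ∃ v ∈ Z, s.arr aBlk v = d} := by
      ext d
      constructor
      · rintro ⟨j, hj, rfl⟩
        exact ⟨_, (hZ.mem _).2 ⟨j, hj, rfl⟩, rfl⟩
      · rintro ⟨v, hv, rfl⟩
        obtain ⟨j, hj, rfl⟩ := (hZ.mem v).1 hv
        exact ⟨j, hj, rfl⟩
    rw [e1, e2] at h4
    refine ⟨by omega, h3, h4, ?_⟩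
    -- every touched block contains the former position of one of the listed states
    have hch : ∀ i : Fin (s₂.reg rTch), ∃ j : Fin (s.reg rl),
        s.arr aBlk (s.arr la j) = s₂.arr aTch i := by
      intro i
      obtain ⟨v, hv, e⟩ := (h4.enum.mem (s₂.arr aTch i)).2 ⟨i, i.2, rfl⟩
      obtain ⟨j, hj, rfl⟩ := (hZ.mem v).1 hv
      exact ⟨⟨j, hj⟩, e⟩
    choose f hf using hch
    have hinj : Function.Injective f := by
      intro i i' e
      refine Fin.ext (h4.enum.inj i i' i.2 i'.2 ?_)
      rw [← hf i, ← hf i', e]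
    simpa using Fintype.card_le_of_injective f hinj

end RamProg

namespace RamState

/-- The end of the block of `v`. -/
def blockEnd (s : RamState) (v : ℕ) : ℕ := s.arr aEn (s.arr aBlk v)

end RamState

namespace RamProg

open RamState

variable {front : Bool} {n h : ℕ} {Z : Set ℕ}

theorem _root_.TreeTables.of_sameBut {R A : List ℕ} {s s₂ : RamState} (ht : TreeTables n h s)
    (hs : SameBut R A s s₂) (hR : ∀ x ∈ R, x ≠ rZero ∧ x ≠ rBase)
    (hA : ∀ a ∈ A, a ≠ aPar ∧ a ≠ aLft ∧ a ≠ aLeaf ∧ a ≠ aOff) : TreeTables n h s₂ := by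
  have e1 := hs.1 rZero fun hc => (hR _ hc).1 rfl
  have e2 := hs.1 rBase fun hc => (hR _ hc).2 rfl
  have e3 := hs.2 aPar fun hc => (hA _ hc).1 rfl
  have e4 := hs.2 aLft fun hc => (hA _ hc).2.1 rfl
  have e5 := hs.2 aLeaf fun hc => (hA _ hc).2.2.1 rfl
  have e6 := hs.2 aOff fun hc => (hA _ hc).2.2.2 rfl
  exact ⟨e1 ▸ ht.zero, e2 ▸ ht.base, e3 ▸ ht.par, e4 ▸ ht.lft, e5 ▸ ht.leaf, e6 ▸ ht.off, ht.le⟩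

/-- The boundaries that have been inserted into the tree after `i` blocks. -/
def newMarks (front : Bool) (st en tch : ℕ → ℕ) (i : ℕ) : Finset ℕ :=
  ((Finset.range i).filter fun j => st (tch j) < en (tch j)).image fun j =>
    PassInv.boundary front st en (tch j)

theorem newMarks_succ (front : Bool) (st en tch : ℕ → ℕ) (i : ℕ) :
    newMarks front st en tch (i + 1) = if st (tch i) < en (tch i) then
      insert (PassInv.boundary front st en (tch i)) (newMarks front st en tch i)
      else newMarks front st en tch i := by
  unfold newMarks
  rw [Finset.range_add_one, Finset.filter_insert]
  split_ifs
  · rw [Finset.image_insert]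
  · rfl

theorem runs_markLoop {s₀ s : RamState} {U : Set ℕ} (hp : PassHolds front n s₀ Z U s)
    (hseg : SegHolds n s₀) (hUZ : ∀ d ∈ U, ∃ v ∈ Z, v < n ∧ s₀.arr aBlk v = d)
    (htab : TreeTables n h s) {M : Finset ℕ} (hM : TreeHolds h M (s.arr aTree))
    (hMs : M ⊆ s₀.starts n) (hI : s.reg rI = 0) :
    (loop (.lt rI rTch) (load rD aTch rI ;; store aAux rD rZero ;; load rG aSt rD ;;
      load rY aEn rD ;; cond (.lt rG rY) (insertMark (bif front then rG else rY)) skip ;;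
      inc rI)).Runs s fun t s₂ =>
        t ≤ 8 * s.reg rTch +
          (5 * h + 7) *
            (newMarks front (s.arr aSt) (s.arr aEn) (s.arr aTch) (s.reg rTch)).card + 1 ∧
        SameBut [rI, rD, rG, rY, rX, rH] [aAux, aTree] s s₂ ∧ (∀ d, s₂.arr aAux d = 0) ∧
        TreeHolds h (M ∪ newMarks front (s.arr aSt) (s.arr aEn) (s.arr aTch) (s.reg rTch))
          (s₂.arr aTree) := by
  refine runs_loop_of_count (s.reg rTch) (fun i t s₂ => s₂.reg rI = i ∧
    t ≤ 8 * i + (5 * h + 7) * (newMarks front (s.arr aSt) (s.arr aEn) (s.arr aTch) i).card ∧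
    SameBut [rI, rD, rG, rY, rX, rH] [aAux, aTree] s s₂ ∧
    (∀ d, (d ∉ U ∨ ∃ j < i, s.arr aTch j = d) → s₂.arr aAux d = 0) ∧
    TreeHolds h (M ∪ newMarks front (s.arr aSt) (s.arr aEn) (s.arr aTch) i) (s₂.arr aTree))
    ?_ ?_ ?_ ?_
  · refine ⟨hI, by simp, .refl _ _ _, ?_, by simpa [newMarks] using hM⟩
    rintro d (hd | ⟨j, hj, -⟩)
    · by_contra hc
      exact hd ((hp.aux_ne d).1 hc)
    · omega
  · rintro i t s₂ hi ⟨h1, h2, h3, -⟩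
    simp only [RamTest.Holds, h1, h3.1 rTch (by simp)]
  · rintro i t s₂ hi ⟨h1, h2, h3, h4, h5⟩
    have e1 : s₂.arr aTch = s.arr aTch := h3.2 _ (by simp)
    have e2 : s₂.arr aSt = s.arr aSt := h3.2 _ (by simp)
    have e3 : s₂.arr aEn = s.arr aEn := h3.2 _ (by simp)
    have e4 : s₂.reg rZero = 0 := (h3.1 _ (by simp)).trans htab.zero
    set d := s.arr aTch i with hd
    have hdU : d ∈ U := (hp.enum.mem d).2 ⟨i, hi, rfl⟩
    have hdk : d ≤ s.reg rBlk := (hp.le_of_mem d hdU).trans hp.le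
    simp only [runs_seq, runs_load, runs_cond, runs_store, runs_skip, runs_inc, RamTest.Holds,
      RamState.reg_setReg, RamState.reg_setArr, RamState.arr_setReg, RamState.arr_setArr, if_true,
      Nat.reduceEqDiff, if_false, e1, e2, e3, e4, h1]
    rw [← hd]
    set s₃ := (((s₂.setReg rD d).setArr aAux d 0).setReg rG (s.arr aSt d)).setReg rY (s.arr aEn d)
      with hs₃
    have hsame₃ : SameBut [rI, rD, rG, rY, rX, rH] [aAux, aTree] s s₃ := by
      simpa [hs₃, SameBut.setReg_iff, SameBut.setArr_iff] using h3
    have hG₃ : s₃.reg rG = s.arr aSt d := by simp [hs₃, RamState.reg_setReg]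
    have hY₃ : s₃.reg rY = s.arr aEn d := by simp [hs₃, RamState.reg_setReg]
    have hI₃ : s₃.reg rI = i := by simp [hs₃, RamState.reg_setReg, RamState.reg_setArr, h1]
    have hA₃ : s₃.arr aAux = Function.update (s₂.arr aAux) d 0 := by
      simp [hs₃, RamState.arr_setReg, RamState.arr_setArr]
    have hT₃ : s₃.arr aTree = s₂.arr aTree := by
      simp [hs₃, RamState.arr_setReg, RamState.arr_setArr]
    have haux : ∀ s₄ : RamState, s₄.arr aAux = s₃.arr aAux →
        ∀ d', (d' ∉ U ∨ ∃ j < i + 1, s.arr aTch j = d') → s₄.arr aAux d' = 0 := by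
      intro s₄ e d' hd'
      rw [e, hA₃, Function.update_apply]
      split_ifs with hdd
      · rfl
      · refine h4 d' (hd'.imp_right ?_)
        rintro ⟨j, hj, rfl⟩
        refine ⟨j, ?_, rfl⟩
        rcases Nat.lt_succ_iff_lt_or_eq.1 hj with hj | rfl
        · exact hj
        · exact absurd hd.symm hdd
    constructor
    · intro hlt
      have hbd : s₃.reg (bif front then rG else rY) =
          PassInv.boundary front (s.arr aSt) (s.arr aEn) d := by
        cases front
        · exact hY₃
        · exact hG₃
      have hb := hp.boundary_mem hUZ hdU hlt
      have hn := hseg.en_le d (hp.le_of_mem d hdU)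
      refine (runs_insertMark (x := bif front then rG else rY) (n := n) (h := h)
        (M := M ∪ newMarks front (s.arr aSt) (s.arr aEn) (s.arr aTch) i)
        (htab.of_sameBut hsame₃ (by simp) (by simp)) (hT₃ ▸ h5) (by rw [hbd]; omega) ?_).mono ?_
      · rw [hbd, Finset.mem_union, not_or]
        constructor
        · intro hc
          obtain ⟨u, hu, e⟩ := mem_starts.1 (hMs hc)
          exact hp.boundary_ne hseg hUZ hdU hlt hu e
        · intro hc
          simp only [newMarks, Finset.mem_image, Finset.mem_filter, Finset.mem_range] at hc
          obtain ⟨j, ⟨hj, hlt'⟩, e⟩ := hc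
          have := hp.boundary_inj hseg hUZ ((hp.enum.mem _).2 ⟨j, by omega, rfl⟩) hlt' hdU hlt e
          have := hp.enum.inj j i (by omega) hi this
          omega
      · rintro t' s₄ ⟨ht', hsame₄, h₄⟩
        have hI₄ : s₄.reg rI = i := (hsame₄.1 _ (by simp)).trans hI₃
        rw [hbd] at h₄
        have hnm := newMarks_succ front (s.arr aSt) (s.arr aEn) (s.arr aTch) i
        rw [← hd, if_pos hlt] at hnm
        have hnot : PassInv.boundary front (s.arr aSt) (s.arr aEn) d ∉
            newMarks front (s.arr aSt) (s.arr aEn) (s.arr aTch) i := by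
          intro hc
          simp only [newMarks, Finset.mem_image, Finset.mem_filter, Finset.mem_range] at hc
          obtain ⟨j, ⟨hj, hlt'⟩, e⟩ := hc
          have := hp.boundary_inj hseg hUZ ((hp.enum.mem _).2 ⟨j, by omega, rfl⟩) hlt' hdU hlt e
          have := hp.enum.inj j i (by omega) hi this
          omega
        refine ⟨by rw [hI₄], ?_, ?_, ?_, ?_⟩
        · rw [hnm, Finset.card_insert_of_notMem hnot, mul_add (5 * h + 7), mul_one]
          omega
        · rw [SameBut.setReg_iff (by simp)]
          exact hsame₃.trans (hsame₄.mono (by simp) (by simp))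
        · exact haux s₄ (hsame₄.2 _ (by simp))
        · rw [hnm, Finset.union_insert]
          exact h₄
    · intro hlt
      have hnm := newMarks_succ front (s.arr aSt) (s.arr aEn) (s.arr aTch) i
      rw [← hd, if_neg hlt] at hnm
      refine ⟨trivial, ?_, ?_, ?_, ?_⟩
      · rw [hnm]
        omega
      · rw [SameBut.setReg_iff (by simp)]
        exact hsame₃
      · exact haux s₃ rfl
      · rw [hnm]
        exact h5
  · rintro t s₂ ⟨h1, h2, h3, h4, h5⟩
    refine ⟨by omega, h3, fun d => h4 d ?_, h5⟩
    rw [← hp.enum.mem d]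
    exact (em _).symm

theorem starts_eq_union {s₀ s : RamState} {U : Set ℕ} (hp : PassHolds front n s₀ Z U s)
    (hZU : ∀ v ∈ Z, s₀.arr aBlk v ∈ U)
    (hUZ : ∀ d ∈ U, ∃ v ∈ Z, v < n ∧ s₀.arr aBlk v = d) :
    s.starts n = s₀.starts n ∪
      newMarks front (s.arr aSt) (s.arr aEn) (s.arr aTch) (s.reg rTch) := by
  ext i
  simp only [newMarks, Finset.mem_union, Finset.mem_image, Finset.mem_filter, Finset.mem_range,
    mem_starts]
  constructor
  · rintro ⟨v, hv, rfl⟩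
    rcases hp.st_cases hZU hv with e | ⟨hd, hlt, e⟩
    · exact .inl ⟨v, hv, e.symm⟩
    · obtain ⟨j, hj, e'⟩ := (hp.enum.mem _).1 hd
      rw [← e'] at hlt e
      exact .inr ⟨j, ⟨hj, hlt⟩, e.symm⟩
  · rintro (⟨v, hv, rfl⟩ | ⟨j, ⟨hj, hlt⟩, rfl⟩)
    · exact hp.exists_st_eq hZU hUZ hv
    · exact hp.exists_st_eq_boundary hUZ ((hp.enum.mem _).2 ⟨j, hj, rfl⟩) hlt

theorem disjoint_newMarks {s₀ s : RamState} {U : Set ℕ} (hp : PassHolds front n s₀ Z U s)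
    (hseg : SegHolds n s₀) (hUZ : ∀ d ∈ U, ∃ v ∈ Z, v < n ∧ s₀.arr aBlk v = d) :
    Disjoint (s₀.starts n)
      (newMarks front (s.arr aSt) (s.arr aEn) (s.arr aTch) (s.reg rTch)) := by
  rw [Finset.disjoint_left]
  intro i hi hc
  obtain ⟨u, hu, rfl⟩ := mem_starts.1 hi
  simp only [newMarks, Finset.mem_image, Finset.mem_filter, Finset.mem_range] at hc
  obtain ⟨j, ⟨hj, hlt⟩, e⟩ := hc
  exact hp.boundary_ne hseg hUZ ((hp.enum.mem _).2 ⟨j, hj, rfl⟩) hlt hu e.symm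

/-- The effect of splitting all blocks by the set `Z`; the set `W` consists of the block starts
that are not marked in the tree. -/
structure SplitResult (front : Bool) (n h : ℕ) (Z : Set ℕ) (W : Finset ℕ) (s s₂ : RamState) :
    Prop where
  same : SameBut [rI, rV, rD, rC, rY, rG, rW, rZ, rBlk, rTch, rX, rH]
    [aPerm, aPos, aBlk, aSt, aEn, aSz, aAux, aTch, aTree] s s₂
  seg : SegHolds n s₂
  aux : ∀ d, s₂.arr aAux d = 0
  tree : TreeHolds h (s₂.starts n \ W) (s₂.arr aTree)
  subset : s.starts n ⊆ s₂.starts n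
  lt_iff : ∀ u v, u < n → v < n → (s₂.blockStart u < s₂.blockStart v ↔
    s.blockStart u < s.blockStart v ∨ s.blockStart u = s.blockStart v ∧
      bif front then u ∈ Z ∧ v ∉ Z else u ∉ Z ∧ v ∈ Z)
  bounds : ∀ v, v < n → s.blockStart v ≤ s₂.blockStart v ∧ s₂.blockEnd v ≤ s.blockEnd v

/-- A pass takes constant time for each state in the list, and one insertion into the tree for each
new block start. -/
theorem runs_splitPass {la rl : ℕ} (hla : la ∉ [aPerm, aPos, aBlk, aSt, aEn, aSz, aAux, aTch])
    (hrl : rl ∉ [rI, rV, rD, rC, rY, rG, rW, rZ, rBlk, rTch]) {s : RamState} {W : Finset ℕ}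
    (htab : TreeTables n h s) (hseg : SegHolds n s) (haux : ∀ d, s.arr aAux d = 0)
    (hZ : Enumerates (s.arr la) (s.reg rl) Z) (hZn : ∀ v ∈ Z, v < n)
    (htree : TreeHolds h (s.starts n \ W) (s.arr aTree)) (hW : W ⊆ s.starts n) :
    (splitPass front la rl).Runs s fun t s₂ =>
      t + (5 * h + 7) * (s.starts n).card ≤
        41 * s.reg rl + 5 + (5 * h + 7) * (s₂.starts n).card ∧
      SplitResult front n h Z W s s₂ := by
  simp only [splitPass, runs_seq, runs_const]
  set s₁ := (s.setReg rTch 0).setReg rI 0 with hs₁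
  have hsame₁ : SameBut [rI, rV, rD, rC, rY, rG, rW, rZ, rBlk, rTch, rX, rH]
      [aPerm, aPos, aBlk, aSt, aEn, aSz, aAux, aTch, aTree] s s₁ := by
    simp [hs₁, SameBut.setReg_iff, SameBut.refl]
  have harr₁ : s₁.arr = s.arr := rfl
  have hrl₁ : s₁.reg rl = s.reg rl := by
    simp only [List.mem_cons, not_or] at hrl
    simp [hs₁, RamState.reg_setReg, hrl]
  have hblk₁ : s₁.reg rBlk = s.reg rBlk := by simp [hs₁, RamState.reg_setReg]
  have hseg₁ : SegHolds n s₁ := by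
    unfold SegHolds
    rw [harr₁, hblk₁]
    exact hseg
  refine (runs_moveLoop (n := n) (Z := Z) (front := front) hla hrl
    (s := s₁) ((hsame₁.1 _ (by simp)).trans htab.zero) hseg₁ (harr₁ ▸ haux)
    (by rw [harr₁, hrl₁]; exact hZ) hZn (by simp [hs₁, RamState.reg_setReg])
    (by simp [hs₁, RamState.reg_setReg])).mono ?_
  rintro t₂ s₂ ⟨ht₂, hsame₂, hp, htl⟩
  have hZU : ∀ v ∈ Z, s₁.arr aBlk v ∈ {d | ∃ v ∈ Z, s₁.arr aBlk v = d} := fun v hv => ⟨v, hv, rfl⟩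
  have hUZ : ∀ d ∈ {d | ∃ v ∈ Z, s₁.arr aBlk v = d}, ∃ v ∈ Z, v < n ∧ s₁.arr aBlk v = d := by
    rintro d ⟨v, hv, e⟩
    exact ⟨v, hv, hZn v hv, e⟩
  set s₃ := s₂.setReg rI 0 with hs₃
  have hsame₃ : SameBut [rI, rV, rD, rC, rY, rG, rW, rZ, rBlk, rTch, rX, rH]
      [aPerm, aPos, aBlk, aSt, aEn, aSz, aAux, aTch, aTree] s s₃ := by
    rw [hs₃, SameBut.setReg_iff (by simp)]
    exact hsame₁.trans (hsame₂.mono (by simp +contextual) (by simp +contextual))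
  have htl₃ : s₃.reg rTch = s₂.reg rTch := by simp [hs₃, RamState.reg_setReg]
  have hp₃ : PassHolds front n s₁ Z {d | ∃ v ∈ Z, s₁.arr aBlk v = d} s₃ := by
    simpa [PassHolds, hs₃, RamState.reg_setReg, RamState.arr_setReg] using hp
  have htree₃ : s₃.arr aTree = s.arr aTree := by
    rw [hs₃, RamState.arr_setReg, hsame₂.2 _ (by simp), harr₁]
  have hst₁ : s₁.starts n = s.starts n := rfl
  refine (runs_markLoop hp₃ hseg₁ hUZ (htab.of_sameBut hsame₃ (by simp) (by simp))
    (M := s.starts n \ W) (htree₃ ▸ htree) (by rw [hst₁]; exact Finset.sdiff_subset)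
    (by simp [hs₃, RamState.reg_setReg])).mono ?_
  rintro t₄ s₄ ⟨ht₄, hsame₄, haux₄, htree₄⟩
  have hst₃ := starts_eq_union hp₃ hZU hUZ
  have hdisj := disjoint_newMarks hp₃ hseg₁ hUZ
  set N := newMarks front (s₃.arr aSt) (s₃.arr aEn) (s₃.arr aTch) (s₃.reg rTch)
  rw [hst₁] at hst₃ hdisj
  have eS : s₄.arr aSt = s₃.arr aSt := hsame₄.2 _ (by simp)
  have eB : s₄.arr aBlk = s₃.arr aBlk := hsame₄.2 _ (by simp)
  have eE : s₄.arr aEn = s₃.arr aEn := hsame₄.2 _ (by simp)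
  have ebs : s₄.blockStart = s₃.blockStart := by
    unfold blockStart
    rw [eS, eB]
  have ebe : s₄.blockEnd = s₃.blockEnd := by
    unfold blockEnd
    rw [eE, eB]
  have est : s₄.starts n = s₃.starts n := by
    unfold starts
    rw [ebs]
  refine ⟨?_, hsame₃.trans (hsame₄.mono (by simp +contextual) (by simp +contextual)), ?_, haux₄, ?_,
    ?_, ?_, ?_⟩
  · rw [est, hst₃, Finset.card_union_of_disjoint hdisj, mul_add (5 * h + 7)]
    rw [hrl₁] at ht₂ htl
    omega
  · have := hp₃.seg
    unfold SegHolds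
    rw [hsame₄.1 rBlk (by simp), hsame₄.2 aPerm (by simp), hsame₄.2 aPos (by simp),
      hsame₄.2 aSz (by simp), eS, eB, eE]
    exact this
  · rw [est, hst₃, Finset.union_sdiff_distrib, Finset.sdiff_eq_self_of_disjoint (s := N)]
    · exact htree₄
    · exact (hdisj.mono_left hW).symm
  · rw [est, hst₃]
    exact Finset.subset_union_left
  · intro u v hu hv
    rw [ebs]
    exact hp₃.lt_iff hseg₁ hZU hu hv
  · intro v hv
    rw [ebs, ebe]
    exact hp₃.bounds hZU hv

end RamProg

/-! ### The invariant of the main loop -/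

namespace RamState

/-- The end of the interval of `X` that starts at the position `i`. -/
def intervalEnd (s : RamState) (i : ℕ) : ℕ := s.arr aXe i

end RamState

open RamState

/-- The blocks of `X` are intervals of positions: the one of the state `v` starts at `x v`. -/
structure Intervals (n : ℕ) (x : ℕ → ℕ) (s : RamState) : Prop where
  le_start : ∀ v, v < n → x v ≤ s.blockStart v
  end_le : ∀ v, v < n → s.blockEnd v ≤ s.intervalEnd (x v)
  disj : ∀ u v, u < n → v < n → x u < x v → s.intervalEnd (x u) ≤ x v
  start : ∀ v, v < n → ∃ u < n, s.blockStart u = x v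
  end_le_n : ∀ v, v < n → s.intervalEnd (x v) ≤ n

/-- The records: two edges have the same record iff they have the same head and their tails lie in
the same block of `X`; the counters count the edges with a record. -/
structure Records (m : ℕ) (tail head x : ℕ → ℕ) (s : RamState) : Prop where
  pos : ∀ e, e < m → 1 ≤ s.arr aRec e
  le : ∀ e, e < m → s.arr aRec e ≤ s.reg rRec
  eq_iff : ∀ e e', e < m → e' < m →
    (s.arr aRec e = s.arr aRec e' ↔ head e = head e' ∧ x (tail e) = x (tail e'))
  count : ∀ r, 1 ≤ r → s.arr aCnt r = countRec m (s.arr aRec) r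

/-- The constant part of the memory that describes the edges, with the number of the states:
`out u` lists the edges with the tail `u`. -/
structure EdgeTables (n m : ℕ) (tail head : ℕ → ℕ) (out : ℕ → List ℕ) (s : RamState) : Prop where
  one : s.reg rOne = 1
  card : s.reg rN = n
  head_eq : s.arr aHead = head
  linked : ∀ u, u < n → IsLinkedList (s.arr aNx) (s.arr aHd u) (out u)
  nodup : ∀ u, u < n → (out u).Nodup
  mem : ∀ u, u < n → ∀ e, e ∈ out u ↔ e < m ∧ tail e = u
  tail_lt : ∀ e, e < m → tail e < n
  head_lt : ∀ e, e < m → head e < n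

/-- The set of the starts of the intervals. -/
def intervalStarts (n : ℕ) (x : ℕ → ℕ) : Finset ℕ := (Finset.range n).image x

theorem mem_intervalStarts {n : ℕ} {x : ℕ → ℕ} {i : ℕ} :
    i ∈ intervalStarts n x ↔ ∃ v < n, x v = i := by
  simp [intervalStarts]

/-- The invariant of the main loop. -/
structure MainInv (n m h : ℕ) (tail head : ℕ → ℕ) (out : ℕ → List ℕ) (x : ℕ → ℕ)
    (s : RamState) : Prop where
  trees : TreeTables n h s
  edges : EdgeTables n m tail head out s
  seg : SegHolds n s
  aux : ∀ d, s.arr aAux d = 0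
  tmp : ∀ v, s.arr aTmp v = 0
  tree : TreeHolds h (s.starts n \ intervalStarts n x) (s.arr aTree)
  intervals : Intervals n x s
  records : Records m tail head x s

theorem EdgeTables.of_sameBut {n m : ℕ} {tail head : ℕ → ℕ} {out : ℕ → List ℕ} {R A : List ℕ}
    {s s₂ : RamState} (ht : EdgeTables n m tail head out s) (hs : SameBut R A s s₂)
    (hR : ∀ x ∈ R, x ≠ rOne ∧ x ≠ rN) (hA : ∀ a ∈ A, a ≠ aHead ∧ a ≠ aNx ∧ a ≠ aHd) :
    EdgeTables n m tail head out s₂ := by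
  have e1 := hs.1 rOne fun hc => (hR _ hc).1 rfl
  have e0 := hs.1 rN fun hc => (hR _ hc).2 rfl
  have e2 := hs.2 aHead fun hc => (hA _ hc).1 rfl
  have e3 := hs.2 aNx fun hc => (hA _ hc).2.1 rfl
  have e4 := hs.2 aHd fun hc => (hA _ hc).2.2 rfl
  exact ⟨e1 ▸ ht.one, e0.trans ht.card, e2 ▸ ht.head_eq, e3 ▸ e4 ▸ ht.linked, ht.nodup, ht.mem,
    ht.tail_lt, ht.head_lt⟩

namespace SegHolds

variable {n : ℕ} {s : RamState}

theorem start_le_pos (h : SegHolds n s) {v : ℕ} (hv : v < n) : s.blockStart v ≤ s.arr aPos v :=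
  h.st_le v hv

theorem pos_lt_end (h : SegHolds n s) {v : ℕ} (hv : v < n) : s.arr aPos v < s.blockEnd v :=
  h.lt_en v hv

theorem start_lt_end (h : SegHolds n s) {v : ℕ} (hv : v < n) : s.blockStart v < s.blockEnd v :=
  (h.st_le v hv).trans_lt (h.lt_en v hv)

theorem end_le (h : SegHolds n s) {v : ℕ} (hv : v < n) : s.blockEnd v ≤ n :=
  h.en_le _ (h.blk_le v hv)

theorem end_le_start (h : SegHolds n s) {u v : ℕ} (hu : u < n) (hv : v < n)
    (hlt : s.blockStart u < s.blockStart v) : s.blockEnd u ≤ s.blockStart v :=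
  h.en_le_st hu hv hlt

theorem blk_eq (h : SegHolds n s) {u v : ℕ} (hu : u < n) (hv : v < n)
    (he : s.blockStart u = s.blockStart v) : s.arr aBlk u = s.arr aBlk v :=
  h.eq_of_st_eq hu hv he

theorem end_eq (h : SegHolds n s) {u v : ℕ} (hu : u < n) (hv : v < n)
    (he : s.blockStart u = s.blockStart v) : s.blockEnd u = s.blockEnd v := by
  unfold blockEnd
  rw [h.blk_eq hu hv he]

theorem start_perm (h : SegHolds n s) {v i : ℕ} (hv : v < n) (h1 : s.blockStart v ≤ i)
    (h2 : i < s.blockEnd v) : s.blockStart (s.arr aPerm i) = s.blockStart v := by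
  unfold blockStart
  rw [h.blk_perm _ (h.blk_le v hv) i h1 h2]

/-- Summing over the positions of a block is summing over the states in the block. -/
theorem sum_block (h : SegHolds n s) {v : ℕ} (hv : v < n) (f : ℕ → ℕ) :
    ∑ i ∈ Finset.Ico (s.blockStart v) (s.blockEnd v), f (s.arr aPerm i) =
      ∑ u ∈ (Finset.range n).filter fun u => s.blockStart u = s.blockStart v, f u := by
  have hn := h.end_le hv
  refine Finset.sum_bij (fun i _ => s.arr aPerm i) ?_ ?_ ?_ (fun _ _ => rfl)
  · intro i hi
    rw [Finset.mem_Ico] at hi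
    exact Finset.mem_filter.2 ⟨Finset.mem_range.2 (h.perm_lt i (by omega)),
      h.start_perm hv hi.1 hi.2⟩
  · intro i hi j hj e
    rw [Finset.mem_Ico] at hi hj
    rw [← h.pos_perm i (by omega), e, h.pos_perm j (by omega)]
  · intro u hu
    obtain ⟨hu, he⟩ := Finset.mem_filter.1 hu
    rw [Finset.mem_range] at hu
    refine ⟨s.arr aPos u, Finset.mem_Ico.2 ⟨he ▸ h.start_le_pos hu, ?_⟩, h.perm_pos u hu⟩
    rw [← h.end_eq hu hv he]
    exact h.pos_lt_end hu

theorem card_block (h : SegHolds n s) {v : ℕ} (hv : v < n) :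
    ((Finset.range n).filter fun u => s.blockStart u = s.blockStart v).card =
      s.arr aSz (s.arr aBlk v) := by
  have h1 := h.sum_block hv fun _ => 1
  have h2 := h.sz_eq _ (h.blk_le v hv)
  simp only [Finset.sum_const, Nat.card_Ico, smul_eq_mul, mul_one] at h1
  rw [← h1]
  unfold blockStart blockEnd
  omega

end SegHolds

namespace Intervals

variable {n : ℕ} {x : ℕ → ℕ} {s : RamState}

theorem eq_of_mem (hx : Intervals n x s) (hs : SegHolds n s) {u v : ℕ} (hu : u < n) (hv : v < n)
    (h1 : x u ≤ s.blockStart v) (h2 : s.blockStart v < s.intervalEnd (x u)) : x v = x u := by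
  have h3 := hx.le_start v hv
  have h4 := hx.end_le v hv
  have h5 := hs.start_lt_end hv
  rcases lt_trichotomy (x u) (x v) with hlt | he | hlt
  · have := hx.disj u v hu hv hlt
    omega
  · exact he.symm
  · have := hx.disj v u hv hu hlt
    omega

theorem start_lt_end (hx : Intervals n x s) (hs : SegHolds n s) {v : ℕ} (hv : v < n) :
    s.blockStart v < s.intervalEnd (x v) :=
  (hs.start_lt_end hv).trans_le (hx.end_le v hv)

/-- Blocks of `P` are contained in blocks of `X`. -/
theorem mono (hx : Intervals n x s) (hs : SegHolds n s) {u v : ℕ} (hu : u < n) (hv : v < n)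
    (h : s.blockStart u ≤ s.blockStart v) : x u ≤ x v := by
  by_contra hc
  have h1 := hx.disj v u hv hu (not_le.1 hc)
  have h2 := hx.start_lt_end hs hv
  have h3 := hx.le_start u hu
  omega

theorem eq_of_start_eq (hx : Intervals n x s) (hs : SegHolds n s) {u v : ℕ} (hu : u < n)
    (hv : v < n) (h : s.blockStart u = s.blockStart v) : x u = x v :=
  le_antisymm (hx.mono hs hu hv h.le) (hx.mono hs hv hu h.ge)

/-- The start of a block is the start of an interval only if it is the start of its own one. -/
theorem notMem_of_ne (hx : Intervals n x s) (hs : SegHolds n s) {u : ℕ} (hu : u < n)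
    (hne : x u ≠ s.blockStart u) : s.blockStart u ∉ intervalStarts n x := by
  intro hc
  obtain ⟨w, hw, e⟩ := mem_intervalStarts.1 hc
  have h1 := hx.le_start w hw
  have h2 := hx.start_lt_end hs hw
  have := hx.eq_of_mem hs hw hu (by omega) (by omega)
  omega

theorem mem_marks (hx : Intervals n x s) (hs : SegHolds n s) {u : ℕ} (hu : u < n)
    (hne : x u ≠ s.blockStart u) : s.blockStart u ∈ s.starts n \ intervalStarts n x :=
  Finset.mem_sdiff.2 ⟨mem_starts.2 ⟨u, hu, rfl⟩, hx.notMem_of_ne hs hu hne⟩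

theorem subset (hx : Intervals n x s) : intervalStarts n x ⊆ s.starts n := by
  intro i hi
  obtain ⟨v, hv, rfl⟩ := mem_intervalStarts.1 hi
  exact mem_starts.2 (hx.start v hv)

/-- A refinement of the blocks does not affect the intervals. -/
theorem of_refine (hx : Intervals n x s) {s₂ : RamState} (hXe : s₂.arr aXe = s.arr aXe)
    (hb : ∀ v, v < n → s.blockStart v ≤ s₂.blockStart v ∧ s₂.blockEnd v ≤ s.blockEnd v)
    (hst : s.starts n ⊆ s₂.starts n) : Intervals n x s₂ := by
  have he : s₂.intervalEnd = s.intervalEnd := by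
    unfold intervalEnd
    rw [hXe]
  refine ⟨fun v hv => (hx.le_start v hv).trans (hb v hv).1, fun v hv => ?_, ?_, fun v hv => ?_, ?_⟩
  · rw [he]
    exact (hb v hv).2.trans (hx.end_le v hv)
  · rw [he]
    exact hx.disj
  · exact mem_starts.1 (hst (mem_starts.2 (hx.start v hv)))
  · rw [he]
    exact hx.end_le_n

end Intervals

/-- The intervals after the interval of `w` has been cut at the start of the block of `w`. -/
def cutAt (x : ℕ → ℕ) (s : RamState) (w u : ℕ) : ℕ :=
  if x u = x w ∧ s.blockStart w ≤ s.blockStart u then s.blockStart w else x u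

namespace Intervals

variable {n : ℕ} {x : ℕ → ℕ} {s : RamState} {w : ℕ}

theorem cut_start (hx : Intervals n x s) (hs : SegHolds n s) (hw : w < n) :
    ∃ u < n, s.blockStart u = x w ∧ x u = x w := by
  obtain ⟨u, hu, e⟩ := hx.start w hw
  have h1 := hx.start_lt_end hs hw
  have h2 := hx.le_start w hw
  exact ⟨u, hu, e, hx.eq_of_mem hs hw hu e.ge (by omega)⟩

theorem intervalStarts_cut (hx : Intervals n x s) (hs : SegHolds n s) (hw : w < n)
    (hlt : x w < s.blockStart w) :
    intervalStarts n (cutAt x s w) = insert (s.blockStart w) (intervalStarts n x) := by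
  ext i
  rw [Finset.mem_insert, mem_intervalStarts, mem_intervalStarts]
  constructor
  · rintro ⟨v, hv, rfl⟩
    unfold cutAt
    split_ifs
    · exact .inl rfl
    · exact .inr ⟨v, hv, rfl⟩
  · rintro (rfl | ⟨v, hv, rfl⟩)
    · exact ⟨w, hw, if_pos ⟨rfl, le_rfl⟩⟩
    · by_cases hvw : x v = x w
      · obtain ⟨u, hu, h1, h2⟩ := hx.cut_start hs hw
        refine ⟨u, hu, ?_⟩
        rw [cutAt, if_neg (by omega), h2, hvw]
      · exact ⟨v, hv, if_neg fun hc => hvw hc.1⟩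

theorem cut (hx : Intervals n x s) (hs : SegHolds n s) (hw : w < n)
    (hlt : x w < s.blockStart w) {s₂ : RamState} (hSt : s₂.blockStart = s.blockStart)
    (hEn : s₂.blockEnd = s.blockEnd)
    (hXe : s₂.arr aXe = Function.update (Function.update (s.arr aXe) (s.blockStart w)
      (s.intervalEnd (x w))) (x w) (s.blockStart w)) : Intervals n (cutAt x s w) s₂ := by
  have hwe := hx.start_lt_end hs hw
  have hwn := hx.end_le_n w hw
  have hne : ∀ v, v < n → x v ≠ s.blockStart w := fun v hv e =>
    hx.notMem_of_ne hs hw hlt.ne (mem_intervalStarts.2 ⟨v, hv, e⟩)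
  have e1 : s₂.intervalEnd (s.blockStart w) = s.intervalEnd (x w) := by
    simp [intervalEnd, hXe, hlt.ne']
  have e2 : s₂.intervalEnd (x w) = s.blockStart w := by
    simp [intervalEnd, hXe]
  have e3 : ∀ v, v < n → x v ≠ x w → s₂.intervalEnd (x v) = s.intervalEnd (x v) := fun v hv h => by
    simp [intervalEnd, hXe, h, hne v hv]
  refine ⟨fun v hv => ?_, fun v hv => ?_, fun u v hu hv => ?_, fun v hv => ?_, fun v hv => ?_⟩
  · rw [hSt]
    have := hx.le_start v hv
    unfold cutAt
    split_ifs <;> omega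
  · rw [hEn]
    have h1 := hx.end_le v hv
    unfold cutAt
    split_ifs with hc
    · rw [e1, ← hc.1]
      exact h1
    · by_cases hvw : x v = x w
      · rw [hvw, e2]
        exact hs.end_le_start hv hw (not_le.1 fun hle => hc ⟨hvw, hle⟩)
      · rw [e3 v hv hvw]
        exact h1
  · have d1 := hx.disj u v hu hv
    have d2 := hx.disj w v hw hv
    have d3 := hx.disj u w hu hw
    unfold cutAt
    intro huv
    split_ifs at huv ⊢ with hc hc' hc'
    · exact absurd huv (lt_irrefl _)
    · rw [e1]
      omega
    · by_cases huw : x u = x w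
      · rw [huw, e2]
      · rw [e3 u hu huw]
        have d4 := hx.disj w u hw hu
        omega
    · by_cases huw : x u = x w
      · rw [huw, e2]
        omega
      · rw [e3 u hu huw]
        exact d1 huv
  · rw [hSt]
    unfold cutAt
    split_ifs
    · exact ⟨w, hw, rfl⟩
    · exact hx.start v hv
  · unfold cutAt
    split_ifs
    · rw [e1]
      exact hwn
    · by_cases hvw : x v = x w
      · rw [hvw, e2]
        omega
      · rw [e3 v hv hvw]
        exact hx.end_le_n v hv

end Intervals

/-! ### The choice of the splitter -/

/-- What the position `j` of the first mark tells about the first compound block: the state `v₁`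
before this position lies in its first block, the state `v₂` at its end lies in its last block. -/
structure FirstCompound (n : ℕ) (x : ℕ → ℕ) (s : RamState) (j v₁ v₂ : ℕ) : Prop where
  lt₁ : v₁ < n
  lt₂ : v₂ < n
  start₁ : s.blockStart v₁ = x v₁
  end₁ : s.blockEnd v₁ = j
  same : x v₂ = x v₁
  end₂ : s.blockEnd v₂ = s.intervalEnd (x v₁)
  ne : s.blockStart v₁ ≠ s.blockStart v₂
  min : ∀ u, u < n → x u = x v₁ → s.blockStart v₁ ≤ s.blockStart u
  max : ∀ u, u < n → x u = x v₁ → s.blockStart u ≤ s.blockStart v₂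
  simple : ∀ u v, u < n → v < n → x u = x v → x u < x v₁ → s.blockStart u = s.blockStart v
  mark : ∃ w < n, s.blockStart w = j ∧ x w = x v₁

/-- A block start is marked if it is not the start of an interval; hence no compound block comes
before the one that contains the first mark. -/
theorem firstCompound_of_min {n : ℕ} {x : ℕ → ℕ} {s : RamState} (hs : SegHolds n s)
    (hx : Intervals n x s) {j : ℕ} (hj : j ∈ s.starts n \ intervalStarts n x)
    (hmin : ∀ i ∈ s.starts n \ intervalStarts n x, j ≤ i) :
    1 ≤ j ∧ FirstCompound n x s j (s.arr aPerm (j - 1))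
      (s.arr aPerm (s.intervalEnd (x (s.arr aPerm (j - 1))) - 1)) := by
  obtain ⟨hj1, hj2⟩ := Finset.mem_sdiff.1 hj
  obtain ⟨w, hw, rfl⟩ := mem_starts.1 hj1
  have hxw : x w < s.blockStart w := by
    refine lt_of_le_of_ne (hx.le_start w hw) fun e => hj2 (mem_intervalStarts.2 ⟨w, hw, e⟩)
  have hwn := (hs.start_lt_end hw).trans_le (hs.end_le hw)
  refine ⟨by omega, ?_⟩
  set j := s.blockStart w with hjw
  set v₁ := s.arr aPerm (j - 1) with hv₁
  have lt₁ : v₁ < n := hs.perm_lt _ (by omega)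
  have pos₁ : s.arr aPos v₁ = j - 1 := hs.pos_perm _ (by omega)
  have a1 := hs.start_le_pos lt₁
  have a2 := hs.pos_lt_end lt₁
  have a3 := hx.le_start v₁ lt₁
  have a4 := hx.end_le v₁ lt₁
  have nomark : ∀ u, u < n → s.blockStart u < j → s.blockStart u = x u := by
    intro u hu hlt
    by_contra hne
    have := hmin _ (hx.mem_marks hs hu (Ne.symm hne))
    omega
  have start₁ := nomark v₁ lt₁ (by omega)
  have end₁ : s.blockEnd v₁ = j := by
    refine le_antisymm (hs.end_le_start lt₁ hw (by omega)) (by omega)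
  have b1 := hx.end_le w hw
  have b2 := hs.start_lt_end hw
  have hsame : x w = x v₁ := by
    rcases lt_trichotomy (x w) (x v₁) with hlt | he | hlt
    · have := hx.disj w v₁ hw lt₁ hlt
      omega
    · exact he
    · have := hx.disj v₁ w lt₁ hw hlt
      omega
  rw [hsame] at b1
  have b3 := hx.end_le_n v₁ lt₁
  set e := s.intervalEnd (x v₁) with he
  set v₂ := s.arr aPerm (e - 1) with hv₂
  have lt₂ : v₂ < n := hs.perm_lt _ (by omega)
  have pos₂ : s.arr aPos v₂ = e - 1 := hs.pos_perm _ (by omega)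
  have c1 := hs.start_le_pos lt₂
  have c2 := hs.pos_lt_end lt₂
  have c3 := hx.le_start v₂ lt₂
  have c4 := hx.end_le v₂ lt₂
  have same : x v₂ = x v₁ := by
    rcases lt_trichotomy (x v₂) (x v₁) with hlt | he | hlt
    · have := hx.disj v₂ v₁ lt₂ lt₁ hlt
      omega
    · exact he
    · have := hx.disj v₁ v₂ lt₁ lt₂ hlt
      omega
  rw [same] at c4
  have end₂ : s.blockEnd v₂ = e := by omega
  refine ⟨lt₁, lt₂, start₁, end₁, same, end₂, ?_, ?_, ?_, ?_, w, hw, rfl, hsame⟩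
  · intro hc
    have := hs.end_eq lt₁ lt₂ hc
    omega
  · intro u hu hxu
    have := hx.le_start u hu
    omega
  · intro u hu hxu
    by_contra hc
    have d1 := hs.end_le_start lt₂ hu (not_le.1 hc)
    have d2 := hx.start_lt_end hs hu
    rw [hxu] at d2
    omega
  · intro u v hu hv huv hlt
    have key : ∀ u, u < n → x u < x v₁ → s.blockStart u = x u := by
      intro u hu hlt
      have d1 := hx.disj u v₁ hu lt₁ hlt
      have d2 := hx.start_lt_end hs hu
      exact nomark u hu (by omega)
    rw [key u hu hlt, key v hv (huv ▸ hlt), huv]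

/-! ### The potential -/

/-- The potential of a partition: every state contributes a weight times the logarithm of the size
of its block. -/
def potential (n : ℕ) (wt : ℕ → ℕ) (x : ℕ → ℕ) : ℕ :=
  ∑ u ∈ Finset.range n, wt u * Nat.log 2 ((Finset.range n).filter fun v => x v = x u).card

/-- If a block `B` with at most half of the states of its block of `x` is split off, then the
potential drops by the weight of `B`. -/
theorem potential_add_le {n : ℕ} {wt x x' : ℕ → ℕ} {B : ℕ → Prop} [DecidablePred B]
    (hx' : ∀ u v, u < n → v < n → (x' u = x' v ↔ x u = x v ∧ (B u ↔ B v)))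
    (hhalf : ∀ u, u < n → B u → 2 * ((Finset.range n).filter B).card ≤
      ((Finset.range n).filter fun v => x v = x u).card) :
    potential n wt x' + ∑ u ∈ (Finset.range n).filter B, wt u ≤ potential n wt x := by
  unfold potential
  rw [Finset.sum_filter, ← Finset.sum_add_distrib]
  refine Finset.sum_le_sum fun u hu => ?_
  rw [Finset.mem_range] at hu
  by_cases hB : B u
  · have hsub : ((Finset.range n).filter fun v => x' v = x' u) ⊆ (Finset.range n).filter B := by
      intro v hv
      obtain ⟨hv, e⟩ := Finset.mem_filter.1 hv
      exact Finset.mem_filter.2 ⟨hv, (((hx' v u (Finset.mem_range.1 hv) hu).1 e).2).2 hB⟩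
    have hpos : 0 < ((Finset.range n).filter fun v => x' v = x' u).card :=
      Finset.card_pos.2 ⟨u, Finset.mem_filter.2 ⟨Finset.mem_range.2 hu, rfl⟩⟩
    have h1 := Finset.card_le_card hsub
    have h2 := hhalf u hu hB
    have h3 : Nat.log 2 ((Finset.range n).filter fun v => x' v = x' u).card + 1 ≤
        Nat.log 2 ((Finset.range n).filter fun v => x v = x u).card := by
      rw [← Nat.log_mul_base (by omega) (by omega)]
      exact Nat.log_mono_right (by omega)
    rw [if_pos hB]
    calc _ = wt u * (Nat.log 2 ((Finset.range n).filter fun v => x' v = x' u).card + 1) := by ring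
      _ ≤ _ := Nat.mul_le_mul_left _ h3
  · rw [if_neg hB, add_zero]
    refine Nat.mul_le_mul_left _ (Nat.log_mono_right (Finset.card_le_card fun v hv => ?_))
    obtain ⟨hv, e⟩ := Finset.mem_filter.1 hv
    exact Finset.mem_filter.2 ⟨hv, ((hx' v u (Finset.mem_range.1 hv) hu).1 e).1⟩

/-! ### Splitting by a block -/

namespace Records

variable {n m b : ℕ} {tail head x x' : ℕ → ℕ} {B : ℕ → Prop} {s s₂ : RamState}

/-- If the block `B` is split off from the block of `X` that starts at `b`, then the edges with
tails in `B` have to be scanned. -/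
theorem of_scan (hr : Records m tail head x s) (hB : ∀ u, u < n → B u → x u = b)
    (hx' : ∀ u v, u < n → v < n → (x' u = x' v ↔ x u = x v ∧ (B u ↔ B v)))
    (htail : ∀ e, e < m → tail e < n)
    (hscan : ScanHolds m head (s.arr aRec) (s.reg rRec) {e | e < m ∧ B (tail e)} s₂) :
    Records m tail head x' s₂ := by
  have hin : ∀ e, e < m → B (tail e) → s₂.arr aRec e = s₂.arr aTmp (head e) ∧
      s₂.arr aTmp (head e) ≠ 0 := fun e he hb =>
    ⟨hscan.rec_of_mem e ⟨he, hb⟩, (hscan.tmp_ne _).2 ⟨e, ⟨he, hb⟩, rfl⟩⟩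
  have hout : ∀ e, ¬ B (tail e) → s₂.arr aRec e = s.arr aRec e := fun e hb =>
    hscan.rec_of_notMem e fun hc => hb hc.2
  have hle := hscan.le
  refine ⟨fun e he => ?_, fun e he => ?_, fun e e' he he' => ?_, hscan.count⟩
  · by_cases hb : B (tail e)
    · obtain ⟨h1, h2⟩ := hin e he hb
      omega
    · rw [hout e hb]
      exact hr.pos e he
  · by_cases hb : B (tail e)
    · obtain ⟨h1, h2⟩ := hin e he hb
      rw [h1]
      exact (hscan.tmp_mem _ h2).2
    · rw [hout e hb]
      exact (hr.le e he).trans hle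
  · rw [hx' _ _ (htail e he) (htail e' he')]
    by_cases hb : B (tail e) <;> by_cases hb' : B (tail e')
    · obtain ⟨h1, h2⟩ := hin e he hb
      obtain ⟨h1', h2'⟩ := hin e' he' hb'
      rw [h1, h1']
      refine ⟨fun h => ⟨hscan.tmp_inj _ _ h2 h, ?_, iff_of_true hb hb'⟩, fun h => by rw [h.1]⟩
      rw [hB _ (htail e he) hb, hB _ (htail e' he') hb']
    · obtain ⟨h1, h2⟩ := hin e he hb
      have h3 := (hscan.tmp_mem _ h2).1
      have h4 := hr.le e' he'
      rw [h1, hout e' hb']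
      exact ⟨fun h => by omega, fun h => absurd (h.2.2.1 hb) hb'⟩
    · obtain ⟨h1, h2⟩ := hin e' he' hb'
      have h3 := (hscan.tmp_mem _ h2).1
      have h4 := hr.le e he
      rw [h1, hout e hb]
      exact ⟨fun h => by omega, fun h => absurd (h.2.2.2 hb') hb⟩
    · rw [hout e hb, hout e' hb', hr.eq_iff e e' he he']
      exact ⟨fun h => ⟨h.1, h.2, iff_of_false hb hb'⟩, fun h => ⟨h.1, h.2.1⟩⟩

/-- After the scan, the counter of the former record of the edges from `B` to `v` counts the edges
to `v` from the rest of the block of `X`. -/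
theorem count_old_eq_zero_iff (hr : Records m tail head x s) (hB : ∀ u, u < n → B u → x u = b)
    (htail : ∀ e, e < m → tail e < n)
    (hscan : ScanHolds m head (s.arr aRec) (s.reg rRec) {e | e < m ∧ B (tail e)} s₂) {v : ℕ}
    (hv : s₂.arr aTmp v ≠ 0) :
    s₂.arr aCnt (s₂.arr aOld v) = 0 ↔ ¬ ∃ e < m, head e = v ∧ x (tail e) = b ∧ ¬ B (tail e) := by
  obtain ⟨e₀, ⟨he₀, hb₀⟩, hv₀, hold⟩ := hscan.old v hv
  rw [hold, hscan.count _ (hr.pos e₀ he₀), countRec, Finset.card_eq_zero,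
    Finset.filter_eq_empty_iff]
  have h0 := hB _ (htail e₀ he₀) hb₀
  constructor
  · rintro h ⟨e, he, hev, hxe, hb⟩
    refine h (Finset.mem_range.2 he) ?_
    rw [hscan.rec_of_notMem e fun hc => hb hc.2, hr.eq_iff e e₀ he he₀]
    exact ⟨hev.trans hv₀.symm, hxe.trans h0.symm⟩
  · intro h e he hc
    rw [Finset.mem_range] at he
    by_cases hb : B (tail e)
    · rw [hscan.rec_of_mem e ⟨he, hb⟩] at hc
      have h1 := (hscan.tmp_mem _ ((hscan.tmp_ne _).2 ⟨e, ⟨he, hb⟩, rfl⟩)).1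
      have h2 := hr.le e₀ he₀
      omega
    · rw [hscan.rec_of_notMem e fun hc => hb hc.2, hr.eq_iff e e₀ he he₀] at hc
      exact h ⟨e, he, hc.1.trans hv₀, hc.2.trans h0, hb⟩

theorem of_sameBut {R A : List ℕ} (hr : Records m tail head x s) (hs : SameBut R A s s₂)
    (hR : ∀ x ∈ R, x ≠ rRec) (hA : ∀ a ∈ A, a ≠ aRec ∧ a ≠ aCnt) : Records m tail head x s₂ := by
  have e1 := hs.1 rRec fun hc => hR _ hc rfl
  have e2 := hs.2 aRec fun hc => (hA _ hc).1 rfl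
  have e3 := hs.2 aCnt fun hc => (hA _ hc).2 rfl
  exact ⟨e2 ▸ hr.pos, e1 ▸ e2 ▸ hr.le, e2 ▸ hr.eq_iff, e2 ▸ e3 ▸ hr.count⟩

end Records

theorem SegHolds.of_sameBut {n : ℕ} {R A : List ℕ} {s s₂ : RamState} (h : SegHolds n s)
    (hs : SameBut R A s s₂) (hR : ∀ x ∈ R, x ≠ rBlk)
    (hA : ∀ a ∈ A, a ∉ [aPerm, aPos, aBlk, aSt, aEn, aSz]) : SegHolds n s₂ := by
  unfold SegHolds
  rw [hs.1 rBlk fun hc => hR _ hc rfl, hs.2 aPerm fun hc => hA _ hc (by simp),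
    hs.2 aPos fun hc => hA _ hc (by simp), hs.2 aBlk fun hc => hA _ hc (by simp),
    hs.2 aSt fun hc => hA _ hc (by simp), hs.2 aEn fun hc => hA _ hc (by simp),
    hs.2 aSz fun hc => hA _ hc (by simp)]
  exact h

theorem SameBut.blockStart_eq {R A : List ℕ} {s s₂ : RamState} (hs : SameBut R A s s₂)
    (hA : ∀ a ∈ A, a ∉ [aBlk, aSt]) : s₂.blockStart = s.blockStart := by
  unfold RamState.blockStart
  rw [hs.2 aBlk fun hc => hA _ hc (by simp), hs.2 aSt fun hc => hA _ hc (by simp)]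

theorem SameBut.blockEnd_eq {R A : List ℕ} {s s₂ : RamState} (hs : SameBut R A s s₂)
    (hA : ∀ a ∈ A, a ∉ [aBlk, aEn]) : s₂.blockEnd = s.blockEnd := by
  unfold RamState.blockEnd
  rw [hs.2 aBlk fun hc => hA _ hc (by simp), hs.2 aEn fun hc => hA _ hc (by simp)]

theorem SameBut.starts_eq {n : ℕ} {R A : List ℕ} {s s₂ : RamState} (hs : SameBut R A s s₂)
    (hA : ∀ a ∈ A, a ∉ [aBlk, aSt]) : s₂.starts n = s.starts n := by
  unfold RamState.starts
  rw [hs.blockStart_eq hA]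

open Classical in
/-- The part of its block to which a state belongs when the splitter is `B` and the compound block
starts at `b`; see `SourceNFA.splitClass`. -/
noncomputable def edgeClass (m : ℕ) (tail head x : ℕ → ℕ) (B : ℕ → Prop) (b v : ℕ) : ℕ :=
  if ∃ e < m, head e = v ∧ B (tail e) then
    if ∃ e < m, head e = v ∧ x (tail e) = b ∧ ¬ B (tail e) then 1 else 0
  else 2

/-- Splitting by `D₁` and then by `D₁₂ ⊆ D₁` is splitting into three parts. -/
theorem lt_iff_of_split_twice {front : Bool} {n : ℕ} {Z₁ Z₂ : Set ℕ} {cls r r₁ r₂ : ℕ → ℕ}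
    (h1 : ∀ u v, u < n → v < n → (r₁ u < r₁ v ↔ r u < r v ∨ r u = r v ∧
      bif front then u ∈ Z₁ ∧ v ∉ Z₁ else u ∉ Z₁ ∧ v ∈ Z₁))
    (h2 : ∀ u v, u < n → v < n → (r₂ u < r₂ v ↔ r₁ u < r₁ v ∨ r₁ u = r₁ v ∧
      bif front then u ∈ Z₂ ∧ v ∉ Z₂ else u ∉ Z₂ ∧ v ∈ Z₂))
    (hc1 : ∀ v, v ∈ Z₁ ↔ cls v < 2) (hc2 : ∀ v, v ∈ Z₂ ↔ cls v < 1) (hc : ∀ v, cls v ≤ 2)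
    {u v : ℕ} (hu : u < n) (hv : v < n) :
    r₂ u < r₂ v ↔ r u < r v ∨ r u = r v ∧
      bif front then cls u < cls v else cls v < cls u := by
  have a1 := h1 u v hu hv
  have a2 := h1 v u hv hu
  have a3 := h2 u v hu hv
  have b1 := hc u
  have b2 := hc v
  simp only [hc1, hc2] at a1 a2 a3
  cases front <;> simp only [cond_true, cond_false] at a1 a2 a3 ⊢ <;> omega

namespace RamProg

open RamState

/-- Cut the interval of `X` from `rS` to `rE` at `rJ`, and split all blocks of `P` by the block in
`rB`, which is one of the two pieces. -/
def processBlock (front : Bool) : RamProg :=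
  store aXe rJ rE ;; store aXe rS rJ ;; deleteMark rJ ;; const rLen 0 ;; scanBlock ;;
  filterList ;; splitPass front aList rLen ;; splitPass front aListTwo rLenTwo

variable {n m h : ℕ} {tail head x : ℕ → ℕ} {out : ℕ → List ℕ} {s : RamState}

/-- The time is split into the work for the edges that leave the splitter, which is `22` steps per
edge for the scan and `9 + 2 * 41` steps for its head, and the work for the new marks. -/
theorem runs_processBlock (front : Bool) (hinv : MainInv n m h tail head out x s) {vB w : ℕ}
    (hvB : vB < n) (hw : w < n) (hlt : x w < s.blockStart w) (hrB : s.reg rB = s.arr aBlk vB)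
    (hrJ : s.reg rJ = s.blockStart w) (hrS : s.reg rS = x w)
    (hrE : s.reg rE = s.intervalEnd (x w))
    (hcut : ∀ u v, u < n → v < n → (cutAt x s w u = cutAt x s w v ↔
      x u = x v ∧ (s.blockStart u = s.blockStart vB ↔ s.blockStart v = s.blockStart vB))) :
    (processBlock front).Runs s fun t s₂ =>
      t + (5 * h + 7) * (s.starts n).card ≤
        ∑ u ∈ (Finset.range n).filter fun u => s.blockStart u = s.blockStart vB,
          (113 * (out u).length + 5) + (5 * h + 26) + (5 * h + 7) * (s₂.starts n).card ∧
      MainInv n m h tail head out (cutAt x s w) s₂ ∧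
      ∀ u v, u < n → v < n → (s₂.blockStart u < s₂.blockStart v ↔
        s.blockStart u < s.blockStart v ∨ s.blockStart u = s.blockStart v ∧
          bif front then
            edgeClass m tail head x (fun u => s.blockStart u = s.blockStart vB) (x vB) u <
              edgeClass m tail head x (fun u => s.blockStart u = s.blockStart vB) (x vB) v
          else
            edgeClass m tail head x (fun u => s.blockStart u = s.blockStart vB) (x vB) v <
              edgeClass m tail head x (fun u => s.blockStart u = s.blockStart vB) (x vB) u) := by
  have hseg := hinv.seg
  have hint := hinv.intervals
  have hI := hint.intervalStarts_cut hseg hw hlt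
  simp only [processBlock, runs_seq, runs_store, runs_const]
  simp only [RamState.reg_setArr, hrJ, hrE, hrS]
  set s₁ := (s.setArr aXe (s.blockStart w) (s.intervalEnd (x w))).setArr aXe (x w)
    (s.blockStart w) with hs₁
  have hsame₁ : SameBut [] [aXe] s s₁ := by
    simp [hs₁, SameBut.setArr_iff, SameBut.refl]
  have hXe₁ : s₁.arr aXe = Function.update (Function.update (s.arr aXe) (s.blockStart w)
      (s.intervalEnd (x w))) (x w) (s.blockStart w) := by
    simp [hs₁, RamState.arr_setArr]
  have hJ₁ : s₁.reg rJ = s.blockStart w := (hsame₁.1 _ (by simp)).trans hrJ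
  refine (runs_deleteMark (x := rJ) (M := s.starts n \ intervalStarts n x)
    (hinv.trees.of_sameBut hsame₁ (by simp) (by simp))
    (hsame₁.2 aTree (by simp) ▸ hinv.tree)
    (by rw [hJ₁]; exact (hseg.start_lt_end hw).trans_le (hseg.end_le hw))
    (by rw [hJ₁]; exact hint.mem_marks hseg hw hlt.ne)).mono ?_
  rintro t₂ s₂ ⟨ht₂, hsame₂, htree₂⟩
  rw [hJ₁, ← Finset.sdiff_insert, ← hI] at htree₂
  set s₃ := s₂.setReg rLen 0 with hs₃
  have hsame₃ : SameBut [rX, rH, rLen] [aXe, aTree] s s₃ := by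
    rw [hs₃, SameBut.setReg_iff (by simp)]
    exact (hsame₁.mono (by simp) (by simp)).trans (hsame₂.mono (by simp +contextual) (by simp))
  have hXe₃ : s₃.arr aXe = s₁.arr aXe := hsame₂.2 _ (by simp)
  have hT₃ : s₃.arr aTree = s₂.arr aTree := rfl
  have hrec₃ := hinv.records.of_sameBut hsame₃ (by simp) (by simp)
  have hed := hinv.edges
  have hbs₃ := hsame₃.blockStart_eq (by simp)
  have hB₃ : s₃.reg rB = s.arr aBlk vB := (hsame₃.1 _ (by simp)).trans hrB
  have hper₃ : s₃.arr aPerm = s.arr aPerm := hsame₃.2 _ (by simp)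
  have hvn := hseg.end_le hvB
  refine (runs_scanBlock (n := n) (m := m) (head := head) (out := out) (tail := tail)
    (rec₀ := s₃.arr aRec) (k₀ := s₃.reg rRec)
    (a := s.blockStart vB) (b := s.blockEnd vB) hed.nodup hed.mem
    ((hsame₃.1 _ (by simp)).trans hinv.trees.zero)
    ((hsame₃.2 _ (by simp)).trans hed.head_eq) ?_ ?_ (by simp [hs₃, RamState.reg_setReg])
    (by rw [hB₃, hsame₃.2 _ (by simp)]; rfl) (by rw [hB₃, hsame₃.2 _ (by simp)]; rfl)
    (hseg.start_lt_end hvB).le ?_ ?_).mono ?_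
  · rw [hsame₃.2 aNx (by simp), hsame₃.2 aHd (by simp)]
    exact hed.linked
  · have hl : s₃.reg rLen = 0 := by simp [hs₃, RamState.reg_setReg]
    unfold ScanHolds
    rw [hl]
    refine ScanInv.start hrec₃.le ?_ hrec₃.count
    rw [hsame₃.2 aTmp (by simp)]
    exact hinv.tmp
  · rw [hper₃]
    exact fun i hi => hseg.perm_lt i (by omega)
  · rw [hper₃]
    intro i j hi hj e
    rw [← hseg.pos_perm i (by omega), e, hseg.pos_perm j (by omega)]
  rw [hper₃]
  rintro t₄ s₄ ⟨ht₄, hsame₄, hscan₄, hlen₄⟩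
  rw [hseg.sum_block hvB fun u => 22 * (out u).length + 5] at ht₄
  rw [hseg.sum_block hvB fun u => (out u).length] at hlen₄
  -- the scanned edges are those with tails in the block of `vB`
  have hE : {e | e < m ∧ ∃ i, s.blockStart vB ≤ i ∧ i < s.blockEnd vB ∧ tail e = s.arr aPerm i} =
      {e | e < m ∧ s.blockStart (tail e) = s.blockStart vB} := by
    ext e
    simp only [Set.mem_ofPred_eq]
    refine and_congr_right fun he => ⟨?_, fun hb => ?_⟩
    · rintro ⟨i, h1, h2, h3⟩
      rw [h3]
      exact hseg.start_perm hvB h1 h2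
    · have ht := hed.tail_lt e he
      refine ⟨s.arr aPos (tail e), hb ▸ hseg.start_le_pos ht, ?_, (hseg.perm_pos _ ht).symm⟩
      rw [← hseg.end_eq ht hvB hb]
      exact hseg.pos_lt_end ht
  rw [hE] at hscan₄
  have hBx : ∀ u, u < n → s.blockStart u = s.blockStart vB → x u = x vB :=
    fun u hu e => hint.eq_of_start_eq hseg hu hvB e
  have hrec₄ := hrec₃.of_scan (x' := cutAt x s w) hBx hcut hed.tail_lt hscan₄
  have hold₄ := fun v => hrec₃.count_old_eq_zero_iff hBx hed.tail_lt hscan₄ (v := v)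
  have hZn : ∀ v ∈ {v | s₄.arr aTmp v ≠ 0}, v < n := by
    intro v hv
    obtain ⟨e, he, rfl⟩ := (hscan₄.tmp_ne v).1 hv
    exact hed.head_lt e he.1
  refine (runs_filterList ((hsame₄.1 rZero (by simp)).trans ((hsame₃.1 _ (by simp)).trans
    hinv.trees.zero)) hscan₄.enum (fun v hv => not_not.1 hv)).mono ?_
  rintro t₅ s₅ ⟨ht₅, hsame₅, htmp₅, hlen₅, henum₅⟩
  have hs35 : SameBut [rW, rY, rV, rZ, rO, rC, rRec, rLen, rP, rQ, rU, rI, rLenTwo]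
      [aTmp, aList, aOld, aRec, aCnt, aListTwo] s₃ s₅ :=
    (hsame₄.mono (by simp +contextual) (by simp +contextual)).trans
      (hsame₅.mono (by simp +contextual) (by simp +contextual))
  have hs05 : SameBut [rW, rY, rV, rZ, rO, rC, rRec, rLen, rP, rQ, rU, rI, rLenTwo, rX, rH]
      [aTmp, aList, aOld, aRec, aCnt, aListTwo, aXe, aTree] s s₅ :=
    (hsame₃.mono (by simp +contextual) (by simp +contextual)).trans
      (hs35.mono (by simp +contextual) (by simp +contextual))
  have hst₅ := hs05.starts_eq (n := n) (by simp)
  have hbs₅ := hs05.blockStart_eq (by simp)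
  have hbe₅ := hs05.blockEnd_eq (by simp)
  have hseg₅ := hseg.of_sameBut hs05 (by simp) (by simp)
  have hXe₅ : s₅.arr aXe = s₁.arr aXe := (hs35.2 _ (by simp)).trans hXe₃
  have hint₅ := hint.cut hseg hw hlt hbs₅ hbe₅ (hXe₅.trans hXe₁)
  have htree₅ : TreeHolds h (s₅.starts n \ intervalStarts n (cutAt x s w)) (s₅.arr aTree) := by
    rw [hst₅, hs35.2 aTree (by simp), hT₃]
    exact htree₂
  have hlen45 : s₅.reg rLen = s₄.reg rLen := hsame₅.1 _ (by simp)
  have htab₅ := hinv.trees.of_sameBut hs05 (by simp) (by simp)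
  refine (runs_splitPass (front := front) (la := aList) (rl := rLen) (by simp) (by simp) htab₅ hseg₅
    (hs05.2 aAux (by simp) ▸ hinv.aux) (by
      rw [hlen45, hsame₅.2 aList (by simp)]
      exact hscan₄.enum) hZn htree₅ hint₅.subset).mono ?_
  rintro t₆ s₆ ⟨ht₆, hres₆⟩
  have htab₆ := htab₅.of_sameBut hres₆.same (by simp) (by simp)
  have hint₆ := hint₅.of_refine (hres₆.same.2 aXe (by simp)) hres₆.bounds hres₆.subset
  have hlen56 : s₆.reg rLenTwo = s₅.reg rLenTwo := hres₆.same.1 _ (by simp)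
  refine (runs_splitPass (front := front) (la := aListTwo) (rl := rLenTwo)
    (Z := {v ∈ {v | s₄.arr aTmp v ≠ 0} | s₄.arr aCnt (s₄.arr aOld v) = 0}) (by simp) (by simp)
    htab₆ hres₆.seg hres₆.aux (by
      rw [hlen56, hres₆.same.2 aListTwo (by simp)]
      exact henum₅) (fun v hv => hZn v hv.1) hres₆.tree hint₆.subset).mono ?_
  rintro t₇ s₇ ⟨ht₇, hres₇⟩
  have hint₇ := hint₆.of_refine (hres₇.same.2 aXe (by simp)) hres₇.bounds hres₇.subset
  have hs57 := hres₆.same.trans hres₇.same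
  refine ⟨?_, ⟨htab₆.of_sameBut hres₇.same (by simp) (by simp), ?_, hres₇.seg, hres₇.aux, ?_,
    hres₇.tree, hint₇, ?_⟩, ?_⟩
  · rw [hlen45] at ht₆
    rw [hlen56] at ht₇
    rw [hst₅] at ht₆
    rw [Finset.sum_add_distrib, ← Finset.mul_sum] at ht₄ ⊢
    omega
  · exact (hed.of_sameBut hs05 (by simp) (by simp)).of_sameBut hs57 (by simp) (by simp)
  · rw [hs57.2 aTmp (by simp)]
    exact htmp₅
  · exact (hrec₄.of_sameBut hsame₅ (by simp) (by simp)).of_sameBut hs57 (by simp) (by simp)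
  · intro u v hu hv
    rw [← hbs₅]
    refine lt_iff_of_split_twice hres₆.lt_iff hres₇.lt_iff (fun v => ?_) (fun v => ?_)
      (fun v => ?_) hu hv
    · rw [Set.mem_ofPred_eq, hscan₄.tmp_ne]
      unfold edgeClass
      simp only [Set.mem_ofPred_eq, hbs₅]
      by_cases h1 : ∃ e < m, head e = v ∧ s.blockStart (tail e) = s.blockStart vB
      · rw [if_pos h1]
        obtain ⟨e, he, h2, h3⟩ := h1
        refine iff_of_true ⟨e, ⟨he, h3⟩, h2⟩ ?_
        split_ifs <;> omega
      · rw [if_neg h1]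
        refine iff_of_false ?_ (by omega)
        rintro ⟨e, ⟨he, h3⟩, h2⟩
        exact h1 ⟨e, he, h2, h3⟩
    · simp only [Set.mem_ofPred_eq]
      unfold edgeClass
      simp only [hbs₅]
      by_cases h1 : ∃ e < m, head e = v ∧ s.blockStart (tail e) = s.blockStart vB
      · rw [if_pos h1]
        obtain ⟨e, he, h2, h3⟩ := h1
        have h4 : s₄.arr aTmp v ≠ 0 := (hscan₄.tmp_ne v).2 ⟨e, ⟨he, h3⟩, h2⟩
        rw [hold₄ v h4]
        split_ifs with h5
        · simp only [h5, not_true, and_false, false_iff]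
          omega
        · simp only [h4, h5, ne_eq, not_false_eq_true, and_self, true_iff]
          omega
      · rw [if_neg h1]
        refine iff_of_false (fun hc => ?_) (by omega)
        obtain ⟨e, ⟨he, h3⟩, h2⟩ := (hscan₄.tmp_ne v).1 hc.1
        exact h1 ⟨e, he, h2, h3⟩
    · unfold edgeClass
      split_ifs <;> omega

end RamProg

/-! ### One iteration of the main loop -/

section

variable {Sig Q : Type*} {n m h : ℕ} {tail head x : ℕ → ℕ} {out : ℕ → List ℕ} {s : RamState}

/-- The edges `0, …, m - 1` represent the transitions of `A`, up to letters, when the states are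
numbered by `e`. -/
def SourceNFA.HasEdges (A : SourceNFA Sig Q) (e : Q ≃ Fin n) (m : ℕ) (tail head : ℕ → ℕ) : Prop :=
  ∀ u v, (∃ a, v ∈ A.step u a) ↔ ∃ i < m, tail i = e u ∧ head i = e v

/-- The functions `r` and `x` on numbered states describe the two ordered partitions of a
configuration. -/
structure Models (e : Q ≃ Fin n) (r x : ℕ → ℕ) (c : RefineConfig Q) : Prop where
  ranksP : Ranks (fun u => r (e u)) c.P
  ranksX : Ranks (fun u => x (e u)) c.X

theorem mem_imgAll_iff {A : SourceNFA Sig Q} {e : Q ≃ Fin n} (hA : A.HasEdges e m tail head)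
    (htail : ∀ i, i < m → tail i < n) (p : ℕ → Prop) (v : Q) :
    v ∈ A.imgAll {u | p (e u)} ↔ ∃ i < m, head i = e v ∧ p (tail i) := by
  rw [SourceNFA.mem_imgAll]
  constructor
  · rintro ⟨a, u, hu, hs⟩
    obtain ⟨i, hi, h1, h2⟩ := (hA u v).1 ⟨a, hs⟩
    exact ⟨i, hi, h2, h1 ▸ hu⟩
  · rintro ⟨i, hi, h1, h2⟩
    have ht : tail i = e (e.symm ⟨tail i, htail i hi⟩) := by simp
    obtain ⟨a, hs⟩ := (hA (e.symm ⟨tail i, htail i hi⟩) v).2 ⟨i, hi, ht, h1⟩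
    exact ⟨a, _, by simpa using h2, hs⟩

theorem splitClass_eq_edgeClass {A : SourceNFA Sig Q} {e : Q ≃ Fin n}
    (hA : A.HasEdges e m tail head) (htail : ∀ i, i < m → tail i < n) (B : ℕ → Prop) (b : ℕ)
    (v : Q) : A.splitClass {u | B (e u)} {u | x (e u) = b} v =
      edgeClass m tail head x B b (e v) := by
  have h : {u : Q | x (e u) = b} \ {u | B (e u)} = {u | x (e u) = b ∧ ¬ B (e u)} := rfl
  unfold SourceNFA.splitClass edgeClass
  rw [h, mem_imgAll_iff hA htail, mem_imgAll_iff hA htail fun u => x u = b ∧ ¬ B u]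
  split_ifs <;> rfl

theorem ncard_numbered (e : Q ≃ Fin n) (p : ℕ → Prop) [DecidablePred p] :
    {u | p (e u)}.ncard = ((Finset.range n).filter p).card := by
  have hinj : Function.Injective fun u => (e u : ℕ) :=
    Fin.val_injective.comp e.injective
  rw [← Set.ncard_image_of_injective _ hinj, ← Set.ncard_coe_finset]
  congr 1
  ext i
  simp only [Set.mem_image, Set.mem_ofPred_eq, Finset.coe_filter, Finset.mem_range]
  constructor
  · rintro ⟨u, hu, rfl⟩
    exact ⟨(e u).2, hu⟩
  · rintro ⟨hi, hp⟩
    exact ⟨e.symm ⟨i, hi⟩, by simpa using hp, by simp⟩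

theorem FirstCompound.splitChoice {j v₁ v₂ : ℕ} (hF : FirstCompound n x s j v₁ v₂)
    (e : Q ≃ Fin n) : SourceNFA.SplitChoice (fun u => s.blockStart (e u)) (fun u => x (e u))
      (e.symm ⟨v₁, hF.lt₁⟩) (e.symm ⟨v₂, hF.lt₂⟩) := by
  refine ⟨fun u v huv hlt => ?_, ?_, ?_, fun u hu => ?_, fun u hu => ?_⟩
  · exact hF.simple _ _ (e u).2 (e v).2 huv (by simpa using hlt)
  · simpa using hF.same.symm
  · simpa using hF.ne
  · simpa using hF.min _ (e u).2 (by simpa using hu)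
  · simpa using hF.max _ (e u).2 (by simpa using hu)

/-- Cutting an interval refines the order of the intervals. -/
theorem cutAt_lt_iff (hx : Intervals n x s) (hs : SegHolds n s) {u v w : ℕ} (hw : w < n)
    (hu : u < n) (hv : v < n) (hlt : x w < s.blockStart w) :
    cutAt x s w u < cutAt x s w v ↔ x u < x v ∨ x u = x v ∧ x u = x w ∧
      s.blockStart u < s.blockStart w ∧ s.blockStart w ≤ s.blockStart v := by
  have h1 := hx.start_lt_end hs hw
  have h2 := hx.disj w u hw hu
  have h3 := hx.disj w v hw hv
  unfold cutAt
  split_ifs <;> omega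

theorem cutAt_eq_iff (hx : Intervals n x s) (hs : SegHolds n s) {u v w : ℕ} (hw : w < n)
    (hu : u < n) (hv : v < n) (hlt : x w < s.blockStart w) :
    cutAt x s w u = cutAt x s w v ↔ x u = x v ∧
      (x u = x w → (s.blockStart w ≤ s.blockStart u ↔ s.blockStart w ≤ s.blockStart v)) := by
  have h1 := cutAt_lt_iff hx hs hw hu hv hlt
  have h2 := cutAt_lt_iff hx hs hw hv hu hlt
  omega

/-- The result of an iteration that takes `t` steps, starts with the block starts `r` and the
interval starts `x`, and ends in `s₂`. New block starts pay for the insertions into the tree, and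
the potential pays for the scanned edges; up to this, the iteration takes `c` steps. -/
def IterationResult (A : SourceNFA Sig Q) (e : Q ≃ Fin n) (m h : ℕ) (tail head : ℕ → ℕ)
    (out : ℕ → List ℕ) (c : ℕ) (r x : ℕ → ℕ) (t : ℕ) (s₂ : RamState) : Prop :=
  ∃ x', MainInv n m h tail head out x' s₂ ∧
    t + (5 * h + 7) * ((Finset.range n).image r).card +
        potential n (fun u => 113 * (out u).length + 5) x' ≤
      potential n (fun u => 113 * (out u).length + 5) x + c +
        (5 * h + 7) * (s₂.starts n).card ∧
    (intervalStarts n x').card = (intervalStarts n x).card + 1 ∧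
    ∀ d, Models e r x d → ∃ d', A.RefineIter d d' ∧ Models e s₂.blockStart x' d'

theorem IterationResult.mono {A : SourceNFA Sig Q} {e : Q ≃ Fin n} {c c' t t' : ℕ} {r : ℕ → ℕ}
    {s₂ : RamState} (hr : IterationResult A e m h tail head out c r x t s₂) (hc : t' + c ≤ c' + t) :
    IterationResult A e m h tail head out c' r x t' s₂ := by
  obtain ⟨x', h1, h2, h3, h4⟩ := hr
  exact ⟨x', h1, by omega, h3, h4⟩

open RamState

/-- Cutting an interval creates one new interval, and splitting off the smaller half pays for
scanning it. -/
theorem MainInv.cut_potential (hinv : MainInv n m h tail head out x s) (wt : ℕ → ℕ) {w vB v : ℕ}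
    (hw : w < n) (hlt : x w < s.blockStart w) (hvB : vB < n) (hv : v < n) (hxv : x v = x vB)
    (hne : s.blockStart v ≠ s.blockStart vB)
    (hsz : s.arr aSz (s.arr aBlk vB) ≤ s.arr aSz (s.arr aBlk v))
    (hcut : ∀ u v, u < n → v < n → (cutAt x s w u = cutAt x s w v ↔
      x u = x v ∧ (s.blockStart u = s.blockStart vB ↔ s.blockStart v = s.blockStart vB))) :
    potential n wt (cutAt x s w) +
        ∑ u ∈ (Finset.range n).filter fun u => s.blockStart u = s.blockStart vB, wt u ≤
      potential n wt x ∧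
    (intervalStarts n (cutAt x s w)).card = (intervalStarts n x).card + 1 := by
  have hseg := hinv.seg
  have hint := hinv.intervals
  constructor
  · refine potential_add_le hcut fun u hu hB => ?_
    have hxu := hint.eq_of_start_eq hseg hu hvB hB
    have hdisj : Disjoint ((Finset.range n).filter fun u => s.blockStart u = s.blockStart vB)
        ((Finset.range n).filter fun u => s.blockStart u = s.blockStart v) := by
      rw [Finset.disjoint_left]
      intro w hw hw'
      exact hne ((Finset.mem_filter.1 hw').2.symm.trans (Finset.mem_filter.1 hw).2)
    have hsub : ((Finset.range n).filter fun u => s.blockStart u = s.blockStart vB) ∪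
        ((Finset.range n).filter fun u => s.blockStart u = s.blockStart v) ⊆
        (Finset.range n).filter fun v => x v = x u := by
      intro w hw
      rw [Finset.mem_union, Finset.mem_filter, Finset.mem_filter, Finset.mem_range] at hw
      rw [Finset.mem_filter, Finset.mem_range]
      rcases hw with ⟨hw, e⟩ | ⟨hw, e⟩
      · exact ⟨hw, (hint.eq_of_start_eq hseg hw hvB e).trans hxu.symm⟩
      · exact ⟨hw, ((hint.eq_of_start_eq hseg hw hv e).trans hxv).trans hxu.symm⟩
    have := Finset.card_le_card hsub
    rw [Finset.card_union_of_disjoint hdisj, hseg.card_block hvB, hseg.card_block hv] at this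
    rw [hseg.card_block hvB]
    omega
  · rw [hint.intervalStarts_cut hseg hw hlt, Finset.card_insert_of_notMem
      (hint.notMem_of_ne hseg hw hlt.ne)]

namespace RamProg

theorem runs_splitByFirst {A : SourceNFA Sig Q} {e : Q ≃ Fin n} (hA : A.HasEdges e m tail head)
    (hinv : MainInv n m h tail head out x s) {j v₁ v₂ : ℕ} (hF : FirstCompound n x s j v₁ v₂)
    (hrB : s.reg rB = s.arr aBlk v₁) (hrJ : s.reg rJ = j) (hrS : s.reg rS = x v₁)
    (hrE : s.reg rE = s.intervalEnd (x v₁))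
    (hsz : s.arr aSz (s.arr aBlk v₁) ≤ s.arr aSz (s.arr aBlk v₂)) :
    (processBlock true).Runs s
      (IterationResult A e m h tail head out (5 * h + 26) s.blockStart x) := by
  have hseg := hinv.seg
  have hint := hinv.intervals
  have htail := hinv.edges.tail_lt
  obtain ⟨w, hw, hwj, hxw⟩ := hF.mark
  have h1 := hseg.start_lt_end hF.lt₁
  have hlt : x w < s.blockStart w := by
    rw [hxw, ← hF.start₁, hwj, ← hF.end₁]
    exact h1
  -- inside the compound block, the states from `j` on are those outside the first block
  have hsplit : ∀ u, u < n → x u = x v₁ →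
      (s.blockStart w ≤ s.blockStart u ↔ s.blockStart u ≠ s.blockStart v₁) := by
    intro u hu hxu
    have h2 := hF.min u hu hxu
    have h3 := hseg.end_le_start hF.lt₁ hu
    have h4 := hF.end₁
    omega
  have hcut : ∀ u v, u < n → v < n → (cutAt x s w u = cutAt x s w v ↔
      x u = x v ∧ (s.blockStart u = s.blockStart v₁ ↔ s.blockStart v = s.blockStart v₁)) := by
    intro u v hu hv
    rw [cutAt_eq_iff hint hseg hw hu hv hlt]
    refine and_congr_right fun huv => ?_
    have h2 := hsplit u hu
    have h3 := hsplit v hv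
    have h4 := hint.eq_of_start_eq hseg hu hF.lt₁
    have h5 := hint.eq_of_start_eq hseg hv hF.lt₁
    by_cases hxu : x u = x v₁
    · have h2 := h2 hxu
      have h3 := h3 (huv ▸ hxu)
      simp only [hxu, hxw, h2, h3, true_imp_iff]
      tauto
    · simp only [hxw, hxu, false_imp_iff, true_iff]
      exact iff_of_false (fun hc => hxu (h4 hc)) (fun hc => hxu (huv.trans (h5 hc)))
  obtain ⟨hpot, hcard⟩ := hinv.cut_potential (fun u => 113 * (out u).length + 5) hw hlt hF.lt₁
    hF.lt₂ hF.same hF.ne.symm hsz hcut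
  refine (runs_processBlock true hinv hF.lt₁ hw hlt hrB (hrJ.trans hwj.symm)
    (hrS.trans hxw.symm) (by rw [hrE, hxw]) hcut).mono ?_
  rintro t s₂ ⟨ht, hinv₂, hord⟩
  refine ⟨cutAt x s w, hinv₂, ?_, hcard, ?_⟩
  · unfold RamState.starts at ht ⊢
    omega
  · rintro ⟨X, P⟩ hd
    have hch := hF.splitChoice e
    suffices hex : ∃ X' P', A.RefineIter ⟨X, P⟩ ⟨X', P'⟩ ∧
        Ranks (fun u => cutAt x s w (e u)) X' ∧ Ranks (fun u => s₂.blockStart (e u)) P' by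
      obtain ⟨X', P', hit, hX', hP'⟩ := hex
      exact ⟨⟨X', P'⟩, hit, hP', hX'⟩
    refine hch.iter_first A hd.ranksP hd.ranksX (fun u v => hint.mono hseg (e u).2 (e v).2) ?_ ?_ ?_
    · simp only [Equiv.apply_symm_apply]
      rw [ncard_numbered e fun u => s.blockStart u = s.blockStart v₁,
        ncard_numbered e fun u => s.blockStart u = s.blockStart v₂, hseg.card_block hF.lt₁,
        hseg.card_block hF.lt₂]
      exact hsz
    · intro u v
      simp only [Equiv.apply_symm_apply]
      rw [splitClass_eq_edgeClass hA htail (fun u => s.blockStart u = s.blockStart v₁),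
        splitClass_eq_edgeClass hA htail (fun u => s.blockStart u = s.blockStart v₁)]
      exact hord _ _ (e u).2 (e v).2
    · intro u v
      simp only [Equiv.apply_symm_apply]
      rw [cutAt_lt_iff hint hseg hw (e u).2 (e v).2 hlt]
      have h2 := hsplit _ (e u).2
      have h3 := hsplit _ (e v).2
      have h4 := hint.eq_of_start_eq hseg (e u).2 hF.lt₁
      rw [hxw]
      omega

theorem runs_splitByLast {A : SourceNFA Sig Q} {e : Q ≃ Fin n} (hA : A.HasEdges e m tail head)
    (hinv : MainInv n m h tail head out x s) {j v₁ v₂ : ℕ} (hF : FirstCompound n x s j v₁ v₂)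
    (hrB : s.reg rB = s.arr aBlk v₂) (hrJ : s.reg rJ = s.blockStart v₂) (hrS : s.reg rS = x v₁)
    (hrE : s.reg rE = s.intervalEnd (x v₁))
    (hsz : s.arr aSz (s.arr aBlk v₂) ≤ s.arr aSz (s.arr aBlk v₁)) :
    (processBlock false).Runs s
      (IterationResult A e m h tail head out (5 * h + 26) s.blockStart x) := by
  have hseg := hinv.seg
  have hint := hinv.intervals
  have htail := hinv.edges.tail_lt
  have h1 := hF.min v₂ hF.lt₂ hF.same
  have hne := hF.ne
  have hlt : x v₂ < s.blockStart v₂ := by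
    rw [hF.same, ← hF.start₁]
    omega
  have hsplit : ∀ u, u < n → x u = x v₁ →
      (s.blockStart v₂ ≤ s.blockStart u ↔ s.blockStart u = s.blockStart v₂) := by
    intro u hu hxu
    have h2 := hF.max u hu hxu
    omega
  have hcut : ∀ u v, u < n → v < n → (cutAt x s v₂ u = cutAt x s v₂ v ↔
      x u = x v ∧ (s.blockStart u = s.blockStart v₂ ↔ s.blockStart v = s.blockStart v₂)) := by
    intro u v hu hv
    rw [cutAt_eq_iff hint hseg hF.lt₂ hu hv hlt]
    refine and_congr_right fun huv => ?_
    have h2 := hsplit u hu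
    have h3 := hsplit v hv
    have h4 := hint.eq_of_start_eq hseg hu hF.lt₂
    have h5 := hint.eq_of_start_eq hseg hv hF.lt₂
    rw [hF.same] at h4 h5 ⊢
    by_cases hxu : x u = x v₁
    · have h2 := h2 hxu
      have h3 := h3 (huv ▸ hxu)
      simp only [hxu, h2, h3, true_imp_iff]
    · simp only [hxu, false_imp_iff, true_iff]
      exact iff_of_false (fun hc => hxu (h4 hc)) (fun hc => hxu (huv.trans (h5 hc)))
  obtain ⟨hpot, hcard⟩ := hinv.cut_potential (fun u => 113 * (out u).length + 5) hF.lt₂ hlt hF.lt₂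
    hF.lt₁ hF.same.symm hF.ne hsz hcut
  refine (runs_processBlock false hinv hF.lt₂ hF.lt₂ hlt hrB hrJ
    (hrS.trans hF.same.symm) (by rw [hrE, hF.same]) hcut).mono ?_
  rintro t s₂ ⟨ht, hinv₂, hord⟩
  refine ⟨cutAt x s v₂, hinv₂, ?_, hcard, ?_⟩
  · unfold RamState.starts at ht ⊢
    omega
  · rintro ⟨X, P⟩ hd
    have hch := hF.splitChoice e
    suffices hex : ∃ X' P', A.RefineIter ⟨X, P⟩ ⟨X', P'⟩ ∧
        Ranks (fun u => cutAt x s v₂ (e u)) X' ∧ Ranks (fun u => s₂.blockStart (e u)) P' by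
      obtain ⟨X', P', hit, hX', hP'⟩ := hex
      exact ⟨⟨X', P'⟩, hit, hP', hX'⟩
    refine hch.iter_last A hd.ranksP hd.ranksX (fun u v => hint.mono hseg (e u).2 (e v).2) ?_ ?_ ?_
    · simp only [Equiv.apply_symm_apply]
      rw [ncard_numbered e fun u => s.blockStart u = s.blockStart v₁,
        ncard_numbered e fun u => s.blockStart u = s.blockStart v₂, hseg.card_block hF.lt₁,
        hseg.card_block hF.lt₂]
      exact hsz
    · intro u v
      simp only [Equiv.apply_symm_apply]
      rw [splitClass_eq_edgeClass hA htail (fun u => s.blockStart u = s.blockStart v₂),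
        splitClass_eq_edgeClass hA htail (fun u => s.blockStart u = s.blockStart v₂), ← hF.same]
      exact hord _ _ (e u).2 (e v).2
    · intro u v
      simp only [Equiv.apply_symm_apply]
      rw [cutAt_lt_iff hint hseg hF.lt₂ (e u).2 (e v).2 hlt]
      have h2 := hsplit _ (e u).2
      have h3 := hsplit _ (e v).2
      have h4 := hint.eq_of_start_eq hseg (e v).2 hF.lt₂
      have h5 := hF.max _ (e u).2
      rw [hF.same] at h4 ⊢
      omega

/-- The body of the main loop. -/
def iteration : RamProg :=
  findMark ;; copy rP rJ ;; dec rP ;; load rV aPerm rP ;; load rF aBlk rV ;; load rS aSt rF ;;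
  load rE aXe rS ;; copy rP rE ;; dec rP ;; load rV aPerm rP ;; load rL aBlk rV ;;
  load rZ aSz rF ;; load rO aSz rL ;;
  cond (.le rZ rO) (copy rB rF ;; processBlock true)
    (copy rB rL ;; load rJ aSt rL ;; processBlock false)

theorem _root_.MainInv.of_sameBut {R : List ℕ} {s₂ : RamState}
    (hinv : MainInv n m h tail head out x s) (hs : SameBut R [] s s₂)
    (hR : ∀ y ∈ R, y ∉ [rZero, rBase, rOne, rN, rBlk, rRec]) :
    MainInv n m h tail head out x s₂ := by
  have hbs := hs.blockStart_eq (by simp)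
  have hbe := hs.blockEnd_eq (by simp)
  refine ⟨hinv.trees.of_sameBut hs ?_ (by simp), hinv.edges.of_sameBut hs ?_ (by simp),
    hinv.seg.of_sameBut hs ?_ (by simp), ?_, ?_, ?_, ?_, hinv.records.of_sameBut hs ?_ (by simp)⟩
  · intro y hy
    have := hR y hy
    simp only [List.mem_cons, not_or] at this
    exact ⟨this.1, this.2.1⟩
  · intro y hy
    have := hR y hy
    simp only [List.mem_cons, not_or] at this
    exact ⟨this.2.2.1, this.2.2.2.1⟩
  · intro y hy
    have := hR y hy
    simp only [List.mem_cons, not_or] at this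
    exact this.2.2.2.2.1
  · rw [hs.2 aAux (by simp)]
    exact hinv.aux
  · rw [hs.2 aTmp (by simp)]
    exact hinv.tmp
  · rw [hs.2 aTree (by simp), hs.starts_eq (by simp)]
    exact hinv.tree
  · refine hinv.intervals.of_refine (hs.2 aXe (by simp)) (fun v _ => ?_) ?_
    · rw [hbs, hbe]
      exact ⟨le_rfl, le_rfl⟩
    · rw [hs.starts_eq (by simp)]
  · intro y hy
    have := hR y hy
    simp only [List.mem_cons, not_or] at this
    exact this.2.2.2.2.2.1

theorem runs_iteration {A : SourceNFA Sig Q} {e : Q ≃ Fin n} (hA : A.HasEdges e m tail head)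
    (hinv : MainInv n m h tail head out x s)
    (hne : (s.starts n \ intervalStarts n x).Nonempty) :
    iteration.Runs s
      (IterationResult A e m h tail head out (10 * h + 50) s.blockStart x) := by
  rw [iteration, runs_seq]
  have hlt : ∀ j ∈ s.starts n \ intervalStarts n x, j < n := by
    intro j hj
    obtain ⟨v, hv, rfl⟩ := mem_starts.1 (Finset.mem_sdiff.1 hj).1
    exact (hinv.seg.start_lt_end hv).trans_le (hinv.seg.end_le hv)
  refine (runs_findMark hinv.trees hinv.tree hlt hne).mono ?_
  rintro t₁ s₁ ⟨ht₁, hsame₁, hj, hmin⟩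
  have hXe₁ : s₁.arr aXe = s.arr aXe := hsame₁.2 _ (by simp)
  obtain ⟨hj1, hF⟩ := firstCompound_of_min hinv.seg hinv.intervals hj hmin
  set j := s₁.reg rJ with hjdef
  set v₁ := s.arr aPerm (j - 1) with hv₁
  have hst₁ : s.arr aSt (s.arr aBlk v₁) = x v₁ := hF.start₁
  have hie : s.arr aXe (x v₁) = s.intervalEnd (x v₁) := rfl
  set v₂ := s.arr aPerm (s.intervalEnd (x v₁) - 1) with hv₂
  simp only [runs_seq, runs_load, runs_copy, runs_dec, runs_cond, RamTest.Holds,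
    RamState.reg_setReg, RamState.arr_setReg, if_true, Nat.reduceEqDiff, if_false,
    hsame₁.2 aPerm (by simp), hsame₁.2 aBlk (by simp), hsame₁.2 aSt (by simp), hXe₁,
    hsame₁.2 aSz (by simp), ← hjdef, ← hv₁, hst₁, hie, ← hv₂]
  have key : ∀ s₂ : RamState, SameBut [rX, rH, rJ, rP, rV, rF, rS, rE, rL, rZ, rO, rB] [] s s₂ →
      MainInv n m h tail head out x s₂ ∧ FirstCompound n x s₂ j v₁ v₂ ∧
      s₂.blockStart = s.blockStart := by
    intro s₂ hs
    have hbs := hs.blockStart_eq (by simp)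
    have hbe := hs.blockEnd_eq (by simp)
    have hie : s₂.intervalEnd = s.intervalEnd := by
      unfold intervalEnd
      rw [hs.2 aXe (by simp)]
    refine ⟨hinv.of_sameBut hs (by simp), ⟨hF.lt₁, hF.lt₂, ?_, ?_, hF.same, ?_, ?_, ?_, ?_, ?_, ?_⟩,
      hbs⟩ <;> simp only [hbs, hbe, hie]
    exacts [hF.start₁, hF.end₁, hF.end₂, hF.ne, hF.min, hF.max, hF.simple, hF.mark]
  refine ⟨fun hle => ?_, fun hle => ?_⟩
  · generalize hs₂ : RamState.setReg _ rB _ = s₂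
    have hs : SameBut [rX, rH, rJ, rP, rV, rF, rS, rE, rL, rZ, rO, rB] [] s s₂ := by
      rw [← hs₂]
      simp only [SameBut.setReg_iff, List.mem_cons, true_or, or_true]
      exact hsame₁.mono (by simp +contextual) (by simp)
    obtain ⟨hinv₂, hF₂, hbs⟩ := key s₂ hs
    rw [← hbs]
    refine (runs_splitByFirst hA hinv₂ hF₂ ?_ ?_ ?_ ?_ ?_).mono fun t s₃ h₃ =>
      h₃.mono (by omega)
    · rw [hs.2 aBlk (by simp), ← hs₂]
      simp [RamState.reg_setReg]
    · rw [← hs₂]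
      simp [RamState.reg_setReg, hjdef]
    · rw [← hs₂]
      simp [RamState.reg_setReg]
    · rw [← hs₂]
      simp [RamState.reg_setReg, RamState.arr_setReg, intervalEnd, hXe₁]
    · rw [hs.2 aBlk (by simp), hs.2 aSz (by simp)]
      exact hle
  · generalize hs₂ : RamState.setReg _ rJ _ = s₂
    have hs : SameBut [rX, rH, rJ, rP, rV, rF, rS, rE, rL, rZ, rO, rB] [] s s₂ := by
      rw [← hs₂]
      simp only [SameBut.setReg_iff, List.mem_cons, true_or, or_true]
      exact hsame₁.mono (by simp +contextual) (by simp)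
    obtain ⟨hinv₂, hF₂, hbs⟩ := key s₂ hs
    rw [← hbs]
    refine (runs_splitByLast hA hinv₂ hF₂ ?_ ?_ ?_ ?_ ?_).mono fun t s₃ h₃ =>
      h₃.mono (by omega)
    · rw [hs.2 aBlk (by simp), ← hs₂]
      simp [RamState.reg_setReg]
    · rw [hbs, ← hs₂]
      simp [RamState.reg_setReg, RamState.blockStart]
    · rw [← hs₂]
      simp [RamState.reg_setReg]
    · rw [← hs₂]
      simp [RamState.reg_setReg, RamState.arr_setReg, intervalEnd, hXe₁]
    · rw [hs.2 aBlk (by simp), hs.2 aSz (by simp)]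
      exact (not_le.1 hle).le

end RamProg

end

/-! ### The main loop -/

theorem TreeHolds.root {n h : ℕ} {M : Finset ℕ} {tc : ℕ → ℕ} (hM : TreeHolds h M tc)
    (hMn : ∀ j ∈ M, j < n) (hn : n ≤ 2 ^ h) : tc 1 = M.card := by
  classical
  rw [hM 1 le_rfl, Finset.filter_true_of_mem]
  intro j hj
  have := hMn j hj
  exact ⟨h, by rw [Nat.add_div_left _ (by positivity), Nat.div_eq_of_lt (by omega)]⟩

namespace RamProg

open RamState

/-- The loop of the algorithm: iterate until there are no marks left. -/
def mainLoop : RamProg :=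
  load rT aTree rOne ;; loop (.ne rT rZero) (iteration ;; load rT aTree rOne)

variable {Sig Q : Type*} {n m h : ℕ} {tail head : ℕ → ℕ} {out : ℕ → List ℕ}

theorem _root_.MainInv.root {x : ℕ → ℕ} {s : RamState}
    (hinv : MainInv n m h tail head out x s) :
    s.arr aTree 1 = (s.starts n \ intervalStarts n x).card := by
  refine hinv.tree.root (n := n) (fun j hj => ?_) hinv.trees.le
  obtain ⟨v, hv, rfl⟩ := mem_starts.1 (Finset.mem_sdiff.1 hj).1
  exact (hinv.seg.start_lt_end hv).trans_le (hinv.seg.end_le hv)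

/-- Every block start is inserted into the tree and every interval start is deleted from it at most
once; this and the `O(h)` steps for finding a mark give the term `(15 * h + 60) * n`. -/
theorem runs_mainLoop {A : SourceNFA Sig Q} {e : Q ≃ Fin n} (hA : A.HasEdges e m tail head)
    {x : ℕ → ℕ} {s : RamState} (hinv : MainInv n m h tail head out x s) {d : RefineConfig Q}
    (hd : Models e s.blockStart x d) :
    mainLoop.Runs s fun t s₂ =>
      t ≤ potential n (fun u => 113 * (out u).length + 5) x + (15 * h + 60) * n + 2 ∧
      SegHolds n s₂ ∧ s₂.reg rN = n ∧
      ∃ P, Relation.ReflTransGen A.RefineIter d ⟨P, P⟩ ∧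
        Ranks (fun u => s₂.blockStart (e u)) P := by
  set wt : ℕ → ℕ := fun u => 113 * (out u).length + 5 with hwt
  rw [mainLoop, runs_seq, runs_load, hinv.edges.one]
  have hload : ∀ {x : ℕ → ℕ} {s : RamState}, MainInv n m h tail head out x s →
      MainInv n m h tail head out x (s.setReg rT (s.arr aTree 1)) := fun {x s} hi =>
    hi.of_sameBut (R := [rT]) (by simp [SameBut.setReg_iff, SameBut.refl]) (by simp)
  have hcardS : ∀ s : RamState, (s.starts n).card ≤ n := fun s =>
    Finset.card_image_le.trans (by simp)
  have hcardI : ∀ x, (intervalStarts n x).card ≤ n := fun x =>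
    Finset.card_image_le.trans (by simp)
  refine runs_loop_of_variant (fun k t s₂ => ∃ x', MainInv n m h tail head out x' s₂ ∧
    n - (intervalStarts n x').card = k ∧ s₂.reg rT = s₂.arr aTree 1 ∧
    t + (5 * h + 7) * (s.starts n).card + potential n wt x' +
        (10 * h + 52) * (intervalStarts n x).card ≤
      potential n wt x + (5 * h + 7) * (s₂.starts n).card +
        (10 * h + 52) * (intervalStarts n x').card ∧
    ∃ d', Relation.ReflTransGen A.RefineIter d d' ∧ Models e s₂.blockStart x' d')
    (n - (intervalStarts n x).card) ?_ ?_ ?_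
  · refine ⟨x, hload hinv, rfl, by simp [RamState.reg_setReg, RamState.arr_setReg], ?_,
      d, .refl, hd⟩
    rw [show (s.setReg rT (s.arr aTree 1)).starts n = s.starts n from rfl]
    omega
  · rintro k t s₂ ⟨x', hinv₂, hk, hT, ht, d', hdd', hd'⟩ hb
    have hz := hinv₂.trees.zero
    simp only [RamTest.Holds, hT, hz, hinv₂.root] at hb
    rw [runs_seq]
    refine (runs_iteration hA hinv₂ (Finset.card_ne_zero.1 hb)).mono ?_
    rintro t₃ s₃ ⟨x'', hinv₃, ht₃, hcard, hmod⟩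
    rw [runs_load, hinv₃.edges.one]
    obtain ⟨d'', hit, hd''⟩ := hmod d' hd'
    have h1 := hcardI x''
    refine ⟨_, ?_, x'', hload hinv₃, rfl, by simp [RamState.reg_setReg, RamState.arr_setReg], ?_,
      d'', hdd'.tail hit, hd''⟩
    · omega
    · rw [show (s₃.setReg rT (s₃.arr aTree 1)).starts n = s₃.starts n from rfl, hcard,
        mul_add (10 * h + 52)]
      change t₃ + (5 * h + 7) * (s₂.starts n).card + potential n wt x'' ≤
        potential n wt x' + (10 * h + 50) + (5 * h + 7) * (s₃.starts n).card at ht₃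
      omega
  · rintro k t s₂ ⟨x', hinv₂, hk, hT, ht, ⟨X, P⟩, hdd', hd'⟩ hb
    have hz := hinv₂.trees.zero
    simp only [RamTest.Holds, hT, hz, hinv₂.root, ne_eq, not_not, Finset.card_eq_zero] at hb
    have h1 : (5 * h + 7) * (s₂.starts n).card ≤ (5 * h + 7) * n :=
      Nat.mul_le_mul_left _ (hcardS s₂)
    have h2 : (10 * h + 52) * (intervalStarts n x').card ≤ (10 * h + 52) * n :=
      Nat.mul_le_mul_left _ (hcardI x')
    have h3 : (15 * h + 60) * n = (5 * h + 7) * n + (10 * h + 52) * n + n := by ring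
    have hxr : ∀ u, u < n → x' u = s₂.blockStart u := by
      intro u hu
      by_contra hc
      have := hinv₂.intervals.mem_marks hinv₂.seg hu hc
      rw [hb] at this
      simp at this
    obtain rfl : X = P := hd'.ranksP.eq_of_mono hd'.ranksX
      (fun u v => hinv₂.intervals.mono hinv₂.seg (e u).2 (e v).2) fun u v huv => by
        rwa [hxr _ (e u).2, hxr _ (e v).2] at huv
    exact ⟨by omega, hinv₂.seg, hinv₂.edges.card, X, hdd', hd'.ranksP⟩

/-! ### The output -/

/-- Number the blocks from left to right, and write the number of its block for every state. -/
def writeOutput : RamProg :=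
  const rI 0 ;; const rC 0 ;;
  loop (.lt rI rN) (load rV aPerm rI ;; load rD aBlk rV ;; store aOut rV rC ;; inc rI ;;
    load rG aEn rD ;; cond (.eq rG rI) (inc rC) skip)

/-- The number of a block is the number of the blocks that start before it. -/
theorem runs_writeOutput {s : RamState} (hN : s.reg rN = n) (hseg : SegHolds n s) :
    writeOutput.Runs s fun t s₂ => t ≤ 9 * n + 3 ∧ ∀ v, v < n →
      s₂.arr aOut v = ((s.starts n).filter fun j => j < s.blockStart v).card := by
  simp only [writeOutput, runs_seq, runs_const]
  refine runs_loop_of_count n (fun i t s₂ => s₂.reg rI = i ∧ t ≤ 9 * i ∧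
    SameBut [rI, rC, rV, rD, rG] [aOut] s s₂ ∧
    s₂.reg rC = ((s.starts n).filter fun j => j < i ∧
      ∀ v, v < n → s.blockStart v = j → s.blockEnd v ≤ i).card ∧
    ∀ v, v < n → s.arr aPos v < i →
      s₂.arr aOut v = ((s.starts n).filter fun j => j < s.blockStart v).card) ?_ ?_ ?_ ?_
  · refine ⟨by simp [RamState.reg_setReg], by simp, by simp [SameBut.setReg_iff, SameBut.refl],
      ?_, by simp⟩
    simp [RamState.reg_setReg]
  · rintro i t s₂ hi ⟨h1, h2, h3, -⟩
    simp only [RamTest.Holds, h1, h3.1 rN (by simp), hN]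
  · rintro i t s₂ hi ⟨h1, h2, h3, h4, h5⟩
    have e1 : s₂.arr aPerm = s.arr aPerm := h3.2 _ (by simp)
    have e2 : s₂.arr aBlk = s.arr aBlk := h3.2 _ (by simp)
    have e3 : s₂.arr aEn = s.arr aEn := h3.2 _ (by simp)
    set v := s.arr aPerm i with hv
    have hvn : v < n := hseg.perm_lt i hi
    have hpos : s.arr aPos v = i := hseg.pos_perm i hi
    have hst := hseg.start_le_pos hvn
    have hen := hseg.pos_lt_end hvn
    have hend : s.arr aEn (s.arr aBlk v) = s.blockEnd v := rfl
    -- the closed blocks are those before the block of `v`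
    have hC : ((s.starts n).filter fun j => j < i ∧
        ∀ v, v < n → s.blockStart v = j → s.blockEnd v ≤ i) =
        (s.starts n).filter fun j => j < s.blockStart v := by
      refine Finset.filter_congr fun j hj => ?_
      obtain ⟨u, hu, rfl⟩ := mem_starts.1 hj
      constructor
      · rintro ⟨h6, h7⟩
        by_contra hc
        have h8 := h7 u hu rfl
        rcases (not_lt.1 hc).lt_or_eq with hlt | he
        · have := hseg.end_le_start hvn hu hlt
          omega
        · have := hseg.end_eq hvn hu he
          omega
      · intro hlt
        refine ⟨by omega, fun w hw hwu => ?_⟩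
        have := hseg.end_le_start hw hvn (by omega)
        omega
    rw [hC] at h4
    have hout : ∀ u, u < n → s.arr aPos u < i + 1 →
        Function.update (s₂.arr aOut) v (s₂.reg rC) u =
          ((s.starts n).filter fun j => j < s.blockStart u).card := by
      intro u hu hui
      rw [Function.update_apply]
      split_ifs with huv
      · rw [huv, h4]
      · refine h5 u hu (lt_of_le_of_ne (by omega) fun hc => huv ?_)
        rw [hv, ← hc, hseg.perm_pos u hu]
    simp only [runs_seq, runs_load, runs_cond, runs_inc, runs_store,
      runs_skip, RamTest.Holds, RamState.reg_setReg, RamState.reg_setArr, RamState.arr_setReg,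
      RamState.arr_setArr, if_true, Nat.reduceEqDiff, if_false, e1, e2, e3, h1, ← hv, hend,
      SameBut.setReg_iff, SameBut.setArr_iff, List.mem_cons, true_or, or_true, h3, true_and]
    refine ⟨fun hz => ⟨by omega, ?_, hout⟩, fun hz => ⟨by omega, ?_, hout⟩⟩
    · rw [h4, ← Finset.card_insert_of_notMem (a := s.blockStart v) (by simp)]
      congr 1
      ext j
      simp only [Finset.mem_insert, Finset.mem_filter]
      constructor
      · rintro (rfl | ⟨hj, hlt⟩)
        · refine ⟨mem_starts.2 ⟨v, hvn, rfl⟩, by omega, fun w hw hwv => ?_⟩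
          rw [hseg.end_eq hw hvn hwv]
          exact hz.le
        · refine ⟨hj, by omega, fun w hw hwj => ?_⟩
          have := hseg.end_le_start hw hvn (by omega)
          omega
      · rintro ⟨hj, hlt, hall⟩
        obtain ⟨u, hu, rfl⟩ := mem_starts.1 hj
        have h6 := hall u hu rfl
        rcases lt_trichotomy (s.blockStart u) (s.blockStart v) with hl | he | hl
        · exact .inr ⟨hj, hl⟩
        · exact .inl he
        · have := hseg.end_le_start hvn hu hl
          have := hseg.start_lt_end hu
          omega
    · rw [h4]
      congr 1
      refine Finset.filter_congr fun j hj => ?_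
      obtain ⟨u, hu, rfl⟩ := mem_starts.1 hj
      constructor
      · intro hlt
        refine ⟨by omega, fun w hw hwu => ?_⟩
        have := hseg.end_le_start hw hvn (by omega)
        omega
      · rintro ⟨hlt, hall⟩
        have h6 := hall u hu rfl
        rcases lt_trichotomy (s.blockStart u) (s.blockStart v) with hl | he | hl
        · exact hl
        · have := hseg.end_eq hu hvn he
          omega
        · have := hseg.end_le_start hvn hu hl
          have := hseg.start_lt_end hu
          omega
  · rintro t s₂ ⟨h1, h2, h3, h4, h5⟩
    exact ⟨by omega, fun v hv => h5 v hv (hseg.pos_lt v hv)⟩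

/-- The index of a part is the number of the parts before it. -/
theorem _root_.Ranks.card_lt_eq {P : List (Set Q)} {r : ℕ → ℕ} {e : Q ≃ Fin n}
    (hP : Ranks (fun u => r (e u)) P) {i : ℕ} (hi : i < P.length) {u : Q} (hu : u ∈ P[i]) :
    (((Finset.range n).image r).filter fun j => j < r (e u)).card = i := by
  have hmem : ∀ j (hj : j < P.length), ∃ v, v ∈ P[j] := fun j hj =>
    hP.nonempty _ (List.getElem_mem hj)
  have : Nonempty Q := ⟨u⟩
  choose! g hg using hmem
  rw [← Finset.card_range i]
  symm
  refine Finset.card_bij (fun j _ => r (e (g j))) ?_ ?_ ?_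
  · intro j hj
    rw [Finset.mem_range] at hj
    refine Finset.mem_filter.2 ⟨Finset.mem_image.2 ⟨_, Finset.mem_range.2 (e (g j)).2, rfl⟩, ?_⟩
    exact hP.lt_of_lt (by omega) hi hj (hg j (by omega)) hu
  · intro j hj k hk he
    rw [Finset.mem_range] at hj hk
    rcases lt_trichotomy j k with hlt | rfl | hlt
    · exact absurd he (hP.lt_of_lt (by omega) (by omega) hlt (hg j (by omega))
        (hg k (by omega))).ne
    · rfl
    · exact absurd he (hP.lt_of_lt (by omega) (by omega) hlt (hg k (by omega))
        (hg j (by omega))).ne'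
  · intro y hy
    obtain ⟨hy, hlt⟩ := Finset.mem_filter.1 hy
    obtain ⟨w, hw, rfl⟩ := Finset.mem_image.1 hy
    rw [Finset.mem_range] at hw
    obtain ⟨D, hD, hwD⟩ := hP.cover (e.symm ⟨w, hw⟩)
    obtain ⟨j, hj, rfl⟩ := List.getElem_of_mem hD
    have he : r (e (g j)) = r w := by
      simpa using hP.const _ (List.getElem_mem hj) _ (hg j hj) _ hwD
    refine ⟨j, Finset.mem_range.2 ?_, he⟩
    by_contra hc
    rcases (not_lt.1 hc).lt_or_eq with hij | rfl
    · have : r (e u) < r (e (g j)) := hP.lt_of_lt hi hj hij hu (hg j hj)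
      omega
    · have : r (e (g i)) = r (e u) := hP.const _ (List.getElem_mem hj) _ (hg i hj) _ hu
      omega

end RamProg

/-! ### Building the tables -/

/-- The numbers `e < i` with `f e = u`, in descending order. -/
def edgeList (f : ℕ → ℕ) (i u : ℕ) : List ℕ := ((List.range i).filter fun e => f e = u).reverse

theorem edgeList_succ (f : ℕ → ℕ) (i u : ℕ) :
    edgeList f (i + 1) u = if f i = u then i :: edgeList f i u else edgeList f i u := by
  unfold edgeList
  rw [List.range_succ, List.filter_append, List.reverse_append]
  split_ifs with h <;> simp [h]

theorem mem_edgeList {f : ℕ → ℕ} {i u e : ℕ} : e ∈ edgeList f i u ↔ e < i ∧ f e = u := by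
  simp [edgeList]

theorem nodup_edgeList (f : ℕ → ℕ) (i u : ℕ) : (edgeList f i u).Nodup :=
  List.nodup_reverse.2 (List.nodup_range.filter _)

theorem sum_length_edgeList_le (f : ℕ → ℕ) (n i : ℕ) :
    ∑ u ∈ Finset.range n, (edgeList f i u).length ≤ i := by
  induction i with
  | zero => simp [edgeList]
  | succ i ih =>
    have : ∀ u, (edgeList f (i + 1) u).length =
        (edgeList f i u).length + if f i = u then 1 else 0 := fun u => by
      rw [edgeList_succ]
      split_ifs <;> simp
    simp only [this, Finset.sum_add_distrib, Finset.sum_ite_eq]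
    split_ifs <;> omega

theorem IsLinkedList.push {f nx hd : ℕ → ℕ} {i : ℕ}
    (h : ∀ u, IsLinkedList nx (hd u) (edgeList f i u)) (u : ℕ) :
    IsLinkedList (Function.update nx i (hd (f i))) (Function.update hd (f i) (i + 1) u)
      (edgeList f (i + 1) u) := by
  have hcongr : ∀ u, IsLinkedList (Function.update nx i (hd (f i))) (hd u) (edgeList f i u) :=
    fun u => (h u).congr fun e he => by
      rw [Function.update_of_ne]
      have := (mem_edgeList.1 he).1
      omega
  rw [edgeList_succ]
  split_ifs with hu
  · subst hu
    rw [Function.update_self]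
    refine ⟨rfl, ?_⟩
    rw [Function.update_self]
    exact hcongr _
  · rw [Function.update_of_ne (Ne.symm hu)]
    exact hcongr u

namespace RamProg

open RamState

/-- Build the linked lists of the edges with the same tail, and of the edges with the same
letter. -/
def buildLists : RamProg :=
  const rI 0 ;;
  loop (.lt rI rM) (load rU aTail rI ;; load rW aHd rU ;; store aNx rI rW ;; load rV aLet rI ;;
    load rW aLhd rV ;; store aLnx rI rW ;; inc rI ;; store aHd rU rI ;; store aLhd rV rI)

variable {n m h : ℕ}

theorem runs_buildLists {s : RamState} (hM : s.reg rM = m) (h1 : ∀ u, s.arr aHd u = 0)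
    (h2 : ∀ a, s.arr aLhd a = 0) :
    buildLists.Runs s fun t s₂ => t ≤ 10 * m + 2 ∧
      SameBut [rI, rU, rV, rW] [aHd, aNx, aLhd, aLnx] s s₂ ∧
      (∀ u, IsLinkedList (s₂.arr aNx) (s₂.arr aHd u) (edgeList (s.arr aTail) m u)) ∧
      ∀ a, IsLinkedList (s₂.arr aLnx) (s₂.arr aLhd a) (edgeList (s.arr aLet) m a) := by
  simp only [buildLists, runs_seq, runs_const]
  refine runs_loop_of_count m (fun i t s₂ => s₂.reg rI = i ∧ t ≤ 10 * i ∧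
    SameBut [rI, rU, rV, rW] [aHd, aNx, aLhd, aLnx] s s₂ ∧
    (∀ u, IsLinkedList (s₂.arr aNx) (s₂.arr aHd u) (edgeList (s.arr aTail) i u)) ∧
    ∀ a, IsLinkedList (s₂.arr aLnx) (s₂.arr aLhd a) (edgeList (s.arr aLet) i a)) ?_ ?_ ?_ ?_
  · refine ⟨by simp [RamState.reg_setReg], by simp, by simp [SameBut.setReg_iff, SameBut.refl],
      fun u => h1 u, fun a => h2 a⟩
  · rintro i t s₂ hi ⟨h3, h4, h5, -⟩
    simp only [RamTest.Holds, h3, h5.1 rM (by simp), hM]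
  · rintro i t s₂ hi ⟨h3, h4, h5, h6, h7⟩
    have e1 : s₂.arr aTail = s.arr aTail := h5.2 _ (by simp)
    have e2 : s₂.arr aLet = s.arr aLet := h5.2 _ (by simp)
    simp only [runs_seq, runs_load, runs_inc, runs_store,
      RamState.reg_setReg, RamState.reg_setArr, RamState.arr_setReg,
      RamState.arr_setArr, if_true, Nat.reduceEqDiff, if_false, e1, e2, h3,
      SameBut.setReg_iff, SameBut.setArr_iff, List.mem_cons, true_or, or_true, h5, true_and]
    exact ⟨by omega, IsLinkedList.push h6, IsLinkedList.push h7⟩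
  · rintro t s₂ ⟨h3, h4, h5⟩
    exact ⟨by omega, h5⟩

/-- Write the next node of the tree into the table of left children, and its two children into the
table of parents. -/
def nextNode : RamProg :=
  store aLft rP rC ;; store aPar rC rP ;; inc rC ;; store aPar rC rP ;; inc rC ;; inc rP

/-- Build the tables of the tree, and compute the least power of two that is at least `n`. -/
def buildTree : RamProg :=
  const rI 0 ;; const rP 0 ;; const rC 0 ;; loop (.lt rI rN) (inc rI ;; nextNode ;; nextNode) ;;
  const rBase 1 ;; loop (.lt rBase rN) (load rBase aLft rBase)

theorem runs_nextNode {s : RamState} {Φ : ℕ → RamState → Prop} :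
    nextNode.Runs s Φ ↔ Φ 6 ((((((s.setArr aLft (s.reg rP) (s.reg rC)).setArr aPar (s.reg rC)
      (s.reg rP)).setReg rC (s.reg rC + 1)).setArr aPar (s.reg rC + 1) (s.reg rP)).setReg rC
      (s.reg rC + 2)).setReg rP (s.reg rP + 1)) := by
  simp only [nextNode, runs_seq, runs_inc, runs_store,
    RamState.reg_setReg, RamState.reg_setArr, if_true, Nat.reduceEqDiff, if_false, Nat.reduceAdd]

/-- The invariant of the construction of the tables of the tree: the children of the first `c`
nodes have been entered. -/
structure TreeBuild (c : ℕ) (s : RamState) : Prop where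
  node : s.reg rP = c
  child : s.reg rC = 2 * c
  par : ∀ y, y < 2 * c → s.arr aPar y = y / 2
  lft : ∀ x, x < c → s.arr aLft x = 2 * x

theorem TreeBuild.next {c : ℕ} {s : RamState} (hs : TreeBuild c s) :
    nextNode.Runs s fun t s₂ => t = 6 ∧ SameBut [rP, rC] [aLft, aPar] s s₂ ∧
      TreeBuild (c + 1) s₂ := by
  rw [runs_nextNode]
  simp only [SameBut.setReg_iff, SameBut.setArr_iff, List.mem_cons, true_or, or_true,
    SameBut.refl, true_and]
  refine ⟨by simp [RamState.reg_setReg, hs.node],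
    by simp [RamState.reg_setReg, hs.child, mul_add], fun y hy => ?_,
    fun x hx => ?_⟩
  · simp only [RamState.arr_setReg, RamState.arr_setArr, if_true, Nat.reduceEqDiff, if_false,
      hs.child, hs.node, Function.update_apply]
    have := hs.par y
    split_ifs <;> omega
  · simp only [RamState.arr_setReg, RamState.arr_setArr, if_true, Nat.reduceEqDiff, if_false,
      hs.child, hs.node, Function.update_apply]
    have := hs.lft x
    split_ifs <;> omega

theorem runs_buildTree {s : RamState} (hN : s.reg rN = n) (hn : 1 ≤ n) :
    buildTree.Runs s fun t s₂ => t ≤ 18 * n + 6 ∧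
      SameBut [rI, rP, rC, rBase] [aLft, aPar] s s₂ ∧
      ∃ h, s₂.reg rBase = 2 ^ h ∧ n ≤ 2 ^ h ∧ 2 ^ h < 2 * n ∧
        (∀ y, y < 2 ^ (h + 1) → s₂.arr aPar y = y / 2) ∧
        ∀ x, x < 2 ^ h → s₂.arr aLft x = 2 * x := by
  simp only [buildTree, runs_seq, runs_const]
  refine (runs_loop_of_count (Φ := fun t s₂ => t ≤ 14 * n + 1 ∧
    SameBut [rI, rP, rC, rBase] [aLft, aPar] s s₂ ∧ TreeBuild (2 * n) s₂) n
    (fun i t s₂ => s₂.reg rI = i ∧ t ≤ 14 * i ∧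
    SameBut [rI, rP, rC, rBase] [aLft, aPar] s s₂ ∧ TreeBuild (2 * i) s₂) ?_ ?_ ?_ ?_).mono ?_
  · refine ⟨by simp [RamState.reg_setReg], by simp, by simp [SameBut.setReg_iff, SameBut.refl],
      by simp [RamState.reg_setReg], by simp [RamState.reg_setReg], by simp, by simp⟩
  · rintro i t s₂ hi ⟨h3, h4, h5, -⟩
    simp only [RamTest.Holds, h3, h5.1 rN (by simp), hN]
  · rintro i t s₂ hi ⟨h3, h4, h5, h6⟩
    rw [runs_seq, runs_inc, runs_seq]
    have h7 : TreeBuild (2 * i) (s₂.setReg rI (s₂.reg rI + 1)) := by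
      refine ⟨?_, ?_, h6.par, h6.lft⟩
      · simpa [RamState.reg_setReg] using h6.node
      · simpa [RamState.reg_setReg] using h6.child
    refine h7.next.mono ?_
    rintro t₃ s₃ ⟨rfl, hs₃, h8⟩
    refine h8.next.mono ?_
    rintro t₄ s₄ ⟨rfl, hs₄, h9⟩
    have hs := (hs₃.trans hs₄).mono (R' := [rI, rP, rC, rBase]) (A' := [aLft, aPar])
      (by simp +contextual) (by simp +contextual)
    refine ⟨?_, by omega, SameBut.trans ?_ hs, h9⟩
    · rw [(hs₃.trans hs₄).1 rI (by simp)]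
      simp [RamState.reg_setReg, h3]
    · simpa [SameBut.setReg_iff] using h5
  · rintro t s₂ ⟨h3, h4, h5⟩
    exact ⟨by omega, h5⟩
  · rintro t₁ s₁ ⟨ht₁, hs₁, hb⟩
    refine runs_loop_of_variant (fun k t s₂ => ∃ g, s₂.reg rBase = 2 ^ g ∧ k = n - 2 ^ g ∧
      2 ^ g < 2 * n ∧ t = 2 * g ∧ SameBut [rI, rP, rC, rBase] [aLft, aPar] s s₂ ∧
      s₂.arr = s₁.arr) (n - 1) ?_ ?_ ?_
    · refine ⟨0, by simp [RamState.reg_setReg], by simp, by simp; omega, rfl, ?_, rfl⟩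
      rwa [SameBut.setReg_iff (by simp)]
    · rintro k t s₂ ⟨g, h3, rfl, h4, rfl, h5, h6⟩ hlt
      simp only [RamTest.Holds, h3, h5.1 rN (by simp), hN] at hlt
      have hpow : 2 ^ (g + 1) = 2 * 2 ^ g := pow_succ' 2 g
      have hpos : 0 < 2 ^ g := by positivity
      rw [runs_load, h6, h3, hb.lft _ h4]
      refine ⟨n - 2 ^ (g + 1), by omega, g + 1, by simp [RamState.reg_setReg, hpow], rfl, by omega,
        by ring, ?_, h6⟩
      rwa [SameBut.setReg_iff (by simp)]
    · rintro k t s₂ ⟨g, h3, rfl, h4, rfl, h5, h6⟩ hlt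
      simp only [RamTest.Holds, h3, h5.1 rN (by simp), hN, not_lt] at hlt
      have hpow : 2 ^ (g + 1) = 2 * 2 ^ g := pow_succ' 2 g
      have hg : g < 2 ^ g := Nat.lt_two_pow_self
      refine ⟨by omega, h5, g, h3, hlt, h4, fun y hy => ?_, fun x hx => ?_⟩
      · rw [h6]
        exact hb.par y (by omega)
      · rw [h6]
        exact hb.lft x (by omega)

/-- Match the numbers below `n` with the leaves of the tree, and put all states into one block. -/
def buildBlock : RamProg :=
  const rI 0 ;; copy rY rBase ;;
  loop (.lt rI rN) (store aLeaf rI rY ;; store aOff rY rI ;; store aPerm rI rI ;;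
    store aPos rI rI ;; inc rI ;; inc rY) ;;
  store aEn rZero rN ;; store aSz rZero rN ;; store aXe rZero rN ;; const rOne 1

theorem runs_buildBlock {s : RamState} (hN : s.reg rN = n) (hZ : s.reg rZero = 0)
    (hB : s.reg rBlk = 0) (hblk : ∀ v, s.arr aBlk v = 0) (hst : s.arr aSt 0 = 0)
    (hbase : s.reg rBase = 2 ^ h) :
    buildBlock.Runs s fun t s₂ => t ≤ 7 * n + 7 ∧
      SameBut [rI, rY, rOne] [aLeaf, aOff, aPerm, aPos, aEn, aSz, aXe] s s₂ ∧
      (∀ j, j < n → s₂.arr aLeaf j = 2 ^ h + j) ∧ (∀ j, j < n → s₂.arr aOff (2 ^ h + j) = j) ∧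
      SegHolds n s₂ ∧ s₂.intervalEnd 0 = n ∧ s₂.reg rOne = 1 := by
  simp only [buildBlock, runs_seq, runs_const, runs_copy]
  refine (runs_loop_of_count (Φ := fun t s₂ => t ≤ 7 * n + 1 ∧
    SameBut [rI, rY, rOne] [aLeaf, aOff, aPerm, aPos, aEn, aSz, aXe] s s₂ ∧
    ∀ j, j < n → s₂.arr aLeaf j = 2 ^ h + j ∧ s₂.arr aOff (2 ^ h + j) = j ∧ s₂.arr aPerm j = j ∧
      s₂.arr aPos j = j) n
    (fun i t s₂ => s₂.reg rI = i ∧ s₂.reg rY = 2 ^ h + i ∧ t ≤ 7 * i ∧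
    SameBut [rI, rY, rOne] [aLeaf, aOff, aPerm, aPos, aEn, aSz, aXe] s s₂ ∧
    ∀ j, j < i → s₂.arr aLeaf j = 2 ^ h + j ∧ s₂.arr aOff (2 ^ h + j) = j ∧ s₂.arr aPerm j = j ∧
      s₂.arr aPos j = j) ?_ ?_ ?_ ?_).mono ?_
  · exact ⟨by simp [RamState.reg_setReg], by simp [RamState.reg_setReg, hbase], by simp,
      by simp [SameBut.setReg_iff, SameBut.refl], by simp⟩
  · rintro i t s₂ hi ⟨h3, h3', h4, h5, -⟩
    simp only [RamTest.Holds, h3, h5.1 rN (by simp), hN]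
  · rintro i t s₂ hi ⟨h3, h3', h4, h5, h6⟩
    simp only [runs_seq, runs_inc, runs_store,
      RamState.reg_setReg, RamState.reg_setArr, RamState.arr_setReg,
      RamState.arr_setArr, if_true, Nat.reduceEqDiff, if_false, h3, h3',
      SameBut.setReg_iff, SameBut.setArr_iff, List.mem_cons, true_or, or_true, h5, true_and]
    refine ⟨by omega, by omega, fun j hj => ?_⟩
    simp only [Function.update_apply, Nat.add_left_cancel_iff]
    by_cases hji : j = i
    · simp [hji]
    · obtain ⟨a1, a2, a3, a4⟩ := h6 j (by omega)
      simp [hji, a1, a2, a3, a4]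
  · rintro t s₂ ⟨h3, h3', h4, h5⟩
    exact ⟨by omega, h5⟩
  · rintro t₁ s₁ ⟨ht₁, hs₁, hall⟩
    have hZ₁ : s₁.reg rZero = 0 := (hs₁.1 _ (by simp)).trans hZ
    have hN₁ : s₁.reg rN = n := (hs₁.1 _ (by simp)).trans hN
    have hB₁ : s₁.reg rBlk = 0 := (hs₁.1 _ (by simp)).trans hB
    have hblk₁ : s₁.arr aBlk = s.arr aBlk := hs₁.2 _ (by simp)
    have hst₁ : s₁.arr aSt = s.arr aSt := hs₁.2 _ (by simp)
    simp only [runs_store, RamState.reg_setReg, RamState.reg_setArr, RamState.arr_setReg,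
      RamState.arr_setArr, if_true, Nat.reduceEqDiff, if_false, hZ₁, hN₁,
      SameBut.setReg_iff, SameBut.setArr_iff, List.mem_cons, true_or, or_true, hs₁, true_and,
      RamState.intervalEnd, Function.update_self, and_true, SegHolds, hB₁, hblk₁, hst₁]
    refine ⟨by omega, fun j hj => (hall j hj).1, fun j hj => (hall j hj).2.1, ?_⟩
    have e1 : ∀ i, i < n → s₁.arr aPerm i = i := fun i hi => (hall i hi).2.2.1
    have e2 : ∀ i, i < n → s₁.arr aPos i = i := fun i hi => (hall i hi).2.2.2
    refine ⟨fun i hi => by rwa [e1 i hi], fun i hi => by rwa [e2 i hi],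
      fun i hi => by rw [e1 i hi, e2 i hi], fun i hi => by rw [e2 i hi, e1 i hi],
      fun v _ => (hblk v).le, fun v _ => by rw [hblk, hst]; exact Nat.zero_le _, fun v hv => ?_,
      fun b hb => ?_, fun b hb i _ hi => ?_, fun b hb => ?_⟩
    · rw [hblk, Function.update_self, e2 v hv]
      exact hv
    · obtain rfl : b = 0 := by omega
      rw [Function.update_self]
    · rw [hblk]
      omega
    · obtain rfl : b = 0 := by omega
      rw [Function.update_self, Function.update_self, hst, zero_add]

end RamProg

/-! ### The initial partition -/

/-- The key of a state: `0` for the source, which is not the head of an edge, and otherwise one more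
than the letter of the edges with this head. -/
structure LetterKey (n m : ℕ) (letter head key : ℕ → ℕ) : Prop where
  head_lt : ∀ e, e < m → head e < n
  of_edge : ∀ e, e < m → key (head e) = letter e + 1
  exists_edge : ∀ v, v < n → key v ≠ 0 → ∃ e < m, head e = v

/-- The invariant of the loop over the letters from the largest to the smallest, when the letters
from `a` on have been processed: the blocks are ordered by the keys, except that all states with
keys up to `a` are in one block; and two processed edges have the same record iff they have the same
head. -/
structure LetterInv (n m h : ℕ) (letter head key : ℕ → ℕ) (a : ℕ) (s : RamState) : Prop where
  trees : TreeTables n h s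
  head_eq : s.arr aHead = head
  linked : ∀ b, IsLinkedList (s.arr aLnx) (s.arr aLhd b) (edgeList letter m b)
  seg : SegHolds n s
  aux : ∀ d, s.arr aAux d = 0
  tmp : ∀ v, s.arr aTmp v = 0
  tree : TreeHolds h (s.starts n \ {0}) (s.arr aTree)
  zero_mem : 0 ∈ s.starts n
  order : ∀ u v, u < n → v < n → (s.blockStart u < s.blockStart v ↔ key u - a < key v - a)
  rec_pos : ∀ e, e < m → a ≤ letter e → 1 ≤ s.arr aRec e
  rec_le : ∀ e, e < m → s.arr aRec e ≤ s.reg rRec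
  rec_eq : ∀ e e', e < m → e' < m → a ≤ letter e → a ≤ letter e' →
    (s.arr aRec e = s.arr aRec e' ↔ head e = head e')
  count : ∀ r, 1 ≤ r → s.arr aCnt r = countRec m (s.arr aRec) r

namespace RamProg

open RamState

/-- Split off the heads of the edges with the letter `rA`, and give records to these edges. -/
def splitByLetter : RamProg :=
  const rLen 0 ;; load rW aLhd rA ;; scanChain aLnx ;; filterList ;; splitPass false aList rLen

/-- Refine the partition by the letters, from the largest to the smallest. -/
def splitByLetters : RamProg :=
  copy rA rK ;; loop (.ne rA rZero) (dec rA ;; splitByLetter)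

variable {n m h : ℕ} {letter head key : ℕ → ℕ}

theorem runs_splitByLetter (hk : LetterKey n m letter head key) {a : ℕ} {s : RamState}
    (hinv : LetterInv n m h letter head key (a + 1) s) (hA : s.reg rA = a) :
    splitByLetter.Runs s fun t s₂ =>
      t + (5 * h + 7) * (s.starts n).card ≤
        72 * (edgeList letter m a).length + 11 + (5 * h + 7) * (s₂.starts n).card ∧
      SameBut [rW, rY, rV, rZ, rO, rC, rRec, rLen, rI, rLenTwo, rD, rG, rBlk, rTch, rX, rH]
        [aTmp, aList, aOld, aRec, aCnt, aListTwo, aPerm, aPos, aBlk, aSt, aEn, aSz, aAux, aTch,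
          aTree] s s₂ ∧
      LetterInv n m h letter head key a s₂ := by
  simp only [splitByLetter, runs_seq, runs_const, runs_load, RamState.reg_setReg,
    RamState.arr_setReg, Nat.reduceEqDiff, if_false, hA]
  set s₁ := (s.setReg rLen 0).setReg rW (s.arr aLhd a) with hs₁
  have hsame₁ : SameBut [rLen, rW] [] s s₁ := by
    simp [hs₁, SameBut.setReg_iff, SameBut.refl]
  have hW₁ : s₁.reg rW = s.arr aLhd a := by simp [hs₁, RamState.reg_setReg]
  have hL₁ : s₁.reg rLen = 0 := by simp [hs₁, RamState.reg_setReg]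
  refine (runs_scanChain (m := m) (head := head) (rec₀ := s.arr aRec) (k₀ := s.reg rRec)
    (nx := aLnx) (by simp) (edgeList letter m a) ∅ s₁
    ((hsame₁.1 _ (by simp)).trans hinv.trees.zero) ((hsame₁.2 _ (by simp)).trans hinv.head_eq) ?_
    (by rw [hW₁]; exact hinv.linked a) (nodup_edgeList _ _ _) (fun e he => (mem_edgeList.1 he).1)
    (by simp)).mono ?_
  · unfold ScanHolds
    rw [hL₁, hsame₁.1 rRec (by simp)]
    exact ScanInv.start hinv.rec_le hinv.tmp hinv.count
  rintro t₂ s₂ ⟨ht₂, hsame₂, hscan, hlen₂⟩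
  have hE : (∅ : Set ℕ) ∪ {e | e ∈ edgeList letter m a} = {e | e < m ∧ letter e = a} := by
    ext e
    simp [mem_edgeList]
  rw [hE] at hscan
  refine (runs_filterList ((hsame₂.1 rZero (by simp)).trans ((hsame₁.1 _ (by simp)).trans
    hinv.trees.zero)) hscan.enum (fun v hv => not_not.1 hv)).mono ?_
  rintro t₃ s₃ ⟨ht₃, hsame₃, htmp₃, -, -⟩
  have hs03 : SameBut [rW, rY, rV, rZ, rO, rC, rRec, rLen, rI, rLenTwo]
      [aTmp, aList, aOld, aRec, aCnt, aListTwo] s s₃ :=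
    (hsame₁.mono (by simp +contextual) (by simp)).trans
      ((hsame₂.mono (by simp +contextual) (by simp +contextual)).trans
      (hsame₃.mono (by simp +contextual) (by simp +contextual)))
  have hst₃ := hs03.starts_eq (n := n) (by simp)
  have hbs₃ := hs03.blockStart_eq (by simp)
  have hlen₃ : s₃.reg rLen = s₂.reg rLen := hsame₃.1 _ (by simp)
  have htab₃ := hinv.trees.of_sameBut hs03 (by simp) (by simp)
  -- the list consists of the states with the key `a + 1`
  have hZ : ∀ v, v < n → (v ∈ {v | s₂.arr aTmp v ≠ 0} ↔ key v = a + 1) := by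
    intro v hv
    rw [Set.mem_ofPred_eq, hscan.tmp_ne]
    constructor
    · rintro ⟨e, ⟨he, rfl⟩, rfl⟩
      exact hk.of_edge e he
    · intro hkv
      obtain ⟨e, he, rfl⟩ := hk.exists_edge v hv (by omega)
      have := hk.of_edge e he
      exact ⟨e, ⟨he, by omega⟩, rfl⟩
  refine (runs_splitPass (n := n) (h := h) (front := false) (la := aList) (rl := rLen) (W := {0})
    (by simp) (by simp) htab₃ (hinv.seg.of_sameBut hs03 (by simp) (by simp))
    (hs03.2 aAux (by simp) ▸ hinv.aux) (by
      rw [hlen₃, hsame₃.2 aList (by simp)]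
      exact hscan.enum) (fun v hv => ?_) (by
      rw [hst₃, hs03.2 aTree (by simp)]
      exact hinv.tree) (by
      rw [hst₃, Finset.singleton_subset_iff]
      exact hinv.zero_mem)).mono ?_
  · obtain ⟨e, he, rfl⟩ := (hscan.tmp_ne v).1 hv
    exact hk.head_lt e he.1
  rintro t₄ s₄ ⟨ht₄, hres⟩
  have hsame : SameBut [rW, rY, rV, rZ, rO, rC, rRec, rLen, rI, rLenTwo, rD, rG, rBlk, rTch, rX, rH]
      [aTmp, aList, aOld, aRec, aCnt, aListTwo, aPerm, aPos, aBlk, aSt, aEn, aSz, aAux, aTch,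
        aTree] s s₄ :=
    (hs03.mono (by simp +contextual) (by simp +contextual)).trans
      (hres.same.mono (by simp +contextual) (by simp +contextual))
  have hrec : s₄.arr aRec = s₂.arr aRec :=
    (hres.same.2 _ (by simp)).trans (hsame₃.2 _ (by simp))
  have hrrec : s₄.reg rRec = s₂.reg rRec :=
    (hres.same.1 _ (by simp)).trans (hsame₃.1 _ (by simp))
  have hcnt : s₄.arr aCnt = s₂.arr aCnt :=
    (hres.same.2 _ (by simp)).trans (hsame₃.2 _ (by simp))
  have hin : ∀ e, e < m → letter e = a → s₂.arr aRec e = s₂.arr aTmp (head e) ∧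
      s₂.arr aTmp (head e) ≠ 0 := fun e he hb =>
    ⟨hscan.rec_of_mem e ⟨he, hb⟩, (hscan.tmp_ne _).2 ⟨e, ⟨he, hb⟩, rfl⟩⟩
  have hout : ∀ e, letter e ≠ a → s₂.arr aRec e = s.arr aRec e := fun e hb =>
    hscan.rec_of_notMem e fun hc => hb hc.2
  have hle := hscan.le
  refine ⟨?_, hsame, htab₃.of_sameBut hres.same (by simp) (by simp), ?_, ?_, hres.seg, hres.aux,
    ?_, hres.tree, ?_, ?_, ?_, ?_, ?_, ?_⟩
  · rw [hst₃] at ht₄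
    omega
  · exact (hsame.2 _ (by simp)).trans hinv.head_eq
  · rw [hsame.2 aLnx (by simp), hsame.2 aLhd (by simp)]
    exact hinv.linked
  · rw [hres.same.2 aTmp (by simp)]
    exact htmp₃
  · exact hres.subset (hst₃ ▸ hinv.zero_mem)
  · intro u v hu hv
    have h1 := hres.lt_iff u v hu hv
    have h2 := hinv.order u v hu hv
    have h3 := hinv.order v u hv hu
    rw [hbs₃] at h1
    rw [h1]
    simp only [cond_false, hZ u hu, hZ v hv]
    omega
  · intro e he hae
    rw [hrec]
    by_cases hb : letter e = a
    · obtain ⟨h1, h2⟩ := hin e he hb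
      omega
    · rw [hout e hb]
      exact hinv.rec_pos e he (by omega)
  · intro e he
    rw [hrec, hrrec]
    by_cases hb : letter e = a
    · obtain ⟨h1, h2⟩ := hin e he hb
      rw [h1]
      exact (hscan.tmp_mem _ h2).2
    · rw [hout e hb]
      exact (hinv.rec_le e he).trans hle
  · intro e e' he he' hae hae'
    rw [hrec]
    have k1 := hk.of_edge e he
    have k2 := hk.of_edge e' he'
    by_cases hb : letter e = a <;> by_cases hb' : letter e' = a
    · obtain ⟨h1, h2⟩ := hin e he hb
      obtain ⟨h1', h2'⟩ := hin e' he' hb'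
      rw [h1, h1']
      exact ⟨fun h => hscan.tmp_inj _ _ h2 h, fun h => by rw [h]⟩
    · obtain ⟨h1, h2⟩ := hin e he hb
      have h3 := (hscan.tmp_mem _ h2).1
      have h4 := hinv.rec_le e' he'
      rw [h1, hout e' hb']
      refine iff_of_false (by omega) fun hc => ?_
      rw [hc] at k1
      omega
    · obtain ⟨h1, h2⟩ := hin e' he' hb'
      have h3 := (hscan.tmp_mem _ h2).1
      have h4 := hinv.rec_le e he
      rw [h1, hout e hb]
      refine iff_of_false (by omega) fun hc => ?_
      rw [hc] at k1
      omega
    · rw [hout e hb, hout e' hb']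
      exact hinv.rec_eq e e' he he' (by omega) (by omega)
  · rw [hcnt, hrec]
    exact hscan.count

theorem runs_splitByLetters {k : ℕ} (hk : LetterKey n m letter head key) {s : RamState}
    (hinv : LetterInv n m h letter head key k s) (hK : s.reg rK = k) :
    splitByLetters.Runs s fun t s₂ => t ≤ 72 * m + 13 * k + (5 * h + 7) * n + 2 ∧
      SameBut [rA, rW, rY, rV, rZ, rO, rC, rRec, rLen, rI, rLenTwo, rD, rG, rBlk, rTch, rX, rH]
        [aTmp, aList, aOld, aRec, aCnt, aListTwo, aPerm, aPos, aBlk, aSt, aEn, aSz, aAux, aTch,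
          aTree] s s₂ ∧
      LetterInv n m h letter head key 0 s₂ := by
  have setA : ∀ {a y : ℕ} {s : RamState}, LetterInv n m h letter head key a s →
      LetterInv n m h letter head key a (s.setReg rA y) := by
    rintro a y s ⟨⟨a1, a2, a3, a4, a5, a6, a7⟩, b2, b3, b4, b5, b6, b7, b8, b9, b10, b11, b12, b13⟩
    refine ⟨⟨?_, ?_, a3, a4, a5, a6, a7⟩, b2, b3, ?_, b5, b6, b7, b8, b9, b10, ?_, b12, b13⟩
    · simpa [RamState.reg_setReg] using a1
    · simpa [RamState.reg_setReg] using a2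
    · simpa [SegHolds, RamState.reg_setReg, RamState.arr_setReg] using b4
    · simpa [RamState.reg_setReg, RamState.arr_setReg] using b11
  rw [splitByLetters, runs_seq, runs_copy, hK]
  refine runs_loop_of_count k (fun i t s₂ => s₂.reg rA = k - i ∧
    t + (5 * h + 7) * (s.starts n).card ≤
      72 * ∑ a ∈ Finset.Ico (k - i) k, (edgeList letter m a).length + 13 * i +
        (5 * h + 7) * (s₂.starts n).card ∧
    SameBut [rA, rW, rY, rV, rZ, rO, rC, rRec, rLen, rI, rLenTwo, rD, rG, rBlk, rTch, rX, rH]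
        [aTmp, aList, aOld, aRec, aCnt, aListTwo, aPerm, aPos, aBlk, aSt, aEn, aSz, aAux, aTch,
          aTree] s s₂ ∧
    LetterInv n m h letter head key (k - i) s₂) ?_ ?_ ?_ ?_
  · refine ⟨by simp [RamState.reg_setReg], ?_, by simp [SameBut.setReg_iff, SameBut.refl],
      setA hinv⟩
    rw [show (s.setReg rA k).starts n = s.starts n from rfl]
    omega
  · rintro i t s₂ hi ⟨h1, h2, h3, h4⟩
    simp only [RamTest.Holds, h1, h4.trees.zero]
    omega
  · rintro i t s₂ hi ⟨h1, h2, h3, h4⟩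
    rw [runs_seq, runs_dec, h1]
    obtain ⟨a, ha⟩ : ∃ a, k - i = a + 1 := ⟨k - i - 1, by omega⟩
    have ha' : k - (i + 1) = a := by omega
    rw [ha] at h2 h4 ⊢
    rw [Nat.add_sub_cancel]
    refine (runs_splitByLetter hk (setA h4) (by simp [RamState.reg_setReg])).mono ?_
    rintro t₃ s₃ ⟨ht₃, hsame₃, hinv₃⟩
    rw [show (s₂.setReg rA a).starts n = s₂.starts n from rfl] at ht₃
    rw [ha', Finset.sum_eq_sum_Ico_succ_bot (by omega)]
    refine ⟨?_, by omega, ?_, hinv₃⟩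
    · rw [hsame₃.1 rA (by simp)]
      simp [RamState.reg_setReg]
    · refine SameBut.trans (s₂ := s₂.setReg rA a) ?_
        (hsame₃.mono (by simp +contextual) (by simp +contextual))
      simpa [SameBut.setReg_iff] using h3
  · rintro t s₂ ⟨h1, h2, h3, h4⟩
    rw [Nat.sub_self] at h2 h4
    have hS : (s₂.starts n).card ≤ n := Finset.card_image_le.trans (by simp)
    have h5 : (5 * h + 7) * (s₂.starts n).card ≤ (5 * h + 7) * n := Nat.mul_le_mul_left _ hS
    have h6 := sum_length_edgeList_le letter k m
    rw [Finset.range_eq_Ico] at h6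
    exact ⟨by omega, h3, h4⟩

theorem _root_.LetterInv.mainInv {tail : ℕ → ℕ} {s : RamState} (hn : 1 ≤ n)
    (hk : LetterKey n m letter head key) (hinv : LetterInv n m h letter head key 0 s)
    (hone : s.reg rOne = 1) (hN : s.reg rN = n) (hend : s.intervalEnd 0 = n)
    (htail : ∀ e, e < m → tail e < n)
    (hlinked : ∀ u, IsLinkedList (s.arr aNx) (s.arr aHd u) (edgeList tail m u)) :
    MainInv n m h tail head (edgeList tail m) (fun _ => 0) s := by
  have hI : intervalStarts n (fun _ => 0) = {0} := by
    ext i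
    rw [mem_intervalStarts, Finset.mem_singleton]
    exact ⟨fun ⟨_, _, e⟩ => e.symm, fun e => ⟨0, hn, e.symm⟩⟩
  refine ⟨hinv.trees, ⟨hone, hN, hinv.head_eq, fun u _ => hlinked u,
    fun u _ => nodup_edgeList _ _ _,
    fun u _ e => mem_edgeList, htail, hk.head_lt⟩, hinv.seg, hinv.aux, hinv.tmp, ?_, ?_, ?_⟩
  · rw [hI]
    exact hinv.tree
  · refine ⟨fun v _ => Nat.zero_le _, fun v hv => ?_, fun u v _ _ hlt => absurd hlt (lt_irrefl 0),
      fun v _ => mem_starts.1 hinv.zero_mem, fun v _ => hend.le⟩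
    rw [hend]
    exact hinv.seg.end_le hv
  · refine ⟨fun e he => hinv.rec_pos e he (Nat.zero_le _), hinv.rec_le, fun e e' he he' => ?_,
      hinv.count⟩
    rw [hinv.rec_eq e e' he he' (Nat.zero_le _) (Nat.zero_le _)]
    simp

/-- Compute the initial configuration of the algorithm. -/
def prepare : RamProg := buildLists ;; buildTree ;; buildBlock ;; splitByLetters

theorem runs_prepare {k : ℕ} {s : RamState} (hn : 1 ≤ n) (hN : s.reg rN = n) (hK : s.reg rK = k)
    (hM : s.reg rM = m) (hreg : ∀ x, 4 ≤ x → s.reg x = 0) (harr : ∀ a, 3 ≤ a → ∀ i, s.arr a i = 0)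
    (hk : LetterKey n m (s.arr aLet) (s.arr aHead) key) (hle : ∀ v, v < n → key v ≤ k)
    (htail : ∀ e, e < m → s.arr aTail e < n) :
    prepare.Runs s fun t s₂ => ∃ h, 2 ^ h < 2 * n ∧
      t ≤ 82 * m + 13 * k + (5 * h + 32) * n + 17 ∧
      MainInv n m h (s.arr aTail) (s.arr aHead) (edgeList (s.arr aTail) m) (fun _ => 0) s₂ ∧
      ∀ u v, u < n → v < n → (s₂.blockStart u < s₂.blockStart v ↔ key u < key v) := by
  simp only [prepare, runs_seq]
  refine (runs_buildLists hM (harr _ (by norm_num)) (harr _ (by norm_num))).mono ?_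
  rintro t₁ s₁ ⟨ht₁, hs₁, hl₁, hl₁'⟩
  refine (runs_buildTree ((hs₁.1 rN (by simp)).trans hN) hn).mono ?_
  rintro t₂ s₂ ⟨ht₂, hs₁₂, h, hbase, hnh, hhn, hpar, hlft⟩
  have hs₂ : SameBut [rI, rU, rV, rW, rP, rC, rBase] [aHd, aNx, aLhd, aLnx, aLft, aPar] s s₂ :=
    (hs₁.mono (by simp +contextual) (by simp +contextual)).trans
      (hs₁₂.mono (by simp +contextual) (by simp +contextual))
  have hz₂ : ∀ a, 3 ≤ a → a ∉ [aHd, aNx, aLhd, aLnx, aLft, aPar] → ∀ i, s₂.arr a i = 0 :=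
    fun a ha hna i => (congrFun (hs₂.2 a hna) i).trans (harr a ha i)
  refine (runs_buildBlock (n := n) (h := h) ((hs₂.1 rN (by simp)).trans hN)
    ((hs₂.1 rZero (by simp)).trans (hreg _ (by norm_num)))
    ((hs₂.1 rBlk (by simp)).trans (hreg _ (by norm_num)))
    (hz₂ aBlk (by norm_num) (by simp)) (hz₂ aSt (by norm_num) (by simp) 0) hbase).mono ?_
  rintro t₃ s₃ ⟨ht₃, hs₂₃, hleaf, hoff, hseg, hend, hone⟩
  have hs₃ : SameBut [rI, rU, rV, rW, rP, rC, rBase, rY, rOne]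
      [aHd, aNx, aLhd, aLnx, aLft, aPar, aLeaf, aOff, aPerm, aPos, aEn, aSz, aXe] s s₃ :=
    (hs₂.mono (by simp +contextual) (by simp +contextual)).trans
      (hs₂₃.mono (by simp +contextual) (by simp +contextual))
  have hz₃ : ∀ a, 3 ≤ a → a ∉ [aHd, aNx, aLhd, aLnx, aLft, aPar, aLeaf, aOff, aPerm, aPos, aEn,
      aSz, aXe] → ∀ i, s₃.arr a i = 0 :=
    fun a ha hna i => (congrFun (hs₃.2 a hna) i).trans (harr a ha i)
  have hs₁₃ : SameBut [rI, rP, rC, rBase, rY, rOne]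
      [aLft, aPar, aLeaf, aOff, aPerm, aPos, aEn, aSz, aXe] s₁ s₃ :=
    (hs₁₂.mono (by simp +contextual) (by simp +contextual)).trans
      (hs₂₃.mono (by simp +contextual) (by simp +contextual))
  have hst₃ : ∀ v, s₃.blockStart v = 0 := fun v => by
    unfold blockStart
    rw [hz₃ aBlk (by norm_num) (by simp), hz₃ aSt (by norm_num) (by simp)]
  have hstarts : s₃.starts n = {0} := by
    ext i
    rw [mem_starts, Finset.mem_singleton]
    exact ⟨fun ⟨v, _, e⟩ => e ▸ (hst₃ v), fun e => ⟨0, hn, e ▸ hst₃ 0⟩⟩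
  have hrec : ∀ e, s₃.arr aRec e = 0 := hz₃ aRec (by norm_num) (by simp)
  have hinv₃ : LetterInv n m h (s.arr aLet) (s.arr aHead) key k s₃ := by
    have hlet : ∀ e, e < m → s.arr aLet e < k := fun e he => by
      have h1 := hk.of_edge e he
      have h2 := hle _ (hk.head_lt e he)
      omega
    refine ⟨⟨(hs₃.1 rZero (by simp)).trans (hreg _ (by norm_num)), ?_, ?_, ?_, hleaf, hoff, hnh⟩,
      hs₃.2 aHead (by simp), ?_, hseg, hz₃ aAux (by norm_num) (by simp),
      hz₃ aTmp (by norm_num) (by simp), ?_, ?_, ?_, ?_, ?_, ?_, ?_⟩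
    · rw [hs₂₃.1 rBase (by simp), hbase]
    · rw [hs₂₃.2 aPar (by simp)]
      exact hpar
    · rw [hs₂₃.2 aLft (by simp)]
      exact hlft
    · rw [hs₁₃.2 aLnx (by simp), hs₁₃.2 aLhd (by simp)]
      exact hl₁'
    · intro y _
      rw [hstarts, hz₃ aTree (by norm_num) (by simp)]
      simp
    · simp [hstarts]
    · intro u v hu hv
      have h1 := hle u hu
      have h2 := hle v hv
      rw [hst₃, hst₃]
      omega
    · intro e he hke
      have := hlet e he
      omega
    · intro e he
      rw [hrec]
      exact Nat.zero_le _
    · intro e e' he he' hke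
      have := hlet e he
      omega
    · intro r hr
      rw [hz₃ aCnt (by norm_num) (by simp), countRec, eq_comm, Finset.card_eq_zero,
        Finset.filter_eq_empty_iff]
      intro e _
      rw [hrec]
      omega
  refine (runs_splitByLetters hk hinv₃ ((hs₃.1 rK (by simp)).trans hK)).mono ?_
  rintro t₄ s₄ ⟨ht₄, hs₄, hinv₄⟩
  refine ⟨h, hhn, ?_, hinv₄.mainInv hn hk ((hs₄.1 rOne (by simp)).trans hone)
    ((hs₄.1 rN (by simp)).trans ((hs₃.1 rN (by simp)).trans hN)) ?_ htail ?_, hinv₄.order⟩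
  · rw [show (5 * h + 32) * n = (5 * h + 7) * n + 25 * n by ring]
    omega
  · unfold intervalEnd
    rw [hs₄.2 aXe (by simp)]
    exact hend
  · rw [hs₄.2 aNx (by simp), hs₄.2 aHd (by simp), hs₁₃.2 aNx (by simp), hs₁₃.2 aHd (by simp)]
    exact hl₁

end RamProg

/-! ### The complete program -/

section

variable {Sig Q : Type*}

namespace SourceNFA

section

variable {A : SourceNFA Sig Q} {n k : ℕ} {T : List (Q × Sig × Q)}

theorem Lists.ncard_transitions (hT : A.Lists T) : A.transitions.ncard = T.length := by
  classical
  rw [← List.toFinset_card_of_nodup hT.1, ← Set.ncard_coe_finset]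
  congr 1
  ext t
  simp [hT.2]

theorem Lists.card_states_le (hA : A.Standard) (hT : A.Lists T) (e : Q ≃ Fin n) :
    n ≤ T.length + 1 := by
  classical
  have hex : ∀ v : {v // v ≠ A.src}, ∃ i : Fin T.length, T[i].2.2 = v := by
    rintro ⟨v, hv⟩
    obtain ⟨u, a, hs⟩ := hA.exists_step hv
    obtain ⟨i, hi, hti⟩ := List.getElem_of_mem ((hT.2 (u, a, v)).2 hs)
    exact ⟨⟨i, hi⟩, by simp [hti]⟩
  choose g hg using hex
  have hinj : Function.Injective g := fun a b hab => Subtype.ext ((hg a).symm.trans (hab ▸ hg b))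
  have : Fintype Q := Fintype.ofEquiv _ e.symm
  have h1 := Fintype.card_le_of_injective g hinj
  have h2 : Fintype.card {v // v ≠ A.src} = Fintype.card Q - 1 := by
    rw [Fintype.card_subtype_compl, Fintype.card_subtype_eq]
  have h3 : Fintype.card Q = n := by simpa using Fintype.card_congr e
  rw [h2, h3, Fintype.card_fin] at h1
  omega

/-- There is a transition, and it does not lead to the source. -/
theorem Standard.two_le_card [Nonempty Sig] (hA : A.Standard) (e : Q ≃ Fin n) : 2 ≤ n := by
  obtain ⟨a⟩ := ‹Nonempty Sig›
  obtain ⟨u, v, hs⟩ := hA.letter_used a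
  have hne : e v ≠ e A.src := fun h => hA.not_mem_src u a (e.injective h ▸ hs)
  have h1 := (e v).2
  have h2 := (e A.src).2
  have h3 : (e v : ℕ) ≠ e A.src := fun h => hne (Fin.ext h)
  omega

variable [LE Sig] {e : Q ≃ Fin n} {f : Sig ≃o Fin k} {i : ℕ}

theorem encode_tail (hi : i < T.length) : (A.encode e f T).arr aTail i = e T[i].1 := by
  simp [encode, hi]

theorem encode_letter (hi : i < T.length) : (A.encode e f T).arr aLet i = f T[i].2.1 := by
  simp [encode, hi]

theorem encode_head (hi : i < T.length) : (A.encode e f T).arr aHead i = e T[i].2.2 := by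
  simp [encode, hi]

theorem encode_reg (x : ℕ) (hx : 4 ≤ x) : (A.encode e f T).reg x = 0 := by
  obtain ⟨y, rfl⟩ := Nat.exists_eq_add_of_le' hx
  rfl

theorem encode_arr (a : ℕ) (ha : 3 ≤ a) (i : ℕ) : (A.encode e f T).arr a i = 0 := by
  obtain ⟨y, rfl⟩ := Nat.exists_eq_add_of_le' ha
  rfl

theorem Lists.hasEdges (hT : A.Lists T) : A.HasEdges e T.length ((A.encode e f T).arr aTail)
    ((A.encode e f T).arr aHead) := by
  intro u v
  constructor
  · rintro ⟨a, hs⟩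
    obtain ⟨i, hi, hti⟩ := List.getElem_of_mem ((hT.2 (u, a, v)).2 hs)
    exact ⟨i, hi, by rw [encode_tail hi, hti], by rw [encode_head hi, hti]⟩
  · rintro ⟨i, hi, h1, h2⟩
    rw [encode_tail hi] at h1
    rw [encode_head hi] at h2
    have h1 := e.injective (Fin.ext h1)
    have h2 := e.injective (Fin.ext h2)
    refine ⟨T[i].2.1, ?_⟩
    have := (hT.2 T[i]).1 (List.getElem_mem hi)
    rw [← h1, ← h2]
    exact this

/-- The letters of the transitions are keys of the numbered states. -/
theorem Lists.letterKey (hA : A.Standard) (hT : A.Lists T) {key : Q → ℕ}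
    (hkey : A.LetterRank (fun a => f a) key) {num : ℕ → ℕ} (hnum : ∀ u, num (e u) = key u) :
    LetterKey n T.length ((A.encode e f T).arr aLet) ((A.encode e f T).arr aHead) num := by
  refine ⟨fun i hi => ?_, fun i hi => ?_, fun v hv hne => ?_⟩
  · rw [encode_head hi]
    exact (e _).2
  · rw [encode_head hi, encode_letter hi, hnum]
    exact hkey.step T[i].1 _ _ ((hT.2 _).1 (List.getElem_mem hi))
  · have hev : v = e (e.symm ⟨v, hv⟩) := by simp
    rw [hev, hnum] at hne
    have hsrc : e.symm ⟨v, hv⟩ ≠ A.src := by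
      intro hc
      rw [hc, hkey.src] at hne
      exact hne rfl
    obtain ⟨u, a, hs⟩ := hA.exists_step hsrc
    obtain ⟨i, hi, hti⟩ := List.getElem_of_mem ((hT.2 (u, a, e.symm ⟨v, hv⟩)).2 hs)
    exact ⟨i, hi, by rw [encode_head hi, hti]; exact hev.symm⟩

theorem Lists.card_letters_le (hA : A.Standard) (hT : A.Lists T) (f : Sig ≃o Fin k) :
    k ≤ T.length := by
  have hex : ∀ a : Fin k, ∃ i : Fin T.length, T[i].2.1 = f.symm a := by
    intro a
    obtain ⟨u, v, hs⟩ := hA.letter_used (f.symm a)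
    obtain ⟨i, hi, hti⟩ := List.getElem_of_mem ((hT.2 (u, f.symm a, v)).2 hs)
    exact ⟨⟨i, hi⟩, by simp [hti]⟩
  choose g hg using hex
  have hinj : Function.Injective g := fun a b hab => by
    have h := (hg a).symm.trans (hab ▸ hg b)
    exact f.symm.injective h
  simpa using Fintype.card_le_of_injective g hinj

end

end SourceNFA

namespace RamProg

/-- The program for ordered partition refinement. -/
def refinement : RamProg := prepare ;; mainLoop ;; writeOutput

/-- The number of states is at most one more than the number `m` of edges, the number of letters is
at most `m`, and the height of the tree is at most `log₂ n + 1 ≤ 2 * log₂ n`. -/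
theorem runs_refinement [Fintype Sig] [LinearOrder Sig] [Nonempty Sig] {A : SourceNFA Sig Q}
    (hA : A.Standard) {n k : ℕ} (e : Q ≃ Fin n) (f : Sig ≃o Fin k) {T : List (Q × Sig × Q)}
    (hT : A.Lists T) :
    refinement.Runs (A.encode e f T) fun t s₂ => t ≤ 600 * (T.length * Nat.log 2 n) ∧
      ∃ P, A.RefineReturns P ∧ HoldsPartition e s₂ P := by
  have hn := hA.two_le_card e
  have hnm := hT.card_states_le hA e
  have hkm := hT.card_letters_le hA f
  have hg : StrictMono fun a => (f a : ℕ) := fun a b hab => by simpa using hab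
  obtain ⟨key, hkey⟩ := hA.exists_letterRank fun a => (f a : ℕ)
  set num : ℕ → ℕ := fun v => if h : v < n then key (e.symm ⟨v, h⟩) else 0 with hnumdef
  have hnum : ∀ u, num (e u) = key u := fun u => by simp [hnumdef]
  have hinit := SourceNFA.refineInv_init hA hg hkey
  have hle : ∀ v, v < n → num v ≤ k := by
    intro v hv
    have hev : v = e (e.symm ⟨v, hv⟩) := by simp
    rw [hev, hnum]
    by_cases hs : e.symm ⟨v, hv⟩ = A.src
    · rw [hs, hkey.src]
      exact Nat.zero_le _
    · obtain ⟨u, a, hstep⟩ := hA.exists_step hs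
      rw [hkey.step u _ a hstep]
      exact (f a).2
  rw [refinement, runs_seq]
  refine (runs_prepare (n := n) (m := T.length) (k := k) (by omega) rfl rfl rfl SourceNFA.encode_reg
    SourceNFA.encode_arr (hT.letterKey hA hkey hnum) hle fun i hi => by
      rw [SourceNFA.encode_tail hi]
      exact (e _).2).mono ?_
  rintro t₁ s₁ ⟨h, hh, ht₁, hinv, hord⟩
  have hmod : Models e s₁.blockStart (fun _ => 0) A.refineInit := by
    refine ⟨hinit.ranksP.of_order fun u v => ?_, hinit.ranksX⟩
    rw [hord _ _ (e u).2 (e v).2, hnum, hnum]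
  rw [runs_seq]
  refine (runs_mainLoop (n := n) hT.hasEdges hinv hmod).mono ?_
  rintro t₂ s₂ ⟨ht₂, hseg, hN, P, hreach, hP⟩
  refine (runs_writeOutput (n := n) hN hseg).mono ?_
  rintro t₃ s₃ ⟨ht₃, hout⟩
  refine ⟨?_, P, ⟨⟨P, P⟩, hreach, rfl, rfl⟩, fun i hi u hu => ?_⟩
  · have hlog : 1 ≤ Nat.log 2 n := Nat.log_pos (by norm_num) hn
    have hhl : h ≤ 2 * Nat.log 2 n := by
      have h1 : n < 2 ^ (Nat.log 2 n + 1) := Nat.lt_pow_succ_log_self (by norm_num) n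
      have h2 : 2 ^ h < 2 ^ (Nat.log 2 n + 2) := by
        rw [pow_succ]
        omega
      have := (Nat.pow_lt_pow_iff_right (by norm_num : 1 < 2)).1 h2
      omega
    have hpot : potential n (fun u => 113 * (edgeList ((A.encode e f T).arr aTail) T.length
        u).length + 5) (fun _ => 0) ≤ (113 * T.length + 5 * n) * Nat.log 2 n := by
      unfold potential
      simp only [Finset.filter_true, Finset.card_range]
      rw [← Finset.sum_mul, Finset.sum_add_distrib, ← Finset.mul_sum]
      refine Nat.mul_le_mul_right _ (Nat.add_le_add (Nat.mul_le_mul_left _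
        (sum_length_edgeList_le _ _ _)) ?_)
      simp [mul_comm]
    generalize Nat.log 2 n = l at hlog hhl hpot ⊢
    generalize T.length = m at *
    have b1 : m ≤ m * l := Nat.le_mul_of_pos_right m hlog
    have b2 : n * l ≤ 2 * (m * l) := by
      rw [← mul_assoc]
      exact Nat.mul_le_mul_right _ (by omega)
    have b3 : h * n ≤ 4 * (m * l) := by
      calc h * n ≤ 2 * l * n := Nat.mul_le_mul_right _ hhl
        _ = 2 * (n * l) := by ring
        _ ≤ _ := by omega
    rw [add_mul, mul_assoc] at ht₁ ht₂
    rw [add_mul, mul_assoc, mul_assoc] at hpot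
    omega
  · rw [hout _ (e u).2]
    exact hP.card_lt_eq hi hu

end RamProg

end

/-- There is one machine program, and one constant `C`, such that for all automata:
the ordered partition refinement algorithm always terminates (however ties in the choice of the
splitter are broken); every ordered partition that it can return gives a total preorder, which is
a Wheeler preorder if and only if the automaton is quasi-Wheeler; and the program computes such an
ordered partition in at most `C * (|δ| * log |Q|)` steps. -/
theorem theorem1 :
    ∃ (prog : RamProg) (C : ℝ),
      ∀ (Sig : Type*) [Fintype Sig] [LinearOrder Sig] [Nonempty Sig]
        (Q : Type*) [Finite Q] (A : SourceNFA Sig Q), A.Standard →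
        -- every run of the algorithm terminates, and does not get stuck inside the loop
        Acc (fun d c => A.RefineIter c d) A.refineInit ∧
        (∀ c, A.RefineReaches c → c.X ≠ c.P → ∃ d, A.RefineIter c d) ∧
        -- the returned ordered partition is a total preorder, and is Wheeler iff possible
        (∀ P, A.RefineReturns P →
          IsOrderedPartition P ∧ TotalPreorderRel (partLE P) ∧
          (A.IsWheelerPreorder (partLE P) ↔ A.QuasiWheeler)) ∧
        -- the program computes a returned ordered partition within the time bound
        (∀ (e : Q ≃ Fin (Nat.card Q)) (f : Sig ≃o Fin (Nat.card Sig)) (T : List (Q × Sig × Q)),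
          A.Lists T →
          ∃ (P : List (Set Q)) (t : ℕ) (s : RamState),
            A.RefineReturns P ∧ RamExec prog (A.encode e f T) t s ∧ HoldsPartition e s P ∧
            (t : ℝ) ≤ C * ((A.transitions.ncard : ℝ) * Real.logb 2 (Nat.card Q))) := by
  refine ⟨RamProg.refinement, 600, fun Sig _ _ _ Q _ A hA => ⟨hA.acc_refineInit, ?_, ?_, ?_⟩⟩
  · intro c hc hne
    obtain ⟨r, x, h⟩ := hA.exists_refineInv hc
    exact h.exists_iter hne
  · rintro P ⟨⟨X, P⟩, hc, he, rfl⟩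
    obtain rfl : X = P := he
    obtain ⟨r, x, h⟩ := hA.exists_refineInv hc
    exact ⟨h.ranksP.isOrderedPartition, h.ranksP.totalPreorderRel, h.isWheelerPreorder_iff⟩
  · intro e f T hT
    obtain ⟨t, s, hexec, ht, P, hP, hs⟩ := RamProg.runs_refinement hA e f hT
    refine ⟨P, t, s, hP, hexec, hs, ?_⟩
    have h1 : (t : ℝ) ≤ 600 * (T.length * Nat.log 2 (Nat.card Q)) := by exact_mod_cast ht
    rw [hT.ncard_transitions]
    refine h1.trans ?_
    gcongr
    exact Real.natLog_le_logb _ _
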